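/- **Theorem 3.6 (Unbounded operators on graphs).** *Setting.* For a closed densely defined operator $A$ on $\ell^2(\mathbb N)$ or $\ell^2(V)$ write $\mathrm{Sp}(A)$ for its spectrum, $R(z,A)=(A-z)^{-1}$ (with $\|R(z,A)\|^{-1}=0$ for $z\in\mathrm{Sp}(A)$), and, for $\epsilon>0$, $\mathrm{Sp}_\epsilon(A)=\mathrm{cl}\{z:\|R(z,A)\|>1/\epsilon\}$ (where $\|R(z,A)\|=\infty$ on $\mathrm{Sp}(A)$). Let $\mathrm{Cl}(\mathbb C)$ be the set of non-empty closed subsets of $\mathbb C$ with the Attouch–Wets metric $$d_{\mathrm{AW}}(C,D)=\sum_{n\ge1}2^{-n}\min\Big\{1,\sup_{|x|\le n}|\mathrm{dist}(x,C)-\mathrm{dist}(x,D)|\Big\}.$$ Fix $\epsilon>0$, a function $f:\mathbb N\to\mathbb N$ with $f(n)\ge n$, and continuous strictly increasing functions $g_m:[0,\infty)\to[0,\infty)$ ($m=0,1,2,\dots$) which vanish only at $0$ and diverge at $\infty$. - $\hat\Omega$: all pairs of a closed densely defined $A$ on $\ell^2(\mathbb N)$ with $\mathrm{Sp}(A)\neq\emptyset$,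 for which $\mathrm{span}\{e_n\}$ is a core of $A$ and of $A^*$, and a null sequence $(c_n)\subset\mathbb Q$ with $\max\{\|(I-P_{f(n)})AP_n\|,\|(I-P_{f(n)})A^*P_n\|\}\le c_n$ for all $n$, where $P_n$ is the projection onto the span of the first $n$ basis vectors. $\Omega_D\subset\hat\Omega$: those with $A$ diagonal. $\Omega_g\subset\hat\Omega$: those with $g_m(\mathrm{dist}(z,\mathrm{Sp}(A)))\le\|R(z,A)\|^{-1}$ for all $m$ and $|z|\le m$. Available information: the matrix elements $\langle Ae_j,e_i\rangle$, the numbers $f(n)$ and $c_n$, for $\Omega_g$ also the values $g_m(q)$ at rational $q\ge0$, and for the pseudospectrum the number $\epsilon$. - Let $\mathcal G$ be a connected undirected graph with countably infinite vertex set $V$, enumerated as $(v_n)$. $\Omega^{\mathcal G}$: all pairs of a closed densely defined $A=\sum_{v,w}\alpha(v,w)|v\rangle\langle w|$ on $\ell^2(V)$ with $\mathrm{Sp}(A)\ne\emptyset$, for which the span of the canonical basis is a core of $A$ and of $A^*$, and a function $S:\mathbb N\to\mathbb N$ with $\alpha(v_n,v_m)=\alpha(v_m,v_n)=0$ whenever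 $m>S(n)$. $\Omega_g^{\mathcal G}\subset\Omega^{\mathcal G}$: those satisfying the resolvent bound with $(g_m)$. Available information: $\alpha(v_i,v_j)$, $S(n)$, for $\Omega^{\mathcal G}_g$ also the values $g_m(q)$, and for the pseudospectrum the number $\epsilon$. A *general algorithm* is a map $\Gamma$ from the class to $\mathrm{Cl}(\mathbb C)$ for which each input $A$ has a finite non-empty set $\Lambda_\Gamma(A)$ of evaluations such that every $B$ that agrees with $A$ on $\Lambda_\Gamma(A)$ satisfies $\Gamma(B)=\Gamma(A)$ and $\Lambda_\Gamma(B)=\Lambda_\Gamma(A)$. A *tower* (of height one) for a problem function $\Xi$ is a sequence of general algorithms with $d_{\mathrm{AW}}(\Gamma_n(A),\Xi(A))\to0$ for all $A$; it is *arithmetic* if one machine performing exact real arithmetic and comparisons, with oracle access to the evaluations, computes from $n$ a finite list of complex numbers whose set of entries is $\Gamma_n(A)$. $\{\Xi,\Omega\}\in\Delta_1^G$ means that some tower satisfies $d_{\mathrm{AW}}(\Gamma_n(A),\Xi(A))\le2^{-n}$ for all $n$, $A$. $\{\Xi,\Omega\}\in\Sigma_1^A$ means that some arithmetic tower admits sets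 $X_n(A)\in\mathrm{Cl}(\mathbb C)$ with $\Gamma_n(A)\subset X_n(A)$ and $d_{\mathrm{AW}}(X_n(A),\Xi(A))\le2^{-n}$ for all $n$, $A$. *Claim.* Let $\Xi_1=\mathrm{Sp}$ and $\Xi_2=\mathrm{Sp}_\epsilon$. Then $$\{\Xi_1,\Omega_D\},\ \{\Xi_1,\Omega_g\},\ \{\Xi_1,\Omega_g^{\mathcal G}\},\ \{\Xi_2,\Omega_D\},\ \{\Xi_2,\hat\Omega\},\ \{\Xi_2,\Omega^{\mathcal G}\}\ \in\ \Sigma_1^A ,$$ and none of $\{\Xi_1,\Omega_D\}$, $\{\Xi_2,\Omega_D\}$, $\{\Xi_2,\hat\Omega\}$, $\{\Xi_2,\Omega^{\mathcal G}\}$ is in $\Delta_1^G$; if $g_m(x)\le x$ for all $m$ and $x$ (so that all diagonal operators satisfy the resolvent bound), then $\{\Xi_1,\Omega_g\}$ and $\{\Xi_1,\Omega^{\mathcal G}_g\}$ are not in $\Delta_1^G$ either. *Routines.* For $n\ge1$ let $G_n=\frac1n(\mathbb Z+i\mathbb Z)\cap\{|z|\le n\}$, let $\mathtt{CompInvg}(n,y,g)=\min\{k/n:k\in\mathbb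 N,\ g(k/n)>y\}$, and let $F_n(z)=l/n$, where $l\ge1$ is the least integer such that $B^*B-l^2/n^2$ and $C^*C-l^2/n^2$ are not both positive definite, with $B=(A-z)(1{:}f(n),1{:}n)$ and $C=(A-z)^*(1{:}f(n),1{:}n)$. (For graphs, $A$ is the matrix $(\alpha(v_i,v_j))$, $c_n=0$, and $f(n)$ is replaced by $\max\{n,\max_{k}(S(k)+1)\}$, $k$ over the first $n$ indices, with indices starting at $0$. For $\Xi_1$ on $\Omega_D$, $g_m(x)=x$.) - $\mathtt{CompSpecUB}$ outputs $\Gamma_n(A)=\bigcup_z M_z$ over $z\in G_n$ with $F_n(z)\le(|z|^2+1)^{-1}$, where $M_z$ is the set of minimisers of $F_n$ over the points of $G_n$ within distance $\mathtt{CompInvg}(n,F_n(z),g_{\lceil|z|\rceil})$ of $z$, together with $E_n(A)=\max_{z\in\Gamma_n(A)}E_n(A,z)$, where $E_n(A,z)=\mathtt{CompInvg}(n,F_n(z)+c_n,g_{\lceil|z|\rceil})$. - $\mathtt{PseudoSpecUB}$ outputs $\Gamma_n(A)=\{z\in G_n:F_n(z)+c_n<\epsilon\}$. On the respective classes these realise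 the inclusions in $\Sigma_1^A$: the sets $\Gamma_n(A)$ are finite, non-empty for large $n$, converge to $\Xi_j(A)$ in $d_{\mathrm{AW}}$, and there are $N_n(A)>n$ such that $(\Gamma_{N_n(A)}(A))_n$ is an arithmetic tower as in the definition of $\Sigma_1^A$. Moreover, for $\mathtt{CompSpecUB}$ and all $n\ge1$, each $z\in\Gamma_n(A)$ satisfies $\mathrm{dist}(z,\mathrm{Sp}(A))\le E_n(A,z)\le E_n(A)$, and, for every $r$, $E_n(A,z)\to0$ uniformly over $z\in\Gamma_n(A)$ with $|z|\le r$; for $\mathtt{PseudoSpecUB}$ and all $n\ge1$, $\Gamma_n(A)\subset\mathrm{Sp}_\epsilon(A)$. -/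

import Mathlib

open Filter Topology
open scoped NNReal ComplexOrder

noncomputable section

namespace SCI

/-! ## Closed operators on `ℓ²` : spectrum, resolvent, pseudospectrum -/

/-- The Hilbert space `ℓ²(ι)` of square-summable complex families. -/
abbrev Ell2 (ι : Type*) := lp (fun _ : ι => ℂ) 2

section Operators

variable {ι : Type*}

/-- The canonical basis vector `e_j`. -/
def basisVec (j : ι) : Ell2 ι := by
  classical exact lp.single 2 j (1 : ℂ)

/-- The linear span of the canonical basis vectors. -/
def basisSpan (ι : Type*) : Submodule ℂ (Ell2 ι) :=
  Submodule.span ℂ (Set.range (basisVec (ι := ι)))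

variable (A : Ell2 ι →ₗ.[ℂ] Ell2 ι)

/-- `B` is a bounded everywhere defined two-sided inverse of `A - z`. -/
def IsResolventAt (z : ℂ) (B : Ell2 ι →L[ℂ] Ell2 ι) : Prop :=
  (∀ x, ∃ h : B x ∈ A.domain, A ⟨B x, h⟩ - z • B x = x) ∧
    ∀ x : A.domain, B (A x - z • (x : Ell2 ι)) = x

/-- The spectrum: all `z` for which `A - z` has no bounded everywhere defined inverse. -/
def spec : Set ℂ := {z | ¬ ∃ B, IsResolventAt A z B}

open Classical in
/-- The resolvent `R(z, A) = (A - z)⁻¹` for `z` outside the spectrum (and `0` on the spectrum). -/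
def resolventOp (z : ℂ) : Ell2 ι →L[ℂ] Ell2 ι :=
  if h : ∃ B, IsResolventAt A z B then h.choose else 0

open Classical in
/-- `‖R(z, A)‖⁻¹`, with the convention that this is `0` on the spectrum. -/
def invResolventNorm (z : ℂ) : ℝ :=
  if z ∈ spec A then 0 else ‖resolventOp A z‖⁻¹

/-- The `ε`-pseudospectrum `cl {z : ‖(A - z)⁻¹‖ > 1/ε}`, where `‖(A - z)⁻¹‖ = ∞` on the
spectrum. -/
def pseudoSpec (ε : ℝ) : Set ℂ :=
  closure {z | z ∈ spec A ∨ 1 / ε < ‖resolventOp A z‖}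

open Classical in
/-- `A e_j` (and `0` if `e_j` is not in the domain; this never happens for the operators below). -/
def col (j : ι) : Ell2 ι :=
  if h : basisVec j ∈ A.domain then A ⟨basisVec j, h⟩ else 0

/-- The matrix element in row `i` and column `j`, i.e. the `e_i`-coefficient of `A e_j`. -/
def entry (i j : ι) : ℂ := inner ℂ (basisVec i) (col A j)

/-- Closed and densely defined, and the span of the canonical basis is a core of `A` and of
the adjoint of `A`. -/
structure IsAdmissible : Prop where
  closed : A.IsClosed
  dense : Dense (A.domain : Set (Ell2 ι))
  core : A.HasCore (basisSpan ι)
  core_adjoint : A.adjoint.HasCore (basisSpan ι)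

variable {A}

theorem isClosed_spec : IsClosed (spec A) := by
  rw [← isOpen_compl_iff, Metric.isOpen_iff]
  intro z hz
  have hz' : ∃ B, IsResolventAt A z B := by
    by_contra h
    exact hz h
  obtain ⟨B, hB1, hB2⟩ := hz'
  refine ⟨(‖B‖ + 1)⁻¹, by positivity, fun w hw => ?_⟩
  have hw' : ‖(w - z) • B‖ < 1 := by
    rw [norm_smul]
    rw [Metric.mem_ball, dist_eq_norm] at hw
    have h0 : (0 : ℝ) < ‖B‖ + 1 := by positivity
    calc ‖w - z‖ * ‖B‖ ≤ ‖w - z‖ * (‖B‖ + 1) := by gcongr; linarith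
      _ < (‖B‖ + 1)⁻¹ * (‖B‖ + 1) := by gcongr
      _ = 1 := inv_mul_cancel₀ h0.ne'
  let u := Units.oneSub ((w - z) • B) hw'
  have hu : ∀ y, (u : Ell2 ι →L[ℂ] Ell2 ι) y = y - (w - z) • B y := fun y => by
    simp [u]
  have h1 : ∀ y, (u : Ell2 ι →L[ℂ] Ell2 ι) ((↑u⁻¹ : Ell2 ι →L[ℂ] Ell2 ι) y) = y := fun y => by
    rw [← ContinuousLinearMap.comp_apply]
    exact congrArg (fun T : Ell2 ι →L[ℂ] Ell2 ι => T y) u.mul_inv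
  have h2 : ∀ y, (↑u⁻¹ : Ell2 ι →L[ℂ] Ell2 ι) ((u : Ell2 ι →L[ℂ] Ell2 ι) y) = y := fun y => by
    rw [← ContinuousLinearMap.comp_apply]
    exact congrArg (fun T : Ell2 ι →L[ℂ] Ell2 ι => T y) u.inv_mul
  intro hcon
  refine hcon ⟨B ∘L (↑u⁻¹ : Ell2 ι →L[ℂ] Ell2 ι), fun x => ?_, fun x => ?_⟩
  · obtain ⟨h, hx⟩ := hB1 ((↑u⁻¹ : Ell2 ι →L[ℂ] Ell2 ι) x)
    refine ⟨h, ?_⟩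
    have h3 := h1 x
    rw [hu] at h3
    simp only [ContinuousLinearMap.comp_apply]
    calc _ = (A ⟨_, h⟩ - z • B ((↑u⁻¹ : Ell2 ι →L[ℂ] Ell2 ι) x)) -
          (w - z) • B ((↑u⁻¹ : Ell2 ι →L[ℂ] Ell2 ι) x) := by module
      _ = x := by rw [hx, h3]
  · have h3 := hB2 x
    have h4 : A x - w • (x : Ell2 ι) =
        (u : Ell2 ι →L[ℂ] Ell2 ι) (A x - z • (x : Ell2 ι)) := by
      rw [hu, h3]
      module
    rw [h4, ContinuousLinearMap.comp_apply, h2, h3]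

theorem spec_subset_pseudoSpec (ε : ℝ) : spec A ⊆ pseudoSpec A ε :=
  fun _ hz => subset_closure (Or.inl hz)

/-- An admissible operator is determined by its matrix elements. -/
theorem IsAdmissible.ext_entry {A B : Ell2 ι →ₗ.[ℂ] Ell2 ι} (hA : IsAdmissible A)
    (hB : IsAdmissible B) (h : ∀ i j, entry A i j = entry B i j) : A = B := by
  classical
  have hcol : ∀ j, col A j = col B j := fun j => by
    ext i
    have := h i j
    unfold entry basisVec at this
    rw [lp.inner_single_left, lp.inner_single_left] at this
    simpa using this
  have hval : ∀ x (hx : x ∈ basisSpan ι) (h1 : x ∈ A.domain) (h2 : x ∈ B.domain),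
      A ⟨x, h1⟩ = B ⟨x, h2⟩ := by
    intro x hx
    refine Submodule.span_induction (p := fun x _ => ∀ (h1 : x ∈ A.domain) (h2 : x ∈ B.domain),
      A ⟨x, h1⟩ = B ⟨x, h2⟩) ?_ ?_ ?_ ?_ hx
    · rintro _ ⟨j, rfl⟩ h1 h2
      have := hcol j
      simpa [col, h1, h2] using this
    · intro h1 h2
      rw [show (⟨0, h1⟩ : A.domain) = 0 from rfl, show (⟨0, h2⟩ : B.domain) = 0 from rfl,
        LinearPMap.map_zero, LinearPMap.map_zero]
    · intro x y hx hy ihx ihy h1 h2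
      have ax := hA.core.le_domain hx
      have ay := hA.core.le_domain hy
      have bx := hB.core.le_domain hx
      have by' := hB.core.le_domain hy
      rw [show (⟨x + y, h1⟩ : A.domain) = ⟨x, ax⟩ + ⟨y, ay⟩ from rfl,
        show (⟨x + y, h2⟩ : B.domain) = ⟨x, bx⟩ + ⟨y, by'⟩ from rfl,
        LinearPMap.map_add, LinearPMap.map_add, ihx ax bx, ihy ay by']
    · intro c x hx ihx h1 h2
      have ax := hA.core.le_domain hx
      have bx := hB.core.le_domain hx
      rw [show (⟨c • x, h1⟩ : A.domain) = c • ⟨x, ax⟩ from rfl,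
        show (⟨c • x, h2⟩ : B.domain) = c • ⟨x, bx⟩ from rfl,
        LinearPMap.map_smul, LinearPMap.map_smul, ihx ax bx]
  rw [← hA.core.closure_eq, ← hB.core.closure_eq]
  congr 1
  refine LinearPMap.ext ?_ ?_
  · rw [LinearPMap.domRestrict_domain, LinearPMap.domRestrict_domain,
      inf_eq_left.2 hA.core.le_domain, inf_eq_left.2 hB.core.le_domain]
  · intro x hx hy
    exact hval x hx.1 hx.2 hy.2

end Operators

/-! ## Dispersion and resolvent control -/

/-- The orthogonal projection `P_n` of `ℓ²(ℕ)` onto the span of the first `n` basis vectors. -/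
def proj (n : ℕ) : Ell2 ℕ →L[ℂ] Ell2 ℕ :=
  ∑ j ∈ Finset.range n, (innerSL ℂ (basisVec j)).smulRight (basisVec j)

/-- The finite rank operator `A P_n`. -/
def mulProj (A : Ell2 ℕ →ₗ.[ℂ] Ell2 ℕ) (n : ℕ) : Ell2 ℕ →L[ℂ] Ell2 ℕ :=
  ∑ j ∈ Finset.range n, (innerSL ℂ (basisVec j)).smulRight (col A j)

/-- The dispersion `D_{f,n}(A) = max {‖(1 - P_{f(n)}) A P_n‖, ‖(1 - P_{f(n)}) A* P_n‖}`. -/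
def dispersion (f : ℕ → ℕ) (n : ℕ) (A : Ell2 ℕ →ₗ.[ℂ] Ell2 ℕ) : ℝ :=
  max ‖(1 - proj (f n)) ∘L mulProj A n‖ ‖(1 - proj (f n)) ∘L mulProj A.adjoint n‖

/-- The standing assumptions on the functions `g_m`. -/
def IsResolventControl (g : ℕ → ℝ≥0 → ℝ≥0) : Prop :=
  ∀ m, Continuous (g m) ∧ StrictMono (g m) ∧ (∀ x, g m x = 0 ↔ x = 0) ∧
    Tendsto (g m) atTop atTop

/-- `A` has resolvent bounded by `(g_m)`:
`g_m(dist(z, Sp(A))) ≤ ‖R(z, A)‖⁻¹` for all `|z| ≤ m`. -/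
def HasResolventBound {ι : Type*} (g : ℕ → ℝ≥0 → ℝ≥0) (A : Ell2 ι →ₗ.[ℂ] Ell2 ι) : Prop :=
  ∀ (m : ℕ) (z : ℂ), ‖z‖ ≤ m → (g m (Metric.infNndist z (spec A)) : ℝ) ≤ invResolventNorm A z

/-! ## The Attouch--Wets distance -/

/-- The set `Cl(ℂ)` of closed non-empty subsets of `ℂ`. -/
def Cl : Type := {C : Set ℂ // IsClosed C ∧ C.Nonempty}

/-- The Attouch--Wets distance. -/
def dAW (C D : Set ℂ) : ℝ :=
  ∑' n : ℕ, (2 : ℝ)⁻¹ ^ (n + 1) *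
    min 1 (⨆ x : Metric.closedBall (0 : ℂ) (n + 1),
      |Metric.infDist (x : ℂ) C - Metric.infDist (x : ℂ) D|)

/-! ## Computational problems and general algorithms -/

universe u

/-- A computational problem with values in `(Cl(ℂ), dAW)`. The evaluation set is given as a
countable family `eval` indexed by `Idx`, which separates the elements of the domain `Dom`. -/
structure Problem where
  Dom : Type u
  Idx : Type
  enc : Encodable Idx
  eval : Idx → Dom → ℂ
  sep : ∀ A B, (∀ k, eval k A = eval k B) → A = B
  sol : Dom → Cl

/-- A general algorithm: the output, and the finite set of evaluations used, depend only on
the values of the evaluations used. -/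
def IsGeneralAlgorithm (P : Problem.{u}) (Γ : P.Dom → Cl) : Prop :=
  ∃ used : P.Dom → Finset P.Idx, ∀ A, (used A).Nonempty ∧
    ∀ B, (∀ k ∈ used A, P.eval k B = P.eval k A) → Γ B = Γ A ∧ used B = used A

/-! ## Machines performing exact real arithmetic with an oracle

The machine has infinitely many real registers (initially `0`), on which it can perform the four
arithmetic operations, comparisons with `0`, and to which it can load the values of the oracle. Its
program is recursive: the discrete part of a configuration (position in the finite program, index
registers, discrete work tape) is coded by one natural number, the control state, and a computable
function assigns to it the instruction to be executed, with the following control state(s). The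
only real constants available are natural numbers, so that on rational oracles the machine can be
executed by a Turing machine, and in general by a Blum--Shub--Smale machine. -/

/-- Instructions; in each case `s`, `s'` are the control states that may follow. -/
inductive Instr
  /-- `x_r := c` -/
  | const (r c s : ℕ)
  /-- `x_r := x_i + x_j` -/
  | add (r i j s : ℕ)
  /-- `x_r := x_i - x_j` -/
  | sub (r i j s : ℕ)
  /-- `x_r := x_i * x_j` -/
  | mul (r i j s : ℕ)
  /-- `x_r := x_i / x_j` (and `0` if `x_j = 0`) -/
  | div (r i j s : ℕ)
  /-- `x_r := Re (O k)` and `x_{r+1} := Im (O k)` for the oracle `O` -/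
  | query (r k s : ℕ)
  /-- go to `s` if `0 < x_i`, and to `s'` otherwise -/
  | branch (i s s' : ℕ)
  /-- stop, with output `x_0 + i x_1, …, x_{2m-2} + i x_{2m-1}` -/
  | halt (m : ℕ)

/-- Instructions as tagged tuples of natural numbers. -/
def Instr.equivSum : Instr ≃
    ((ℕ × ℕ × ℕ) ⊕ (ℕ × ℕ × ℕ) ⊕ (ℕ × ℕ × ℕ) ⊕ ℕ) ⊕
      ((ℕ × ℕ × ℕ × ℕ) ⊕ (ℕ × ℕ × ℕ × ℕ) ⊕ (ℕ × ℕ × ℕ × ℕ) ⊕ (ℕ × ℕ × ℕ × ℕ)) where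
  toFun
    | .const r c s => .inl (.inl (r, c, s))
    | .query r k s => .inl (.inr (.inl (r, k, s)))
    | .branch i s s' => .inl (.inr (.inr (.inl (i, s, s'))))
    | .halt m => .inl (.inr (.inr (.inr m)))
    | .add r i j s => .inr (.inl (r, i, j, s))
    | .sub r i j s => .inr (.inr (.inl (r, i, j, s)))
    | .mul r i j s => .inr (.inr (.inr (.inl (r, i, j, s))))
    | .div r i j s => .inr (.inr (.inr (.inr (r, i, j, s))))
  invFun
    | .inl (.inl (r, c, s)) => .const r c s
    | .inl (.inr (.inl (r, k, s))) => .query r k s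
    | .inl (.inr (.inr (.inl (i, s, s')))) => .branch i s s'
    | .inl (.inr (.inr (.inr m))) => .halt m
    | .inr (.inl (r, i, j, s)) => .add r i j s
    | .inr (.inr (.inl (r, i, j, s))) => .sub r i j s
    | .inr (.inr (.inr (.inl (r, i, j, s)))) => .mul r i j s
    | .inr (.inr (.inr (.inr (r, i, j, s)))) => .div r i j s
  left_inv x := by cases x <;> rfl
  right_inv x := by
    rcases x with (_ | _ | _ | _) | (_ | _ | _ | _) <;> rfl

instance : Primcodable Instr := Primcodable.ofEquiv _ Instr.equivSum

/-- A machine: its initial control state on input `n`, and its program. -/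
structure Machine where
  start : ℕ → ℕ
  prog : ℕ → Instr
  start_computable : Computable start
  prog_computable : Computable prog

/-- A configuration: the control state and the contents of the real registers. -/
structure Config where
  state : ℕ
  reg : ℕ → ℝ

/-- One step of the computation with oracle `O`. -/
def Machine.step (M : Machine) (O : ℕ → ℂ) (x : Config) : Config :=
  match M.prog x.state with
  | .const r c s => ⟨s, Function.update x.reg r c⟩
  | .add r i j s => ⟨s, Function.update x.reg r (x.reg i + x.reg j)⟩
  | .sub r i j s => ⟨s, Function.update x.reg r (x.reg i - x.reg j)⟩
  | .mul r i j s => ⟨s, Function.update x.reg r (x.reg i * x.reg j)⟩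
  | .div r i j s => ⟨s, Function.update x.reg r (x.reg i / x.reg j)⟩
  | .query r k s =>
      ⟨s, Function.update (Function.update x.reg r (O k).re) (r + 1) (O k).im⟩
  | .branch i s s' => ⟨open Classical in if 0 < x.reg i then s else s', x.reg⟩
  | .halt _ => x

/-- The machine, on input `n` and with oracle `O`, stops after finitely many steps and outputs the
finite string `L` of complex numbers. -/
def Machine.Outputs (M : Machine) (O : ℕ → ℂ) (n : ℕ) (L : List ℂ) : Prop :=
  ∃ (t m : ℕ) (x : Config), x = (M.step O)^[t] ⟨M.start n, fun _ => 0⟩ ∧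
    M.prog x.state = .halt m ∧
    L = List.ofFn fun i : Fin m => (⟨x.reg (2 * i), x.reg (2 * i + 1)⟩ : ℂ)

/-- The oracle giving access to all evaluations of the input `A`. -/
def Problem.oracle (P : Problem.{u}) (A : P.Dom) (k : ℕ) : ℂ :=
  match P.enc.decode k with
  | some i => P.eval i A
  | none => 0

/-! ## Towers of height one and the classes `Δ₁`, `Δ₂`, `Σ₁` -/

/-- The type of a tower of algorithms: general (G) or arithmetic (A). -/
inductive TowerType
  | general
  | arithmetic

/-- `(Γ_n)` is recursive: one machine computes, from `n` and the evaluations of `A`, a finite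
string of complex numbers, whose set of entries is `Γ_n(A)`. -/
def IsRecursive (P : Problem.{u}) (Γ : ℕ → P.Dom → Cl) : Prop :=
  ∃ M : Machine, ∀ n A, ∃ L : List ℂ, M.Outputs (P.oracle A) n L ∧ (Γ n A).1 = {z | z ∈ L}

/-- A tower of algorithms of height one of the given type. -/
structure IsTower (α : TowerType) (P : Problem.{u}) (Γ : ℕ → P.Dom → Cl) : Prop where
  general : ∀ n, IsGeneralAlgorithm P (Γ n)
  recursive : α = .arithmetic → IsRecursive P Γ
  tendsto : ∀ A, Tendsto (fun n => dAW (Γ n A).1 (P.sol A).1) atTop (𝓝 0)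

/-- `Δ₁`: computable with full error control. -/
def DeltaOne (α : TowerType) (P : Problem.{u}) : Prop :=
  ∃ Γ, IsTower α P Γ ∧ ∀ n A, dAW (Γ n A).1 (P.sol A).1 ≤ (2 : ℝ)⁻¹ ^ n

/-- `Δ₂`: computable in one limit. -/
def DeltaTwo (α : TowerType) (P : Problem.{u}) : Prop :=
  ∃ Γ, IsTower α P Γ

/-- A tower of height one with `Σ₁` error control: `Γ_n(A) ⊆ X_n(A)` for closed non-empty sets with
`d(X_n(A), Ξ(A)) ≤ 2⁻ⁿ`. -/
def IsSigmaOneTower (α : TowerType) (P : Problem.{u}) (Γ : ℕ → P.Dom → Cl) : Prop :=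
  IsTower α P Γ ∧ ∃ X : ℕ → P.Dom → Cl, ∀ n A,
    (Γ n A).1 ⊆ (X n A).1 ∧ dAW (X n A).1 (P.sol A).1 ≤ (2 : ℝ)⁻¹ ^ n

/-- The class `Σ₁`. -/
def SigmaOne (α : TowerType) (P : Problem.{u}) : Prop :=
  DeltaTwo α P ∧ ∃ Γ, IsSigmaOneTower α P Γ

/-! ## The problems on `ℓ²(ℕ)` -/

/-- The class `Ω̂` for the dispersion function `f`: an admissible operator with non-empty spectrum,
together with the known rational null sequence bounding its dispersion. -/
structure DispOp (f : ℕ → ℕ) where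
  op : Ell2 ℕ →ₗ.[ℂ] Ell2 ℕ
  c : ℕ → ℚ
  admissible : IsAdmissible op
  tendsto_c : Tendsto c atTop (𝓝 0)
  dispersion_le : ∀ n, dispersion f n op ≤ c n
  spec_nonempty : (spec op).Nonempty

/-- The operator is diagonal. -/
def DispOp.IsDiagonal {f : ℕ → ℕ} (A : DispOp f) : Prop :=
  ∀ i j, i ≠ j → entry A.op i j = 0

/-- The spectrum as an element of `Cl(ℂ)`. -/
def specCl {ι : Type*} (A : Ell2 ι →ₗ.[ℂ] Ell2 ι) (h : (spec A).Nonempty) : Cl :=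
  ⟨spec A, isClosed_spec, h⟩

/-- The pseudospectrum as an element of `Cl(ℂ)`. -/
def pseudoSpecCl {ι : Type*} (ε : ℝ) (A : Ell2 ι →ₗ.[ℂ] Ell2 ι) (h : (spec A).Nonempty) : Cl :=
  ⟨pseudoSpec A ε, isClosed_closure, h.mono (spec_subset_pseudoSpec ε)⟩

/-- The evaluations available for all operators on `ℓ²(ℕ)`: matrix elements, `f(n)`, `c_n`. -/
abbrev DispIdx := (ℕ × ℕ) ⊕ ℕ ⊕ ℕ

def DispOp.eval {f : ℕ → ℕ} (A : DispOp f) : DispIdx → ℂ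
  | .inl (i, j) => entry A.op i j
  | .inr (.inl n) => (f n : ℂ)
  | .inr (.inr n) => (A.c n : ℂ)

theorem DispOp.ext_eval {f : ℕ → ℕ} (A B : DispOp f) (h : ∀ k, A.eval k = B.eval k) : A = B := by
  have h1 : A.op = B.op :=
    A.admissible.ext_entry B.admissible fun i j => h (.inl (i, j))
  have h2 : A.c = B.c := by
    ext n
    have := h (.inr (.inr n))
    simpa [DispOp.eval] using this
  cases A
  cases B
  simp_all

/-- The problem of computing `Ξ` on a subclass of `Ω̂`, where, besides the evaluations `DispIdx`,
constant evaluations `κ` are available. -/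
def dispProblem (f : ℕ → ℕ) (Class : DispOp f → Prop) (Ξ : DispOp f → Cl) (K : Type)
    [Encodable K] (κ : K → ℂ) : Problem.{0} where
  Dom := {A : DispOp f // Class A}
  Idx := DispIdx ⊕ K
  enc := inferInstance
  eval k A := match k with
    | .inl k => A.1.eval k
    | .inr k => κ k
  sep _ _ h := Subtype.ext (DispOp.ext_eval _ _ fun k => h (.inl k))
  sol A := Ξ A.1

/-- The evaluations `g_m(a / b)` of the functions controlling the resolvent. -/
def gEval (g : ℕ → ℝ≥0 → ℝ≥0) : ℕ × ℕ × ℕ → ℂ :=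
  fun k => ((g k.1 ((k.2.1 : ℝ≥0) / (k.2.2 : ℝ≥0)) : ℝ) : ℂ)

/-- `{Ξ₁, Ω_D}`: the spectrum of diagonal operators. -/
def diagSpec (f : ℕ → ℕ) : Problem.{0} :=
  dispProblem f (fun A => A.IsDiagonal) (fun A => specCl A.op A.spec_nonempty) Empty nofun

/-- `{Ξ₁, Ω_g}`: the spectrum of operators with known resolvent bound. -/
def resolventSpec (f : ℕ → ℕ) (g : ℕ → ℝ≥0 → ℝ≥0) : Problem.{0} :=
  dispProblem f (fun A => HasResolventBound g A.op) (fun A => specCl A.op A.spec_nonempty)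
    (ℕ × ℕ × ℕ) (gEval g)

/-- `{Ξ₂, Ω_D}`: the pseudospectrum of diagonal operators. -/
def diagPseudo (f : ℕ → ℕ) (ε : ℝ) : Problem.{0} :=
  dispProblem f (fun A => A.IsDiagonal) (fun A => pseudoSpecCl ε A.op A.spec_nonempty)
    Unit (fun _ => (ε : ℂ))

/-- `{Ξ₂, Ω̂}`: the pseudospectrum of all operators with known bounded dispersion. -/
def dispPseudo (f : ℕ → ℕ) (ε : ℝ) : Problem.{0} :=
  dispProblem f (fun _ => True) (fun A => pseudoSpecCl ε A.op A.spec_nonempty)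
    Unit (fun _ => (ε : ℂ))

/-! ## The problems on graphs -/

/-- The class `Ω^𝒢` for a graph `G` with enumeration `v` of its vertices: an admissible operator
`∑ α(v, w) |v⟩⟨w|` on `ℓ²(V)` with non-empty spectrum, together with a known function `S` such that
`α(v_n, v_m) = α(v_m, v_n) = 0` for `m > S(n)`. In particular, for each `v`, only finitely many
`α(v, w)`, `α(w, v)` are non-zero. The coefficients `α` are the matrix elements of `op`, and they
need not be supported on the edges of `G`. -/
structure GraphOp {V : Type u} (_G : SimpleGraph V) (v : ℕ ≃ V) where
  op : Ell2 V →ₗ.[ℂ] Ell2 V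
  S : ℕ → ℕ
  admissible : IsAdmissible op
  support : ∀ n m, S n < m → entry op (v n) (v m) = 0 ∧ entry op (v m) (v n) = 0
  spec_nonempty : (spec op).Nonempty

section Graph

variable {V : Type u} (G : SimpleGraph V) (v : ℕ ≃ V)

/-- The evaluations available for all operators on the graph: `α(v_i, v_j)` and `S(n)`. -/
abbrev GraphIdx := (ℕ × ℕ) ⊕ ℕ

variable {G v} in
def GraphOp.eval (A : GraphOp G v) : GraphIdx → ℂ
  | .inl (i, j) => entry A.op (v i) (v j)
  | .inr n => (A.S n : ℂ)

variable {G v} in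
theorem GraphOp.ext_eval (A B : GraphOp G v) (h : ∀ k, A.eval k = B.eval k) : A = B := by
  have h1 : A.op = B.op :=
    A.admissible.ext_entry B.admissible fun i j => by
      have := h (.inl (v.symm i, v.symm j))
      simpa [GraphOp.eval] using this
  have h2 : A.S = B.S := by
    ext n
    have := h (.inr n)
    simpa [GraphOp.eval] using this
  cases A
  cases B
  simp_all

/-- The problem of computing `Ξ` on a subclass of `Ω^𝒢`, where, besides the evaluations
`GraphIdx`, constant evaluations `κ` are available. -/
def graphProblem (Class : GraphOp G v → Prop) (Ξ : GraphOp G v → Cl) (K : Type)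
    [Encodable K] (κ : K → ℂ) : Problem.{u} where
  Dom := {A : GraphOp G v // Class A}
  Idx := GraphIdx ⊕ K
  enc := inferInstance
  eval k A := match k with
    | .inl k => A.1.eval k
    | .inr k => κ k
  sep _ _ h := Subtype.ext (GraphOp.ext_eval _ _ fun k => h (.inl k))
  sol A := Ξ A.1

/-- `{Ξ₁, Ω_g^𝒢}`: the spectrum of operators on the graph with known resolvent bound. -/
def graphSpec (g : ℕ → ℝ≥0 → ℝ≥0) : Problem.{u} :=
  graphProblem G v (fun A => HasResolventBound g A.op) (fun A => specCl A.op A.spec_nonempty)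
    (ℕ × ℕ × ℕ) (gEval g)

/-- `{Ξ₂, Ω^𝒢}`: the pseudospectrum of operators on the graph. -/
def graphPseudo (ε : ℝ) : Problem.{u} :=
  graphProblem G v (fun _ => True) (fun A => pseudoSpecCl ε A.op A.spec_nonempty)
    Unit (fun _ => (ε : ℂ))

end Graph

/-! ## The routines

They take as input a number `n ≥ 1`, the matrix `a` of the operator, the number `m = f(n)` of rows
used, and the dispersion bound `c = c_n`. -/

/-- The grid `(1/n)(ℤ + iℤ) ∩ {|z| ≤ n}`. -/
def grid (n : ℕ) : Set ℂ :=
  {z | ‖z‖ ≤ n ∧ ∃ p q : ℤ, z = (p + q * Complex.I) / n}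

/-- `min {k/n : k ∈ ℕ, g(k/n) > y}`. -/
def compInvg (n : ℕ) (y : ℝ) (g : ℝ≥0 → ℝ≥0) : ℝ :=
  (sInf {k : ℕ | y < g ((k : ℝ≥0) / (n : ℝ≥0))} : ℕ) / (n : ℝ)

/-- The rectangular section `(A - z)(1:m, 1:n)` of the infinite matrix `a`. -/
def rectSection (a : ℕ → ℕ → ℂ) (m n : ℕ) (z : ℂ) : Matrix (Fin m) (Fin n) ℂ :=
  Matrix.of fun i j => a i j - if (i : ℕ) = j then z else 0

/-- `l/n` for the least `l ≥ 1` such that `B*B - l²/n²` and `C*C - l²/n²` are not both positive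
definite, where `B = (A - z)(1:m, 1:n)` and `C = (A - z)*(1:m, 1:n)`. -/
def distSpec (a : ℕ → ℕ → ℂ) (n m : ℕ) (z : ℂ) : ℝ :=
  let B := rectSection a m n z
  let C := rectSection (fun i j => star (a j i)) m n (star z)
  (sInf {l : ℕ | 1 ≤ l ∧
    ¬ ((B.conjTranspose * B - (((l : ℂ) / n) ^ 2) • (1 : Matrix (Fin n) (Fin n) ℂ)).PosDef ∧
      (C.conjTranspose * C - (((l : ℂ) / n) ^ 2) • (1 : Matrix (Fin n) (Fin n) ℂ)).PosDef)} : ℕ) /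
    (n : ℝ)

/-- The output set of the routine `CompSpecUB`: the union, over all grid points `z` with
`F(z) ≤ (|z|² + 1)⁻¹`, of the sets of minimisers of `F` over the grid points in the ball around
`z` of radius `compInvg n (F z) g_{⌈|z|⌉}`; here `F` is `distSpec`. -/
def compSpecUB (a : ℕ → ℕ → ℂ) (n m : ℕ) (g : ℕ → ℝ≥0 → ℝ≥0) : Set ℂ :=
  let F := distSpec a n m
  let near : ℂ → Set ℂ := fun z =>
    Metric.closedBall z (compInvg n (F z) (g ⌈‖z‖⌉₊)) ∩ grid n
  {w | ∃ z ∈ grid n, F z ≤ (‖z‖ ^ 2 + 1)⁻¹ ∧ w ∈ near z ∧ ∀ w' ∈ near z, F w ≤ F w'}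

/-- The error estimate of the routine `CompSpecUB` at the point `z` of its output. -/
def specErrAt (a : ℕ → ℕ → ℂ) (n m : ℕ) (g : ℕ → ℝ≥0 → ℝ≥0) (c : ℝ) (z : ℂ) : ℝ :=
  compInvg n (distSpec a n m z + c) (g ⌈‖z‖⌉₊)

/-- The error estimate `E_n(A)` of `CompSpecUB`: the maximum over its output. -/
def specErr (a : ℕ → ℕ → ℂ) (n m : ℕ) (g : ℕ → ℝ≥0 → ℝ≥0) (c : ℝ) : ℝ :=
  sSup (specErrAt a n m g c '' compSpecUB a n m g)

/-- The output of the routine `PseudoSpecUB`. -/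
def pseudoSpecUB (a : ℕ → ℕ → ℂ) (n m : ℕ) (c ε : ℝ) : Set ℂ :=
  {z | z ∈ grid n ∧ distSpec a n m z + c < ε}

/-- The matrix of an operator on `ℓ²(ℕ)`. -/
def DispOp.mat {f : ℕ → ℕ} (A : DispOp f) (i j : ℕ) : ℂ := entry A.op i j

/-- The matrix of an operator on the graph, with respect to the enumeration of the vertices. -/
def GraphOp.mat {V : Type u} {G : SimpleGraph V} {v : ℕ ≃ V} (A : GraphOp G v) (i j : ℕ) : ℂ :=
  entry A.op (v i) (v j)

/-- The dispersion function computed from `S`: all non-zero entries in the first `n` columns and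
rows of the matrix have both indices less than `rows n`. -/
def GraphOp.rows {V : Type u} {G : SimpleGraph V} {v : ℕ ≃ V} (A : GraphOp G v) (n : ℕ) : ℕ :=
  max n ((Finset.range n).sup fun k => A.S k + 1)

/-- The sets `R n A` realise the classification of the problem in `Σ₁^A`: they are finite, are
non-empty for large `n`, converge to `Ξ(A)`, and some arithmetic tower with `Σ₁` error control
consists of outputs `R N A` of the routine, where `N > n` is chosen adaptively. -/
def Realises (P : Problem.{u}) (R : ℕ → P.Dom → Set ℂ) : Prop :=
  (∀ A, (∀ n, 1 ≤ n → (R n A).Finite) ∧ (∀ᶠ n in atTop, (R n A).Nonempty) ∧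
    Tendsto (fun n => dAW (R n A) (P.sol A).1) atTop (𝓝 0)) ∧
  ∃ Γ, IsSigmaOneTower .arithmetic P Γ ∧
    ∃ N : ℕ → P.Dom → ℕ, ∀ n A, n < N n A ∧ (Γ n A).1 = R (N n A) A

/-- The error estimates are guaranteed: each point `z` of the output `R n A` is within distance
`E n A z ≤ Emax n A` of `Ξ(A)`, and `E n A z` tends to `0` uniformly for `z` in bounded sets. -/
def HasErrorBounds (P : Problem.{u}) (R : ℕ → P.Dom → Set ℂ) (E : ℕ → P.Dom → ℂ → ℝ)
    (Emax : ℕ → P.Dom → ℝ) : Prop :=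
  ∀ A, (∀ n, 1 ≤ n → ∀ z ∈ R n A,
      Metric.infDist z (P.sol A).1 ≤ E n A z ∧ E n A z ≤ Emax n A) ∧
    ∀ r δ : ℝ, 0 < δ → ∀ᶠ n in atTop, ∀ z ∈ R n A, ‖z‖ ≤ r → E n A z ≤ δ

end SCI

end

open SCI

/-! Write `γ z` for `‖R(z, A)‖⁻¹`. For a closed densely defined operator whose basis span is a core
of `A` and of `A*`, `γ z` is the best constant `κ` with `κ‖x‖ ≤ ‖(A - z)x‖` and `κ‖x‖ ≤ ‖(A - z)*
x‖` for all finite vectors `x`: lower bounds pass from a core to the whole domain, and two-sided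
lower bounds force invertibility (`le_invResolventNorm`); the converse is
`invResolventNorm_mul_norm_le` and its adjoint version. The routine's `F_n(z)` is, up to rounding by
`1/n`, the smaller of the least singular values of the two rectangular sections. The rows cut off
cost at most `c_n`, so `γ ≤ F_n + c_n` everywhere; conversely each finite vector that shows `γ z <
κ` is seen by all large sections, so `F_n(w) ≤ κ + |w - z| + 1/n` eventually. These two facts,
packaged in `IsApprox` and proved in `isApprox_distSpec`, are all that convergence needs.

For pseudospectra, `F_n(z) + c_n < ε` certifies `γ z < ε`, and every point with `γ < ε` is
approximated by such grid points. For spectra, the resolvent control turns `F_n(w) + c_n` into a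
bound for the distance from `w` to the spectrum. What must be shown is that `F_n` is uniformly small
on the output (`IsApprox.eventually_minimiser_le`). Far from the origin the threshold `(|z|² + 1)⁻¹`
achieves this. Near the origin the search ball around `z` almost reaches the spectrum, so the
minimiser does at least as well as a grid point close to a spectral point.

The `Σ₁` error control is obtained by choosing `N > n` adaptively. For pseudospectra any non-empty
output works, with `X_n` the pseudospectrum itself. For spectra one waits until the error estimate
is at most `2⁻⁽ⁿ⁺¹⁾` at all output points in a large ball, and takes `X_n` to be the union of the
output and the spectrum (`dAW_union_le`).

Computability rests on one observation: every decision is determined by the signs of finitely many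
arithmetic expressions in the oracle values. Expressions are coded by natural numbers; `signMachine`
evaluates the codes `0, 1, 2, …`, records the signs, and stops when a primitive recursive procedure
finds the record sufficient. The class `OracleComputable` of functions determined in this way is
closed under composition, recursion and unbounded search, and `realises_of_oracleComputable` turns
its members into towers. Positive definiteness becomes a condition on signs through division-free
elimination (`posOn_iff_pivots`).

The problems are not in `Δ₁` by an adversary argument (`not_deltaOne_of_adversary`): finitely many
evaluations cannot distinguish the zero operator from `t|e_k⟩⟨e_k|` with `k` large, but the two
solutions differ by a fixed amount near the point `t`. -/

namespace SCI

/-! ## Finite linear combinations of basis vectors -/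

section FiniteVectors

variable {ι : Type*}

theorem basisVec_apply_self (j : ι) : basisVec j j = 1 := by
  classical simp [basisVec]

theorem basisVec_apply_ne {i j : ι} (h : i ≠ j) : basisVec j i = 0 := by
  classical
  unfold basisVec
  exact lp.single_apply_ne 2 j _ h

theorem inner_basisVec (j : ι) (y : Ell2 ι) : inner ℂ (basisVec j) y = y j := by
  classical
  unfold basisVec
  rw [lp.inner_single_left]
  simp

theorem norm_basisVec (j : ι) : ‖basisVec j‖ = 1 := by
  classical
  unfold basisVec
  rw [lp.norm_single (by norm_num)]
  simp

theorem orthonormal_basisVec : Orthonormal ℂ (basisVec : ι → Ell2 ι) :=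
  ⟨norm_basisVec, fun i j h => by
    change inner ℂ (basisVec i) (basisVec j) = 0
    rw [inner_basisVec, basisVec_apply_ne h]⟩

theorem basisVec_mem_basisSpan (j : ι) : basisVec j ∈ basisSpan ι :=
  Submodule.subset_span ⟨j, rfl⟩

variable (v : ℕ ≃ ι)

/-- The finite linear combination of basis vectors with coefficients `x`. -/
noncomputable def finVec (n : ℕ) (x : Fin n → ℂ) : Ell2 ι := ∑ j, x j • basisVec (v j)

/-- The orthogonal projection onto the first `m` basis vectors in the enumeration `v`. -/
noncomputable def truncate (m : ℕ) (y : Ell2 ι) : Ell2 ι :=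
  finVec v m fun i => y (v i)

theorem finVec_mem (n : ℕ) (x : Fin n → ℂ) : finVec v n x ∈ basisSpan ι :=
  Submodule.sum_mem _ fun _ _ => Submodule.smul_mem _ _ (basisVec_mem_basisSpan _)

theorem orthonormal_comp_fin (n : ℕ) :
    Orthonormal ℂ (fun j : Fin n => (basisVec (v j) : Ell2 ι)) :=
  orthonormal_basisVec.comp _ (v.injective.comp Fin.val_injective)

theorem norm_sq_finVec (n : ℕ) (x : Fin n → ℂ) : ‖finVec v n x‖ ^ 2 = ∑ j, ‖x j‖ ^ 2 := by
  have h := (orthonormal_comp_fin v n).inner_sum x x Finset.univ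
  have h2 : (‖finVec v n x‖ ^ 2 : ℂ) = ((∑ j, ‖x j‖ ^ 2 : ℝ) : ℂ) := by
    refine (inner_self_eq_norm_sq_to_K (𝕜 := ℂ) (finVec v n x)).symm.trans ?_
    unfold finVec
    rw [h]
    push_cast
    refine Finset.sum_congr rfl fun j _ => ?_
    rw [mul_comm, Complex.mul_conj, Complex.normSq_eq_norm_sq]
    norm_cast
  exact_mod_cast h2

theorem finVec_ne_zero {n : ℕ} {x : Fin n → ℂ} (hx : x ≠ 0) : finVec v n x ≠ 0 := by
  intro h
  apply hx
  have h2 := norm_sq_finVec v n x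
  rw [h, norm_zero] at h2
  have h3 : ∀ j ∈ Finset.univ, ‖x j‖ ^ 2 = 0 :=
    (Finset.sum_eq_zero_iff_of_nonneg fun _ _ => sq_nonneg _).1 (by simpa using h2.symm)
  ext j
  simpa using h3 j (Finset.mem_univ j)

theorem norm_sq_truncate (m : ℕ) (y : Ell2 ι) :
    ‖truncate v m y‖ ^ 2 = ∑ i : Fin m, ‖y (v i)‖ ^ 2 := norm_sq_finVec _ _ _

theorem norm_truncate_le (m : ℕ) (y : Ell2 ι) : ‖truncate v m y‖ ≤ ‖y‖ := by
  have h := (orthonormal_comp_fin v m).sum_inner_products_le (x := y) (s := Finset.univ)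
  simp only [inner_basisVec] at h
  rw [← norm_sq_truncate v] at h
  exact (pow_le_pow_iff_left₀ (norm_nonneg _) (norm_nonneg _) two_ne_zero).1 h

theorem finVec_apply (n : ℕ) (x : Fin n → ℂ) (i : ι) :
    finVec v n x i = ∑ j, x j * (basisVec (v j) : Ell2 ι) i := by
  rw [← inner_basisVec]
  unfold finVec
  rw [inner_sum]
  simp only [inner_smul_right, inner_basisVec]

theorem finVec_apply_lt (n : ℕ) (x : Fin n → ℂ) (i : Fin n) : finVec v n x (v i) = x i := by
  rw [finVec_apply, Finset.sum_eq_single i]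
  · simp [basisVec_apply_self]
  · intro j _ hj
    rw [basisVec_apply_ne, mul_zero]
    exact fun h => hj (Fin.ext (v.injective h)).symm
  · simp

theorem finVec_apply_ge (n : ℕ) (x : Fin n → ℂ) (i : ℕ) (hi : n ≤ i) : finVec v n x (v i) = 0 := by
  rw [finVec_apply]
  refine Finset.sum_eq_zero fun j _ => ?_
  rw [basisVec_apply_ne, mul_zero]
  intro h
  have := v.injective h
  omega

theorem truncate_sub (m : ℕ) (x y : Ell2 ι) :
    truncate v m (x - y) = truncate v m x - truncate v m y := by
  simp [truncate, finVec, sub_smul, Finset.sum_sub_distrib]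

theorem truncate_smul (m : ℕ) (c : ℂ) (x : Ell2 ι) :
    truncate v m (c • x) = c • truncate v m x := by
  simp [truncate, finVec, mul_smul, Finset.smul_sum]

theorem truncate_add (m : ℕ) (x y : Ell2 ι) :
    truncate v m (x + y) = truncate v m x + truncate v m y := by
  simp [truncate, finVec, add_smul, Finset.sum_add_distrib]

theorem truncate_eq_range_sum (m : ℕ) (y : Ell2 ι) :
    truncate v m y = ∑ i ∈ Finset.range m, y (v i) • basisVec (v i) := by
  rw [truncate, finVec, ← Fin.sum_univ_eq_sum_range (fun i => y (v i) • (basisVec (v i) : Ell2 ι))]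

theorem truncate_finVec {n m : ℕ} (h : n ≤ m) (x : Fin n → ℂ) :
    truncate v m (finVec v n x) = finVec v n x := by
  ext i
  obtain ⟨i, rfl⟩ := v.surjective i
  by_cases hi : i < m
  · exact finVec_apply_lt v m _ ⟨i, hi⟩
  · rw [truncate, finVec_apply_ge v m _ i (by omega), finVec_apply_ge v n _ i (by omega)]

/-- A vector in the span involves only finitely many basis vectors. Every test vector from the core
is therefore available to all large finite sections. -/
theorem eventually_truncate_eq (x : Ell2 ι) (hx : x ∈ basisSpan ι) :
    ∀ᶠ n in atTop, truncate v n x = x := by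
  refine Submodule.span_induction (p := fun x _ => ∀ᶠ n in atTop, truncate v n x = x) ?_ ?_ ?_ ?_ hx
  · rintro _ ⟨j, rfl⟩
    obtain ⟨j, rfl⟩ := v.surjective j
    filter_upwards [eventually_gt_atTop j] with n hn
    have : (basisVec (v j) : Ell2 ι) = finVec v (j + 1) (Pi.single (Fin.last j) 1) := by
      unfold finVec
      rw [Finset.sum_eq_single (Fin.last j)]
      · simp
      · intro b _ hb
        simp [hb]
      · simp
    rw [this]
    exact truncate_finVec v (by omega) _
  · refine Eventually.of_forall fun n => ?_
    simp [truncate, finVec]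
  · intro x y _ _ hx hy
    filter_upwards [hx, hy] with n h1 h2
    rw [truncate_add, h1, h2]
  · intro c x _ hx
    filter_upwards [hx] with n h1
    rw [truncate_smul, h1]

end FiniteVectors

/-! ## Positive definiteness of shifted Gram matrices -/

section Gram

open Matrix

theorem gram_quadratic_form {m n : ℕ} (B : Matrix (Fin m) (Fin n) ℂ) (s : ℝ) (x : Fin n → ℂ) :
    star x ⬝ᵥ ((B.conjTranspose * B - ((s : ℂ) ^ 2) • (1 : Matrix (Fin n) (Fin n) ℂ)) *ᵥ x) =
      ((∑ i, ‖(B *ᵥ x) i‖ ^ 2 - s ^ 2 * ∑ j, ‖x j‖ ^ 2 : ℝ) : ℂ) := by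
  have key : ∀ {k : ℕ} (y : Fin k → ℂ), star y ⬝ᵥ y = ((∑ i, ‖y i‖ ^ 2 : ℝ) : ℂ) := by
    intro k y
    simp only [dotProduct, Pi.star_apply]
    push_cast
    refine Finset.sum_congr rfl fun i _ => ?_
    rw [RCLike.star_def, mul_comm, Complex.mul_conj, Complex.normSq_eq_norm_sq]
    norm_cast
  rw [sub_mulVec, dotProduct_sub, smul_mulVec, dotProduct_smul, one_mulVec, key,
    ← mulVec_mulVec, dotProduct_mulVec, ← star_mulVec, key, smul_eq_mul]
  push_cast
  ring

/-- The quadratic form of `B*B - s²` is `‖Bx‖² - s²‖x‖²`, so for `s ≥ 0` the condition says that the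
least singular value of `B` exceeds `s`. -/
theorem posDef_gram_sub_iff {m n : ℕ} (B : Matrix (Fin m) (Fin n) ℂ) (s : ℝ) :
    (B.conjTranspose * B - ((s : ℂ) ^ 2) • (1 : Matrix (Fin n) (Fin n) ℂ)).PosDef ↔
      ∀ x : Fin n → ℂ, x ≠ 0 → s ^ 2 * ∑ j, ‖x j‖ ^ 2 < ∑ i, ‖(B *ᵥ x) i‖ ^ 2 := by
  rw [posDef_iff_dotProduct_mulVec]
  have hH : (B.conjTranspose * B - ((s : ℂ) ^ 2) • (1 : Matrix (Fin n) (Fin n) ℂ)).IsHermitian := by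
    refine (isHermitian_conjTranspose_mul_self B).sub ?_
    rw [IsHermitian, conjTranspose_smul, conjTranspose_one]
    congr 1
    rw [star_pow, RCLike.star_def, Complex.conj_ofReal]
  simp only [gram_quadratic_form, hH, true_and]
  refine forall_congr' fun x => ?_
  refine forall_congr' fun _ => ?_
  rw [Complex.zero_lt_real, sub_pos]

end Gram

/-! ## Lower bounds for unbounded operators and the resolvent -/

section Coercive

/-- A lower bound for `T - z` on a core extends to the whole domain. -/
theorem lower_bound_of_core {E : Type*} [NormedAddCommGroup E] [NormedSpace ℂ E]
    {T : E →ₗ.[ℂ] E} {S : Submodule ℂ E} (hT : T.IsClosed) (hS : T.HasCore S)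
    {z : ℂ} {κ : ℝ} (h : ∀ x : T.domain, (x : E) ∈ S → κ * ‖(x : E)‖ ≤ ‖T x - z • (x : E)‖)
    (x : T.domain) : κ * ‖(x : E)‖ ≤ ‖T x - z • (x : E)‖ := by
  have hcl : (T.domRestrict S).IsClosable :=
    hT.isClosable.leIsClosable LinearPMap.domRestrict_le
  have hgr := hcl.graph_closure_eq_closure_graph
  rw [hS.closure_eq] at hgr
  have h1 : ((x : E), T x) ∈ T.graph := T.mem_graph x
  rw [← hgr, ← SetLike.mem_coe, Submodule.topologicalClosure_coe] at h1
  -- The inequality is a closed condition on pairs `(x, Tx)`, and the core property says that the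
  -- graph over `S` is dense in the graph of `T`.
  have hclosed : IsClosed {p : E × E | κ * ‖p.1‖ ≤ ‖p.2 - z • p.1‖} :=
    isClosed_le (by fun_prop) (by fun_prop)
  have hsub : ((T.domRestrict S).graph : Set (E × E)) ⊆
      {p : E × E | κ * ‖p.1‖ ≤ ‖p.2 - z • p.1‖} := by
    intro p hp
    obtain ⟨y, hy1, hy2⟩ := (LinearPMap.mem_graph_iff _).1 hp
    have hy : (y : E) ∈ S ⊓ T.domain := y.2
    have h3 : (T.domRestrict S) y = T ⟨y, hy.2⟩ :=
      (LinearPMap.domRestrict_le : T.domRestrict S ≤ T).2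
        (show (y : E) = ((⟨(y : E), hy.2⟩ : T.domain) : E) from rfl)
    have h4 := h ⟨y, hy.2⟩ hy.1
    rw [Set.mem_ofPred_eq, ← hy1, ← hy2, h3]
    exact h4
  exact closure_minimal hsub hclosed h1

variable {ι : Type*} {T : Ell2 ι →ₗ.[ℂ] Ell2 ι}

/-- If `T - z` and `T* - z̄` are bounded below by `κ > 0`, then `z` is in the resolvent set. -/
theorem exists_resolvent_of_lower_bound (hT : T.IsClosed) (hd : Dense (T.domain : Set (Ell2 ι)))
    {z : ℂ} {κ : ℝ} (hκ : 0 < κ)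
    (h : ∀ x : T.domain, κ * ‖(x : Ell2 ι)‖ ≤ ‖T x - z • (x : Ell2 ι)‖)
    (h' : ∀ x : T.adjoint.domain,
      κ * ‖(x : Ell2 ι)‖ ≤ ‖T.adjoint x - (starRingEnd ℂ z) • (x : Ell2 ι)‖) :
    ∃ B, IsResolventAt T z B := by
  let L : T.domain →ₗ[ℂ] Ell2 ι := T.toFun - z • T.domain.subtype
  have hL : ∀ x, L x = T x - z • (x : Ell2 ι) := fun x => rfl
  have hinj : Function.Injective L := by
    rw [← LinearMap.ker_eq_bot, LinearMap.ker_eq_bot']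
    intro x hx
    have h1 := h x
    rw [← hL, hx, norm_zero] at h1
    have h2 : ‖(x : Ell2 ι)‖ ≤ 0 := by
      by_contra hc
      push Not at hc
      have := mul_pos hκ hc
      linarith
    exact Subtype.ext (norm_le_zero_iff.1 h2)
  -- By the lower bound, convergence of `L x_n` makes `x_n` a Cauchy sequence; closedness of the
  -- graph then identifies the limit as a value of `L`.
  have hcl : IsClosed (LinearMap.range L : Set (Ell2 ι)) := by
    rw [← isSeqClosed_iff_isClosed]
    intro y y0 hy hlim
    choose x hx using fun n => LinearMap.mem_range.1 (hy n)
    have hc : CauchySeq fun n => (x n : Ell2 ι) := by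
      rw [Metric.cauchySeq_iff]
      intro ε hε
      obtain ⟨N, hN⟩ := Metric.cauchySeq_iff.1 hlim.cauchySeq (κ * ε) (mul_pos hκ hε)
      refine ⟨N, fun m hm n hn => ?_⟩
      have h1 := hN m hm n hn
      rw [dist_eq_norm, ← hx m, ← hx n, ← map_sub, hL] at h1
      have h2 := h (x m - x n)
      rw [dist_eq_norm]
      exact lt_of_mul_lt_mul_left (h2.trans_lt h1) hκ.le
    obtain ⟨x0, hx0⟩ := cauchySeq_tendsto_of_complete hc
    have hTx : Tendsto (fun n => T (x n)) atTop (𝓝 (y0 + z • x0)) := by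
      have : (fun n => T (x n)) = fun n => y n + z • (x n : Ell2 ι) := by
        ext1 n
        rw [← hx n, hL]
        abel
      rw [this]
      exact hlim.add (hx0.const_smul z)
    have hmem : (x0, y0 + z • x0) ∈ (T.graph : Set (Ell2 ι × Ell2 ι)) :=
      hT.mem_of_tendsto (hx0.prodMk_nhds hTx) (Eventually.of_forall fun n => T.mem_graph (x n))
    rw [SetLike.mem_coe, LinearPMap.mem_graph_iff] at hmem
    obtain ⟨w, hw1, hw2⟩ := hmem
    refine ⟨w, ?_⟩
    rw [hL]
    simp only at hw1 hw2
    rw [hw2, hw1]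
    abel
  -- A vector orthogonal to the range lies in the kernel of `T* - z̄`, which is trivial by `h'`; as
  -- the range is closed, it is everything.
  have hsurj : Function.Surjective L := by
    rw [← LinearMap.range_eq_top]
    have : CompleteSpace (LinearMap.range L) := hcl.completeSpace_coe
    rw [← Submodule.orthogonal_eq_bot_iff, Submodule.eq_bot_iff]
    intro w hw
    have h1 : ∀ x : T.domain, inner ℂ ((starRingEnd ℂ z) • w) (x : Ell2 ι) = inner ℂ w (T x) := by
      intro x
      have h2 := (Submodule.mem_orthogonal' _ _).1 hw (L x) ⟨x, rfl⟩
      rw [hL, inner_sub_right, inner_smul_right, sub_eq_zero] at h2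
      rw [inner_smul_left, h2]
      simp
    have hwd : w ∈ T.adjoint.domain := LinearPMap.mem_adjoint_domain_of_exists w ⟨_, h1⟩
    have h3 : T.adjoint ⟨w, hwd⟩ = (starRingEnd ℂ z) • w :=
      LinearPMap.adjoint_apply_eq hd ⟨w, hwd⟩ h1
    have h4 := h' ⟨w, hwd⟩
    rw [h3, sub_self, norm_zero] at h4
    have h2 : ‖w‖ ≤ 0 := by
      by_contra hc
      push Not at hc
      have := mul_pos hκ hc
      simp only at h4
      linarith
    exact norm_le_zero_iff.1 h2
  let e := LinearEquiv.ofBijective L ⟨hinj, hsurj⟩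
  let B0 : Ell2 ι →ₗ[ℂ] Ell2 ι := T.domain.subtype ∘ₗ e.symm.toLinearMap
  have hB0 : ∀ y, B0 y = (e.symm y : Ell2 ι) := fun y => rfl
  have hbd : ∀ y, ‖B0 y‖ ≤ κ⁻¹ * ‖y‖ := by
    intro y
    have h1 := h (e.symm y)
    rw [← hL] at h1
    have h2 : L (e.symm y) = y := e.apply_symm_apply y
    rw [h2] at h1
    rw [hB0, inv_mul_eq_div, le_div_iff₀ hκ, mul_comm]
    exact h1
  refine ⟨B0.mkContinuous κ⁻¹ hbd, fun y => ⟨(e.symm y).2, ?_⟩, fun x => ?_⟩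
  · have h2 : L (e.symm y) = y := e.apply_symm_apply y
    exact h2
  · have h2 : e.symm (L x) = x := e.symm_apply_apply x
    rw [← hL]
    change B0 (L x) = x
    rw [hB0, h2]

theorem isResolventAt_resolventOp {z : ℂ} (hz : z ∉ spec T) :
    IsResolventAt T z (resolventOp T z) := by
  have h : ∃ B, IsResolventAt T z B := by
    by_contra h
    exact hz h
  unfold resolventOp
  rw [dif_pos h]
  exact h.choose_spec

/-- A zero resolvent would give `(T - z)0 = e_j`. This is needed because the inverse of `0` is `0`
by convention: it guarantees that `‖R‖⁻¹` vanishes only on the spectrum. -/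
theorem resolventOp_ne_zero [Nonempty ι] {z : ℂ} (hz : z ∉ spec T) : resolventOp T z ≠ 0 := by
  intro h0
  obtain ⟨j⟩ := ‹Nonempty ι›
  obtain ⟨h, hx⟩ := (isResolventAt_resolventOp hz).1 (basisVec j)
  have h1 : (⟨resolventOp T z (basisVec j), h⟩ : T.domain) = 0 := by
    apply Subtype.ext
    simp [h0]
  rw [h1, LinearPMap.map_zero, h0] at hx
  have := norm_basisVec j
  rw [← hx] at this
  simp at this

theorem invResolventNorm_nonneg (T : Ell2 ι →ₗ.[ℂ] Ell2 ι) (z : ℂ) : 0 ≤ invResolventNorm T z := by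
  unfold invResolventNorm
  split_ifs <;> positivity

theorem invResolventNorm_pos [Nonempty ι] {z : ℂ} (hz : z ∉ spec T) : 0 < invResolventNorm T z := by
  unfold invResolventNorm
  rw [if_neg hz]
  have := norm_pos_iff.2 (resolventOp_ne_zero hz)
  positivity

theorem invResolventNorm_eq_zero_iff [Nonempty ι] {z : ℂ} :
    invResolventNorm T z = 0 ↔ z ∈ spec T := by
  constructor
  · intro h
    by_contra hz
    exact (invResolventNorm_pos hz).ne' h
  · intro h
    simp [invResolventNorm, h]

/-- The pseudospectrum in terms of `‖R(z, T)‖⁻¹`. -/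
theorem pseudoSpec_eq [Nonempty ι] {ε : ℝ} (hε : 0 < ε) :
    pseudoSpec T ε = closure {z | invResolventNorm T z < ε} := by
  unfold pseudoSpec
  congr 1
  ext z
  simp only [Set.mem_ofPred_eq]
  by_cases hz : z ∈ spec T
  · simp [hz, invResolventNorm_eq_zero_iff.2 hz, hε]
  · have h := norm_pos_iff.2 (resolventOp_ne_zero hz)
    simp only [hz, false_or, invResolventNorm, if_false]
    rw [one_div, inv_lt_comm₀ hε h]

theorem invResolventNorm_mul_norm_le {z : ℂ} (x : T.domain) :
    invResolventNorm T z * ‖(x : Ell2 ι)‖ ≤ ‖T x - z • (x : Ell2 ι)‖ := by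
  by_cases hz : z ∈ spec T
  · simp [invResolventNorm, hz]
  · unfold invResolventNorm
    rw [if_neg hz]
    have h := (isResolventAt_resolventOp hz).2 x
    by_cases h0 : ‖resolventOp T z‖ = 0
    · simp [h0]
    · have h0' : 0 < ‖resolventOp T z‖ := lt_of_le_of_ne (norm_nonneg _) (Ne.symm h0)
      rw [inv_mul_le_iff₀ h0']
      conv_lhs => rw [← h]
      exact (resolventOp T z).le_opNorm _

/-- The bound for `T* - z̄` follows by duality from the resolvent of `T` alone, without constructing
the resolvent of the adjoint. -/
theorem invResolventNorm_mul_norm_le_adjoint (hd : Dense (T.domain : Set (Ell2 ι))) {z : ℂ}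
    (y : T.adjoint.domain) :
    invResolventNorm T z * ‖(y : Ell2 ι)‖ ≤ ‖T.adjoint y - (starRingEnd ℂ z) • (y : Ell2 ι)‖ := by
  by_cases hz : z ∈ spec T
  · simp [invResolventNorm, hz]
  · unfold invResolventNorm
    rw [if_neg hz]
    by_cases h0 : ‖resolventOp T z‖ = 0
    · simp [h0]
    have h0' : 0 < ‖resolventOp T z‖ := lt_of_le_of_ne (norm_nonneg _) (Ne.symm h0)
    rw [inv_mul_le_iff₀ h0']
    obtain ⟨h, hx⟩ := (isResolventAt_resolventOp hz).1 (y : Ell2 ι)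
    -- Insert `y = (T - z) R y` in the second argument and move `T - z` to the other side.
    have h1 : inner ℂ (y : Ell2 ι) (y : Ell2 ι) =
        inner ℂ (T.adjoint y - (starRingEnd ℂ z) • (y : Ell2 ι)) (resolventOp T z y) := by
      conv_lhs => rhs; rw [← hx]
      rw [inner_sub_right, inner_sub_left, inner_smul_right, inner_smul_left, Complex.conj_conj]
      congr 1
      exact (LinearPMap.adjoint_isFormalAdjoint hd y ⟨_, h⟩).symm
    have h2 : ‖(y : Ell2 ι)‖ * ‖(y : Ell2 ι)‖ ≤
        ‖resolventOp T z‖ * ‖T.adjoint y - (starRingEnd ℂ z) • (y : Ell2 ι)‖ * ‖(y : Ell2 ι)‖ := by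
      calc ‖(y : Ell2 ι)‖ * ‖(y : Ell2 ι)‖ = ‖inner ℂ (y : Ell2 ι) (y : Ell2 ι)‖ := by
            rw [inner_self_eq_norm_sq_to_K, ← sq]; simp
        _ ≤ ‖T.adjoint y - (starRingEnd ℂ z) • (y : Ell2 ι)‖ * ‖resolventOp T z y‖ := by
            rw [h1]; exact norm_inner_le_norm _ _
        _ ≤ ‖T.adjoint y - (starRingEnd ℂ z) • (y : Ell2 ι)‖ *
            (‖resolventOp T z‖ * ‖(y : Ell2 ι)‖) := by
            gcongr; exact (resolventOp T z).le_opNorm _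
        _ = _ := by ring
    by_cases hy : ‖(y : Ell2 ι)‖ = 0
    · rw [hy]; positivity
    · exact le_of_mul_le_mul_right h2 (lt_of_le_of_ne (norm_nonneg _) (Ne.symm hy))

/-- Lower bounds for `T - z` and `T* - z̄` on cores bound `‖R(z, T)‖⁻¹` from below. -/
theorem le_invResolventNorm [Nonempty ι] (hT : IsAdmissible T) {z : ℂ} {κ : ℝ} (hκ : 0 < κ)
    (h : ∀ x : T.domain, (x : Ell2 ι) ∈ basisSpan ι →
      κ * ‖(x : Ell2 ι)‖ ≤ ‖T x - z • (x : Ell2 ι)‖)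
    (h' : ∀ x : T.adjoint.domain, (x : Ell2 ι) ∈ basisSpan ι →
      κ * ‖(x : Ell2 ι)‖ ≤ ‖T.adjoint x - (starRingEnd ℂ z) • (x : Ell2 ι)‖) :
    κ ≤ invResolventNorm T z := by
  have h1 := lower_bound_of_core hT.closed hT.core h
  have h2 := lower_bound_of_core (LinearPMap.adjoint_isClosed hT.dense) hT.core_adjoint h'
  have hz : z ∉ spec T := fun hz => hz (exists_resolvent_of_lower_bound hT.closed hT.dense hκ h1 h2)
  unfold invResolventNorm
  rw [if_neg hz, le_inv_comm₀ hκ (norm_pos_iff.2 (resolventOp_ne_zero hz))]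
  refine ContinuousLinearMap.opNorm_le_bound _ (by positivity) fun y => ?_
  obtain ⟨hy, hx⟩ := (isResolventAt_resolventOp hz).1 y
  have h3 := h1 ⟨_, hy⟩
  rw [hx] at h3
  rw [inv_mul_eq_div, le_div_iff₀ hκ, mul_comm]
  exact h3

end Coercive

/-! ## Rectangular sections of the matrix of an operator -/

section Sections

variable {ι : Type*} (v : ℕ ≃ ι) (T : Ell2 ι →ₗ.[ℂ] Ell2 ι)

/-- The value of `T` on a finite linear combination of basis vectors. -/
noncomputable def colComb (n : ℕ) (x : Fin n → ℂ) : Ell2 ι := ∑ j, x j • col T (v j)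

variable {T}

theorem entry_eq_col (i j : ι) : entry T i j = col T j i := inner_basisVec _ _

theorem col_eq {j : ι} (h : basisVec j ∈ T.domain) : col T j = T ⟨basisVec j, h⟩ := by
  unfold col
  rw [dif_pos h]

theorem apply_finVec (hT : basisSpan ι ≤ T.domain) (n : ℕ) (x : Fin n → ℂ) :
    T ⟨finVec v n x, hT (finVec_mem v n x)⟩ = colComb v T n x := by
  have : (⟨finVec v n x, hT (finVec_mem v n x)⟩ : T.domain) =
      ∑ j, x j • (⟨basisVec (v j), hT (basisVec_mem_basisSpan _)⟩ : T.domain) := by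
    apply Subtype.ext
    simp [finVec]
  rw [this]
  change T.toFun _ = _
  rw [map_sum]
  unfold colComb
  refine Finset.sum_congr rfl fun j _ => ?_
  rw [map_smul, col_eq (hT (basisVec_mem_basisSpan _))]
  rfl

/-- This identifies the second section used by the routine, formed from conjugated rows of the
matrix, with a section of the operator `T*`. -/
theorem entry_adjoint (hT : IsAdmissible T) (i j : ι) :
    entry T.adjoint i j = star (entry T j i) := by
  have h1 := hT.core.le_domain (basisVec_mem_basisSpan i)
  have h2 := hT.core_adjoint.le_domain (basisVec_mem_basisSpan j)
  unfold entry
  rw [col_eq h1, col_eq h2]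
  have := LinearPMap.adjoint_isFormalAdjoint hT.dense ⟨_, h2⟩ ⟨_, h1⟩
  rw [RCLike.star_def, inner_conj_symm, ← inner_conj_symm, this, inner_conj_symm]

theorem colComb_apply (n : ℕ) (x : Fin n → ℂ) (i : ι) :
    colComb v T n x i = ∑ j : Fin n, entry T i (v j) * x j := by
  rw [← inner_basisVec]
  unfold colComb
  rw [inner_sum]
  refine Finset.sum_congr rfl fun j _ => ?_
  rw [inner_smul_right, mul_comm]
  rfl

open Matrix in
-- Applying the section to coordinates amounts to applying `T - z` to a finite vector and discarding
-- the coordinates from `m` on.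
theorem sum_norm_sq_rectSection {n m : ℕ} (z : ℂ) (x : Fin n → ℂ) :
    ∑ i, ‖((rectSection (fun i j => entry T (v i) (v j)) m n z) *ᵥ x) i‖ ^ 2 =
      ‖truncate v m (colComb v T n x - z • finVec v n x)‖ ^ 2 := by
  rw [norm_sq_truncate]
  refine Finset.sum_congr rfl fun i _ => ?_
  congr 2
  have h1 : (colComb v T n x - z • finVec v n x) (v i) =
      colComb v T n x (v i) - z * finVec v n x (v i) := rfl
  rw [h1, colComb_apply]
  simp only [mulVec, dotProduct, rectSection, of_apply, sub_mul, Finset.sum_sub_distrib]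
  congr 1
  by_cases hi : (i : ℕ) < n
  · rw [show v i = v ((⟨i, hi⟩ : Fin n) : ℕ) from rfl, finVec_apply_lt,
      Finset.sum_eq_single ⟨i, hi⟩]
    · simp
    · intro j _ hj
      rw [if_neg, zero_mul]
      intro hij
      exact hj (Fin.ext hij.symm)
    · simp
  · rw [finVec_apply_ge v n x i (by omega), mul_zero]
    refine Finset.sum_eq_zero fun j _ => ?_
    rw [if_neg (by omega), zero_mul]

open Matrix in
/-- Positive definiteness of `B*B - s²` for a rectangular section `B` of `T - z`. -/
theorem posDef_section_iff {n m : ℕ} (z : ℂ) {s : ℝ} (hs : 0 ≤ s)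
    (B : Matrix (Fin m) (Fin n) ℂ) (hB : B = rectSection (fun i j => entry T (v i) (v j)) m n z) :
    (B.conjTranspose * B - ((s : ℂ) ^ 2) • (1 : Matrix (Fin n) (Fin n) ℂ)).PosDef ↔
      ∀ x : Fin n → ℂ, x ≠ 0 →
        s * ‖finVec v n x‖ < ‖truncate v m (colComb v T n x - z • finVec v n x)‖ := by
  rw [posDef_gram_sub_iff]
  refine forall_congr' fun x => forall_congr' fun _ => ?_
  rw [hB, sum_norm_sq_rectSection v, ← norm_sq_finVec v, ← mul_pow,
    pow_lt_pow_iff_left₀ (by positivity) (norm_nonneg _) two_ne_zero]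

/-- The set of the numbers `l` whose minimum determines `distSpec`. -/
def stopSet (a : ℕ → ℕ → ℂ) (n m : ℕ) (z : ℂ) : Set ℕ :=
  let B := rectSection a m n z
  let C := rectSection (fun i j => star (a j i)) m n (star z)
  {l : ℕ | 1 ≤ l ∧
    ¬ ((B.conjTranspose * B - (((l : ℂ) / n) ^ 2) • (1 : Matrix (Fin n) (Fin n) ℂ)).PosDef ∧
      (C.conjTranspose * C - (((l : ℂ) / n) ^ 2) • (1 : Matrix (Fin n) (Fin n) ℂ)).PosDef)}

theorem distSpec_eq (a : ℕ → ℕ → ℂ) (n m : ℕ) (z : ℂ) :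
    distSpec a n m z = (sInf (stopSet a n m z) : ℕ) / (n : ℝ) := rfl

/-- Failure of definiteness is the existence of an approximate eigenvector of `T` or `T*` in the
section. This form is the bridge between the routine and operator theory. -/
theorem mem_stopSet_iff (hT : IsAdmissible T) {n m : ℕ} (z : ℂ) (l : ℕ) :
    l ∈ stopSet (fun i j => entry T (v i) (v j)) n m z ↔ 1 ≤ l ∧ ∃ x : Fin n → ℂ, x ≠ 0 ∧
      (‖truncate v m (colComb v T n x - z • finVec v n x)‖ ≤ (l / n : ℝ) * ‖finVec v n x‖ ∨
        ‖truncate v m (colComb v T.adjoint n x - (star z) • finVec v n x)‖ ≤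
          (l / n : ℝ) * ‖finVec v n x‖) := by
  have hl : ((l : ℂ) / n) = (((l : ℝ) / n : ℝ) : ℂ) := by push_cast; rfl
  unfold stopSet
  simp only [Set.mem_ofPred_eq, hl]
  rw [posDef_section_iff v z (by positivity) _ rfl,
    posDef_section_iff (T := T.adjoint) v (star z) (by positivity) _
      (by simp only [entry_adjoint hT])]
  refine and_congr_right fun _ => ?_
  rw [not_and_or]
  push Not
  constructor
  · rintro (⟨x, hx, h1⟩ | ⟨x, hx, h1⟩)
    exacts [⟨x, hx, .inl h1⟩, ⟨x, hx, .inr h1⟩]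
  · rintro ⟨x, hx, h1 | h1⟩
    exacts [.inl ⟨x, hx, h1⟩, .inr ⟨x, hx, h1⟩]

/-- The number `⌊nκ⌋ + 1` is positive and, divided by `n`, is at least `κ`, so a vector with
quotient at most `κ` already violates definiteness there. The rounding costs at most `1/n`, as used
in `distSpec_le`. -/
theorem stopSet_mem_of_le (hT : IsAdmissible T) {n m : ℕ} (hn : 1 ≤ n) (z : ℂ) {κ : ℝ}
    {x : Fin n → ℂ} (hx : x ≠ 0)
    (hx' : ‖truncate v m (colComb v T n x - z • finVec v n x)‖ ≤ κ * ‖finVec v n x‖ ∨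
        ‖truncate v m (colComb v T.adjoint n x - (star z) • finVec v n x)‖ ≤
          κ * ‖finVec v n x‖) :
    ⌊n * κ⌋₊ + 1 ∈ stopSet (fun i j => entry T (v i) (v j)) n m z := by
  rw [mem_stopSet_iff v hT]
  refine ⟨by omega, x, hx, ?_⟩
  have hn' : (0 : ℝ) < n := by exact_mod_cast hn
  have h1 : κ ≤ ((⌊n * κ⌋₊ + 1 : ℕ) : ℝ) / n := by
    rw [le_div_iff₀ hn', mul_comm]
    push_cast
    exact (Nat.lt_floor_add_one _).le
  rcases hx' with hx' | hx'
  · exact .inl (hx'.trans (by gcongr))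
  · exact .inr (hx'.trans (by gcongr))

theorem distSpec_le (hT : IsAdmissible T) {n m : ℕ} (hn : 1 ≤ n) (z : ℂ) {κ : ℝ}
    (hκ : 0 ≤ κ) {x : Fin n → ℂ} (hx : x ≠ 0)
    (hx' : ‖truncate v m (colComb v T n x - z • finVec v n x)‖ ≤ κ * ‖finVec v n x‖ ∨
        ‖truncate v m (colComb v T.adjoint n x - (star z) • finVec v n x)‖ ≤
          κ * ‖finVec v n x‖) :
    distSpec (fun i j => entry T (v i) (v j)) n m z ≤ κ + 1 / n := by
  have hn' : (0 : ℝ) < n := by exact_mod_cast hn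
  rw [distSpec_eq]
  have h1 := Nat.sInf_le (stopSet_mem_of_le v hT hn z hx hx')
  have h2 : ((sInf (stopSet (fun i j => entry T (v i) (v j)) n m z) : ℕ) : ℝ) ≤ n * κ + 1 := by
    calc _ ≤ ((⌊n * κ⌋₊ + 1 : ℕ) : ℝ) := by exact_mod_cast h1
      _ ≤ n * κ + 1 := by push_cast; gcongr; exact Nat.floor_le (by positivity)
  rw [div_le_iff₀ hn', add_mul, one_div, inv_mul_cancel₀ hn'.ne']
  linarith

/-- The first basis vector, with its own quotient as `κ`, stops the search. Non-emptiness matters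
since the infimum of the empty set would be `0`. -/
theorem stopSet_nonempty (hT : IsAdmissible T) {n m : ℕ} (hn : 1 ≤ n) (z : ℂ) :
    (stopSet (fun i j => entry T (v i) (v j)) n m z).Nonempty := by
  have hx : (Pi.single (⟨0, hn⟩ : Fin n) 1 : Fin n → ℂ) ≠ 0 := by simp
  set x : Fin n → ℂ := Pi.single (⟨0, hn⟩ : Fin n) 1
  have h0 := norm_pos_iff.2 (finVec_ne_zero v hx)
  refine ⟨_, stopSet_mem_of_le v hT hn z
    (κ := ‖truncate v m (colComb v T n x - z • finVec v n x)‖ / ‖finVec v n x‖)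
    hx (.inl ?_)⟩
  rw [div_mul_cancel₀ _ h0.ne']

/-- The properties of `distSpec` used in the convergence proofs: `γ` is `‖R(z, A)‖⁻¹`, and `S` the
spectrum. -/
structure IsApprox (S : Set ℂ) (γ : ℂ → ℝ) (F : ℕ → ℂ → ℝ) (c : ℕ → ℝ) : Prop where
  closed : IsClosed S
  nonempty : S.Nonempty
  mem_iff : ∀ z, γ z = 0 ↔ z ∈ S
  tendsto_c : Tendsto c atTop (𝓝 0)
  lower : ∀ n, 1 ≤ n → ∀ z, γ z ≤ F n z + c n
  upper : ∀ z κ, γ z < κ → ∀ᶠ n : ℕ in atTop, ∀ w, F n w ≤ κ + ‖w - z‖ + 1 / n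

/-- Lower bound: the vector at which the search stops has a small truncated residual, and restoring
the discarded rows costs at most `c n`. Upper bound: if `γ z < κ`, then some finite vector has
residual below `κ` for `T` or for `T*`, and it enters every large section. -/
theorem isApprox_distSpec (hT : IsAdmissible T) (hne : (spec T).Nonempty) {rows : ℕ → ℕ}
    {c : ℕ → ℝ} (hrows : ∀ n, n ≤ rows n) (hc : Tendsto c atTop (𝓝 0))
    (htail : ∀ n x, ‖colComb v T n x - truncate v (rows n) (colComb v T n x)‖ ≤
      c n * ‖finVec v n x‖)
    (htail' : ∀ n x,
      ‖colComb v T.adjoint n x - truncate v (rows n) (colComb v T.adjoint n x)‖ ≤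
      c n * ‖finVec v n x‖) :
    IsApprox (spec T) (invResolventNorm T)
      (fun n z => distSpec (fun i j => entry T (v i) (v j)) n (rows n) z) c := by
  have hι : Nonempty ι := ⟨v 0⟩
  refine ⟨isClosed_spec, hne, fun z => invResolventNorm_eq_zero_iff, hc,
    fun n hn z => ?_, fun z κ hκ => ?_⟩
  · obtain ⟨-, x, hx, h1⟩ := (mem_stopSet_iff v hT z _).1
      (Nat.sInf_mem (stopSet_nonempty v hT hn z))
    rw [← distSpec_eq] at h1
    have h0 := norm_pos_iff.2 (finVec_ne_zero v hx)
    -- Since `n ≤ rows n`, truncation does not change the finite vector itself, so only the tail of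
    -- `y` is lost.
    have key : ∀ (y : Ell2 ι) (w : ℂ), ‖y - w • finVec v n x‖ ≤
        ‖truncate v (rows n) (y - w • finVec v n x)‖ + ‖y - truncate v (rows n) y‖ := by
      intro y w
      refine le_trans (le_of_eq ?_) (norm_add_le _ _)
      rw [truncate_sub, truncate_smul, truncate_finVec v (hrows n)]
      congr 1
      abel
    have h2 : invResolventNorm T z * ‖finVec v n x‖ ≤
        (distSpec (fun i j => entry T (v i) (v j)) n (rows n) z + c n) * ‖finVec v n x‖ := by
      rw [add_mul]
      rcases h1 with h1 | h1
      · have h3 := invResolventNorm_mul_norm_le (z := z)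
          ⟨finVec v n x, hT.core.le_domain (finVec_mem v n x)⟩
        rw [apply_finVec] at h3
        exact (h3.trans (key _ _)).trans (add_le_add h1 (htail n x))
      · have h3 := invResolventNorm_mul_norm_le_adjoint hT.dense (z := z)
          ⟨finVec v n x, hT.core_adjoint.le_domain (finVec_mem v n x)⟩
        rw [apply_finVec] at h3
        exact (h3.trans (key _ _)).trans (add_le_add h1 (htail' n x))
    exact le_of_mul_le_mul_right h2 h0
  · have hκ0 : 0 < κ := (invResolventNorm_nonneg T z).trans_lt hκ
    -- Otherwise `κ` would be a lower bound on both cores, and hence at most `γ z`.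
    have hex : ∃ X : Ell2 ι, X ∈ basisSpan ι ∧
        ((∃ h : X ∈ T.domain, ‖T ⟨X, h⟩ - z • X‖ < κ * ‖X‖) ∨
          ∃ h : X ∈ T.adjoint.domain, ‖T.adjoint ⟨X, h⟩ - (star z) • X‖ < κ * ‖X‖) := by
      by_contra hcon
      push Not at hcon
      refine absurd (le_invResolventNorm hT hκ0 (fun x hx => ?_) fun x hx => ?_) hκ.not_ge
      · exact (hcon x hx).1 x.2
      · exact (hcon x hx).2 x.2
    obtain ⟨X, hX, hX'⟩ := hex
    have hX0 : X ≠ 0 := by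
      rintro rfl
      rcases hX' with ⟨h, h1⟩ | ⟨h, h1⟩ <;>
      · rw [norm_zero, mul_zero] at h1
        exact absurd h1 (norm_nonneg _).not_gt
    filter_upwards [eventually_truncate_eq v X hX, eventually_ge_atTop 1] with n hn hn1 w
    have hX2 : finVec v n (fun i => X (v i)) = X := hn
    set x : Fin n → ℂ := fun i => X (v i)
    have hx : x ≠ 0 := by
      intro h
      apply hX0
      rw [← hX2, h]
      simp [finVec]
    refine distSpec_le v hT hn1 w (by positivity) hx ?_
    -- The same vector `X` serves all `w` simultaneously, at the price `|w - z|`; this makes the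
    -- upper bound uniform in `w`.
    have key : ∀ (y : Ell2 ι) (w z : ℂ), ‖y - z • X‖ < κ * ‖X‖ →
        ‖truncate v (rows n) (y - w • X)‖ ≤ (κ + ‖w - z‖) * ‖X‖ := by
      intro y w z h
      refine (norm_truncate_le v _ _).trans ?_
      have h2 : y - w • X = (y - z • X) - (w - z) • X := by
        rw [sub_smul]; abel
      rw [h2, add_mul, ← norm_smul]
      exact (norm_sub_le _ _).trans (by gcongr)
    rw [hX2]
    rcases hX' with ⟨h, h1⟩ | ⟨h, h1⟩
    · left
      refine key _ w z ?_
      have h2 := apply_finVec v hT.core.le_domain n x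
      simp only [hX2] at h2
      rwa [← h2]
    · right
      have h3 : ‖w - z‖ = ‖star w - star z‖ := by rw [← star_sub, norm_star]
      rw [h3]
      refine key _ (star w) (star z) ?_
      have h2 := apply_finVec v hT.core_adjoint.le_domain n x
      simp only [hX2] at h2
      rwa [← h2]

end Sections

/-! ## The two classes of operators -/

/-- The dispersion is the operator norm of the map sending a vector of the section to the tail of
its image, so its bound `c_n` is the required tail estimate, for `A` and `A*` alike. -/
theorem DispOp.isApprox {f : ℕ → ℕ} (hf : ∀ n, n ≤ f n) (A : DispOp f) :
    IsApprox (spec A.op) (invResolventNorm A.op) (fun n z => distSpec A.mat n (f n) z)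
      (fun n => (A.c n : ℝ)) := by
  have key : ∀ (S : Ell2 ℕ →ₗ.[ℂ] Ell2 ℕ) (n : ℕ) (d : ℝ)
      (_ : ‖(1 - proj (f n)) ∘L mulProj S n‖ ≤ d) (x : Fin n → ℂ),
      ‖colComb (Equiv.refl ℕ) S n x - truncate (Equiv.refl ℕ) (f n) (colComb (Equiv.refl ℕ) S n x)‖
        ≤ d * ‖finVec (Equiv.refl ℕ) n x‖ := by
    intro S n d hd x
    have h1 : ∀ y, proj (f n) y = truncate (Equiv.refl ℕ) (f n) y := by
      intro y
      rw [truncate_eq_range_sum]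
      simp [proj, inner_basisVec]
    have h2 : mulProj S n (finVec (Equiv.refl ℕ) n x) = colComb (Equiv.refl ℕ) S n x := by
      unfold mulProj colComb
      rw [_root_.sum_apply, ← Fin.sum_univ_eq_sum_range
        (fun j => ((innerSL ℂ (basisVec j)).smulRight (col S j)) (finVec (Equiv.refl ℕ) n x))]
      refine Finset.sum_congr rfl fun j _ => ?_
      rw [ContinuousLinearMap.smulRight_apply, innerSL_apply_apply, inner_basisVec]
      congr 1
      exact finVec_apply_lt (Equiv.refl ℕ) n x j
    have h3 := ((1 - proj (f n)) ∘L mulProj S n).le_of_opNorm_le hd (finVec (Equiv.refl ℕ) n x)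
    rw [ContinuousLinearMap.comp_apply, h2, _root_.sub_apply, h1] at h3
    exact h3
  refine isApprox_distSpec (Equiv.refl ℕ) A.admissible A.spec_nonempty hf ?_ ?_ ?_
  · have := (Rat.continuous_coe_real.tendsto 0).comp A.tendsto_c
    simpa [Function.comp_def] using this
  · exact fun n x => key _ n _ ((le_max_left _ _).trans (A.dispersion_le n)) x
  · exact fun n x => key _ n _ ((le_max_right _ _).trans (A.dispersion_le n)) x

theorem GraphOp.le_rows {V : Type*} {G : SimpleGraph V} {v : ℕ ≃ V} (A : GraphOp G v) (n : ℕ) :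
    n ≤ A.rows n := le_max_left _ _

theorem GraphOp.lt_rows {V : Type*} {G : SimpleGraph V} {v : ℕ ≃ V} (A : GraphOp G v) {k n : ℕ}
    (h : k < n) : A.S k < A.rows n :=
  (Nat.lt_succ_self _).trans_le ((Finset.le_sup (f := fun k => A.S k + 1)
    (Finset.mem_range.2 h)).trans (le_max_right _ _))

/-- Here `rows n` exceeds all indices of non-zero entries in the first `n` columns and rows, so the
tails vanish and `c = 0` is allowed. -/
theorem GraphOp.isApprox {V : Type*} {G : SimpleGraph V} {v : ℕ ≃ V} (A : GraphOp G v) :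
    IsApprox (spec A.op) (invResolventNorm A.op) (fun n z => distSpec A.mat n (A.rows n) z)
      (fun _ => 0) := by
  have key : ∀ (S : Ell2 V →ₗ.[ℂ] Ell2 V)
      (_ : ∀ k m, A.S k < m → entry S (v m) (v k) = 0) (n : ℕ) (x : Fin n → ℂ),
      ‖colComb v S n x - truncate v (A.rows n) (colComb v S n x)‖ ≤ 0 * ‖finVec v n x‖ := by
    intro S hS n x
    rw [zero_mul, norm_le_zero_iff, sub_eq_zero]
    ext i
    obtain ⟨i, rfl⟩ := v.surjective i
    by_cases hi : i < A.rows n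
    · exact (finVec_apply_lt v (A.rows n) (fun i => colComb v S n x (v i)) ⟨i, hi⟩).symm
    · rw [truncate, finVec_apply_ge v _ _ i (by omega), colComb_apply]
      refine Finset.sum_eq_zero fun j _ => ?_
      rw [hS j i (by have := A.lt_rows j.2; omega), zero_mul]
  refine isApprox_distSpec v A.admissible A.spec_nonempty A.le_rows tendsto_const_nhds
    (key _ fun k m h => (A.support k m h).2) (key _ fun k m h => ?_)
  rw [entry_adjoint A.admissible, (A.support k m h).1, star_zero]

/-! ## The Attouch--Wets distance -/

section AttouchWets

theorem abs_infDist_sub_le {C D : Set ℂ} {r : ℝ} {x : ℂ} (hx : ‖x‖ ≤ r) :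
    |Metric.infDist x C - Metric.infDist x D| ≤
      2 * r + (Metric.infDist 0 C + Metric.infDist 0 D) := by
  have h1 : ∀ C : Set ℂ, Metric.infDist x C ≤ Metric.infDist 0 C + r := fun C => by
    have := Metric.infDist_le_infDist_add_dist (s := C) (x := x) (y := 0)
    rw [dist_zero_right] at this
    linarith
  have h2 := h1 C
  have h3 := h1 D
  have h4 := Metric.infDist_nonneg (x := x) (s := C)
  have h5 := Metric.infDist_nonneg (x := x) (s := D)
  have h6 := Metric.infDist_nonneg (x := 0) (s := C)
  have h7 := Metric.infDist_nonneg (x := 0) (s := D)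
  rw [abs_le]
  have h8 := norm_nonneg x
  constructor <;> linarith

/-- Boundedness is what makes the supremum in the metric dominate its members; the supremum of an
unbounded real family would be `0` by default. -/
theorem bddAbove_infDist_sub (C D : Set ℂ) (r : ℝ) :
    BddAbove (Set.range fun x : Metric.closedBall (0 : ℂ) r =>
      |Metric.infDist (x : ℂ) C - Metric.infDist (x : ℂ) D|) := by
  refine ⟨2 * r + (Metric.infDist 0 C + Metric.infDist 0 D), ?_⟩
  rintro _ ⟨x, rfl⟩
  exact abs_infDist_sub_le (mem_closedBall_zero_iff.1 x.2)

theorem dAW_term_nonneg (C D : Set ℂ) (n : ℕ) : 0 ≤ (2 : ℝ)⁻¹ ^ (n + 1) *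
    min 1 (⨆ x : Metric.closedBall (0 : ℂ) (n + 1),
      |Metric.infDist (x : ℂ) C - Metric.infDist (x : ℂ) D|) :=
  mul_nonneg (by positivity) (le_min zero_le_one (Real.iSup_nonneg fun _ => abs_nonneg _))

theorem hasSum_half_pow_succ : HasSum (fun n : ℕ => (2 : ℝ)⁻¹ ^ (n + 1)) 1 := by
  have h := hasSum_geometric_two.mul_left (2 : ℝ)⁻¹
  simpa [pow_succ, mul_comm, one_div] using h

theorem summable_dAW (C D : Set ℂ) : Summable fun n : ℕ => (2 : ℝ)⁻¹ ^ (n + 1) *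
    min 1 (⨆ x : Metric.closedBall (0 : ℂ) (n + 1),
      |Metric.infDist (x : ℂ) C - Metric.infDist (x : ℂ) D|) :=
  Summable.of_nonneg_of_le (dAW_term_nonneg C D)
    (fun n => mul_le_of_le_one_right (by positivity) (min_le_left _ _))
    hasSum_half_pow_succ.summable

theorem dAW_nonneg (C D : Set ℂ) : 0 ≤ dAW C D := tsum_nonneg (dAW_term_nonneg C D)

theorem le_dAW (C D : Set ℂ) {k : ℕ} {x : ℂ} (hx : ‖x‖ ≤ k + 1) :
    (2 : ℝ)⁻¹ ^ (k + 1) * min 1 |Metric.infDist x C - Metric.infDist x D| ≤ dAW C D := by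
  refine le_trans ?_ ((summable_dAW C D).le_tsum k fun n _ => dAW_term_nonneg C D n)
  gcongr
  exact le_ciSup (bddAbove_infDist_sub C D (k + 1)) ⟨x, mem_closedBall_zero_iff.2 hx⟩

/-- The terms for the balls of radius at most `K` contribute at most `s` in total; each remaining
minimum is at most `1`, and the remaining weights sum to `2⁻ᴷ`. -/
theorem dAW_le {C D : Set ℂ} {K : ℕ} {s : ℝ}
    (h : ∀ x : ℂ, ‖x‖ ≤ K → |Metric.infDist x C - Metric.infDist x D| ≤ s) :
    dAW C D ≤ s + (2 : ℝ)⁻¹ ^ K := by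
  have hs : 0 ≤ s := (abs_nonneg _).trans (h 0 (by simp))
  have h1 : HasSum (fun n : ℕ => s * (2 : ℝ)⁻¹ ^ (n + 1)) (s * 1) := hasSum_half_pow_succ.mul_left s
  have h2 : HasSum (fun n : ℕ => if n < K then 0 else (2 : ℝ)⁻¹ ^ (n + 1)) ((2 : ℝ)⁻¹ ^ K) := by
    rw [← hasSum_nat_add_iff' K, Finset.sum_eq_zero fun i hi => if_pos (Finset.mem_range.1 hi),
      sub_zero]
    have h3 := hasSum_half_pow_succ.mul_left ((2 : ℝ)⁻¹ ^ K)
    rw [mul_one] at h3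
    have h4 : (fun n : ℕ => if n + K < K then 0 else (2 : ℝ)⁻¹ ^ (n + K + 1)) =
        fun n : ℕ => (2 : ℝ)⁻¹ ^ K * (2 : ℝ)⁻¹ ^ (n + 1) := by
      ext n
      rw [if_neg (by omega), ← pow_add]
      congr 1
      omega
    rw [h4]
    exact h3
  have h3 := h1.add h2
  rw [mul_one] at h3
  rw [← h3.tsum_eq]
  refine (summable_dAW C D).tsum_le_tsum (fun n => ?_) h3.summable
  by_cases hn : n < K
  · rw [if_pos hn, add_zero, mul_comm s]
    gcongr
    refine (min_le_right _ _).trans (Real.iSup_le (fun x => h x ?_) hs)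
    refine (mem_closedBall_zero_iff.1 x.2).trans ?_
    exact_mod_cast hn
  · rw [if_neg hn]
    have : (2 : ℝ)⁻¹ ^ (n + 1) * min 1 (⨆ x : Metric.closedBall (0 : ℂ) (n + 1),
        |Metric.infDist (x : ℂ) C - Metric.infDist (x : ℂ) D|) ≤ (2 : ℝ)⁻¹ ^ (n + 1) :=
      mul_le_of_le_one_right (by positivity) (min_le_left _ _)
    have h4 : 0 ≤ s * (2 : ℝ)⁻¹ ^ (n + 1) := by positivity
    linarith

theorem tendsto_dAW {C : ℕ → Set ℂ} {D : Set ℂ}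
    (h : ∀ r δ : ℝ, 0 < δ → ∀ᶠ n in atTop, ∀ x : ℂ, ‖x‖ ≤ r →
      |Metric.infDist x (C n) - Metric.infDist x D| ≤ δ) :
    Tendsto (fun n => dAW (C n) D) atTop (𝓝 0) := by
  rw [Metric.tendsto_nhds]
  intro ε hε
  obtain ⟨K, hK⟩ := exists_pow_lt_of_lt_one (half_pos hε) (by norm_num : (2 : ℝ)⁻¹ < 1)
  filter_upwards [h K (ε / 2) (half_pos hε)] with n hn
  rw [Real.dist_0_eq_abs, abs_of_nonneg (dAW_nonneg _ _)]
  have := dAW_le hn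
  linarith

/-- Local convergence of sets from both sides implies convergence in the Attouch--Wets metric. -/
theorem tendsto_dAW_of_local {C : ℕ → Set ℂ} {D : Set ℂ} (hD : IsClosed D) (hne : D.Nonempty)
    (h1 : ∀ r δ : ℝ, 0 < δ → ∀ᶠ n in atTop, ∀ w ∈ C n, ‖w‖ ≤ r → Metric.infDist w D ≤ δ)
    (h2 : ∀ d ∈ D, ∀ δ : ℝ, 0 < δ → ∀ᶠ n in atTop, ∃ w ∈ C n, dist w d ≤ δ) :
    (∀ᶠ n in atTop, (C n).Nonempty) ∧ Tendsto (fun n => dAW (C n) D) atTop (𝓝 0) := by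
  obtain ⟨d0, hd0⟩ := hne
  refine ⟨?_, tendsto_dAW fun r δ hδ => ?_⟩
  · filter_upwards [h2 d0 hd0 1 one_pos] with n ⟨w, hw, _⟩ using ⟨w, hw⟩
  -- If `‖x‖ ≤ r`, the nearest point of `D` to `x` is at distance at most `r + ‖d0‖`, hence in this
  -- ball. Covering it by finitely many small balls makes `h2` uniform.
  have hcomp : IsCompact (D ∩ Metric.closedBall 0 (2 * r + ‖d0‖)) :=
    (isCompact_closedBall _ _).inter_left hD
  obtain ⟨t, ht, hcov⟩ := hcomp.elim_nhds_subcover (fun x => Metric.ball x (δ / 2))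
    (fun x _ => Metric.ball_mem_nhds x (half_pos hδ))
  have h3 : ∀ᶠ n in atTop, ∀ d ∈ t, ∃ w ∈ C n, dist w d ≤ δ / 2 :=
    (Finset.eventually_all t).2 fun d hd => h2 d (ht d hd).1 _ (half_pos hδ)
  -- The extra `2` allows for a point of `C n` within `1` of `d0` and for a point realising the
  -- distance to `C n` only up to `1`.
  filter_upwards [h3, h1 (2 * r + ‖d0‖ + 2) (δ / 2) (half_pos hδ), h2 d0 hd0 1 one_pos]
    with n h3 h1 h4 x hx
  obtain ⟨w0, hw0, hw0'⟩ := h4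
  rw [abs_le]
  have hxd0 : dist x d0 ≤ r + ‖d0‖ := by
    rw [dist_eq_norm]; exact (norm_sub_le _ _).trans (by gcongr)
  constructor
  · -- points of `C n` are close to `D`
    obtain ⟨w, hw, hw'⟩ := (Metric.infDist_lt_iff ⟨w0, hw0⟩ (x := x)
      (r := Metric.infDist x (C n) + min 1 (δ / 2))).1 (by
        have : 0 < min 1 (δ / 2) := lt_min one_pos (half_pos hδ)
        linarith)
    have h5 : Metric.infDist x (C n) ≤ dist x w0 := Metric.infDist_le_dist_of_mem hw0
    have h6 : dist x w0 ≤ dist x d0 + dist w0 d0 := by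
      rw [dist_comm w0]; exact dist_triangle _ _ _
    have h7 : ‖w‖ ≤ 2 * r + ‖d0‖ + 2 := by
      have h8 : ‖w‖ ≤ ‖x‖ + dist x w := by
        rw [dist_eq_norm]
        calc ‖w‖ = ‖x - (x - w)‖ := by congr 1; abel
          _ ≤ _ := norm_sub_le _ _
      have := min_le_left 1 (δ / 2)
      linarith
    have h8 := h1 w hw h7
    have h9 := Metric.infDist_le_infDist_add_dist (s := D) (x := x) (y := w)
    have := min_le_right 1 (δ / 2)
    linarith
  · obtain ⟨d, hd, hd'⟩ := hD.exists_infDist_eq_dist ⟨d0, hd0⟩ x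
    have h5 : Metric.infDist x D ≤ dist x d0 := Metric.infDist_le_dist_of_mem hd0
    have h7 : ‖d‖ ≤ 2 * r + ‖d0‖ := by
      have h8 : ‖d‖ ≤ ‖x‖ + dist x d := by
        rw [dist_eq_norm]
        calc ‖d‖ = ‖x - (x - d)‖ := by congr 1; abel
          _ ≤ _ := norm_sub_le _ _
      linarith
    obtain ⟨e, he, hde⟩ := Set.mem_iUnion₂.1 (hcov ⟨hd, mem_closedBall_zero_iff.2 h7⟩)
    obtain ⟨w, hw, hwe⟩ := h3 e he
    have h8 : Metric.infDist x (C n) ≤ dist x w := Metric.infDist_le_dist_of_mem hw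
    have h9 : dist x w ≤ dist x d + dist d e + dist w e := by
      rw [dist_comm w]; exact dist_triangle4 _ _ _ _
    have h10 := Metric.mem_ball.1 hde
    linarith

/-- Adding to `S` points which, in a large ball, are close to `S` changes `S` little. -/
theorem dAW_union_le {C S : Set ℂ} {n : ℕ} {W : ℝ} {w0 : ℂ} (hw0 : w0 ∈ C) (hW : ‖w0‖ ≤ W)
    (hS : S.Nonempty)
    (h : ∀ w ∈ C, ‖w‖ ≤ 4 * n + 10 + W → Metric.infDist w S ≤ (2 : ℝ)⁻¹ ^ (n + 1)) :
    dAW (C ∪ S) S ≤ (2 : ℝ)⁻¹ ^ n := by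
  have key : dAW (C ∪ S) S ≤ (2 : ℝ)⁻¹ ^ (n + 1) + (2 : ℝ)⁻¹ ^ (n + 1) := by
    refine dAW_le fun x hx => ?_
    push_cast at hx
    have h1 : Metric.infDist x (C ∪ S) ≤ Metric.infDist x S :=
      Metric.infDist_le_infDist_of_subset Set.subset_union_right hS
    have h2 : Metric.infDist x S - (2 : ℝ)⁻¹ ^ (n + 1) ≤ Metric.infDist x (C ∪ S) := by
      rw [Metric.le_infDist (hS.mono Set.subset_union_right)]
      rintro w (hw | hw)
      · by_cases hwn : ‖w‖ ≤ 4 * n + 10 + W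
        · have h3 := h w hw hwn
          have h9 := Metric.infDist_le_infDist_add_dist (s := S) (x := x) (y := w)
          linarith
        -- A point this far out is farther from `x` than `w0` is, with room to spare, and `w0` is
        -- itself close to `S`; so far points of `C` do not bring the union closer to `x`.
        · push Not at hwn
          have h3 := h w0 hw0 (by have := norm_nonneg w0; linarith)
          have h9 := Metric.infDist_le_infDist_add_dist (s := S) (x := x) (y := w0)
          have h4 : dist x w0 ≤ ‖x‖ + ‖w0‖ := by rw [dist_eq_norm]; exact norm_sub_le _ _
          have h5 : ‖w‖ - ‖x‖ ≤ dist x w := by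
            rw [dist_comm, dist_eq_norm]; exact norm_sub_norm_le _ _
          have h6 : (0 : ℝ) ≤ n := Nat.cast_nonneg n
          linarith
      · have h3 : Metric.infDist x S ≤ dist x w := Metric.infDist_le_dist_of_mem hw
        have h4 : (0 : ℝ) ≤ (2 : ℝ)⁻¹ ^ (n + 1) := by positivity
        linarith
    rw [abs_le]
    have h4 : (0 : ℝ) ≤ (2 : ℝ)⁻¹ ^ (n + 1) := by positivity
    constructor <;> linarith
  refine key.trans (le_of_eq ?_)
  rw [pow_succ]
  ring

/-- The distances of a point to two sets differ little if the sets are close. -/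
theorem abs_infDist_sub_lt_of_dAW_lt {C D : Set ℂ} {k : ℕ} {x : ℂ} (hx : ‖x‖ ≤ k + 1) {s : ℝ}
    (hs : s ≤ 1) (h : dAW C D < (2 : ℝ)⁻¹ ^ (k + 1) * s) :
    |Metric.infDist x C - Metric.infDist x D| < s := by
  have h1 := (le_dAW C D hx).trans_lt h
  have h2 := lt_of_mul_lt_mul_left h1 (by positivity)
  rcases min_lt_iff.1 h2 with h3 | h3
  · linarith
  · exact h3

end AttouchWets

/-! ## The grids -/

theorem grid_finite {n : ℕ} (hn : 1 ≤ n) : (grid n).Finite := by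
  have hn' : (0 : ℝ) < n := by exact_mod_cast hn
  refine Set.Finite.subset (Set.Finite.image
    (fun p : ℤ × ℤ => ((p.1 + p.2 * Complex.I) / n : ℂ))
    ((Set.finite_Icc (-(n ^ 2 : ℤ)) (n ^ 2)).prod (Set.finite_Icc (-(n ^ 2 : ℤ)) (n ^ 2)))) ?_
  rintro z ⟨hz, p, q, rfl⟩
  refine ⟨(p, q), ?_, rfl⟩
  rw [norm_div, Complex.norm_natCast, div_le_iff₀ hn'] at hz
  have h1 := (Complex.abs_re_le_norm _).trans hz
  have h2 := (Complex.abs_im_le_norm _).trans hz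
  simp only [Complex.add_re, Complex.intCast_re, Complex.mul_re, Complex.I_re, mul_zero,
    Complex.intCast_im, Complex.I_im, mul_one, sub_self, add_zero, Complex.add_im, Complex.mul_im,
    zero_add] at h1 h2
  rw [← sq, abs_le] at h1 h2
  simp only [Set.mem_prod, Set.mem_Icc]
  exact ⟨⟨by exact_mod_cast h1.1, by exact_mod_cast h1.2⟩, by exact_mod_cast h2.1,
    by exact_mod_cast h2.2⟩

/-- Rounding both coordinates of `n x` down moves each by at most `1`; the hypothesis keeps the
rounded point in the disc of radius `n`. -/
theorem exists_grid_near {n : ℕ} (hn : 1 ≤ n) {x : ℂ} (hx : ‖x‖ + 2 / n ≤ n) :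
    ∃ w ∈ grid n, ‖w - x‖ ≤ 2 / n := by
  have hn' : (0 : ℝ) < n := by exact_mod_cast hn
  have hnc : (n : ℂ) ≠ 0 := by exact_mod_cast hn'.ne'
  set w : ℂ := (⌊n * x.re⌋ + ⌊n * x.im⌋ * Complex.I) / n with hw
  have h1 : ‖w - x‖ ≤ 2 / n := by
    have h2 : w - x = (((⌊n * x.re⌋ - n * x.re : ℝ) : ℂ) +
        ((⌊n * x.im⌋ - n * x.im : ℝ) : ℂ) * Complex.I) / n := by
      rw [hw]
      field_simp
      have h3 := Complex.re_add_im x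
      push_cast
      linear_combination (n : ℂ) * h3
    rw [h2, norm_div, Complex.norm_natCast]
    gcongr
    refine (norm_add_le _ _).trans ?_
    rw [norm_mul, Complex.norm_I, mul_one, Complex.norm_real, Complex.norm_real,
      Real.norm_eq_abs, Real.norm_eq_abs]
    have a1 := Int.floor_le (n * x.re)
    have a2 := Int.lt_floor_add_one (n * x.re)
    have a3 := Int.floor_le (n * x.im)
    have a4 := Int.lt_floor_add_one (n * x.im)
    have b1 : |(⌊n * x.re⌋ - n * x.re : ℝ)| ≤ 1 := by rw [abs_le]; constructor <;> linarith
    have b2 : |(⌊n * x.im⌋ - n * x.im : ℝ)| ≤ 1 := by rw [abs_le]; constructor <;> linarith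
    linarith
  refine ⟨w, ⟨?_, _, _, rfl⟩, h1⟩
  calc ‖w‖ = ‖x + (w - x)‖ := by congr 1; abel
    _ ≤ ‖x‖ + ‖w - x‖ := norm_add_le _ _
    _ ≤ n := by linarith

/-! ## The inverse of a resolvent control on a grid -/

section CompInv

variable {g₀ : ℝ≥0 → ℝ≥0}

theorem compInvg_nonneg (n : ℕ) (y : ℝ) (g₀ : ℝ≥0 → ℝ≥0) : 0 ≤ compInvg n y g₀ := by
  unfold compInvg; positivity

theorem nonempty_lt_apply_div (hg : Tendsto g₀ atTop atTop) {n : ℕ} (hn : 1 ≤ n) (y : ℝ) :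
    {k : ℕ | y < g₀ ((k : ℝ≥0) / (n : ℝ≥0))}.Nonempty := by
  have hn' : (0 : ℝ≥0) < n := by exact_mod_cast hn
  have h1 : Tendsto (fun k : ℕ => ((g₀ ((k : ℝ≥0) / (n : ℝ≥0)) : ℝ≥0) : ℝ)) atTop atTop := by
    refine NNReal.tendsto_coe_atTop.2 (hg.comp ?_)
    exact tendsto_natCast_atTop_atTop.atTop_div_const hn'
  exact (h1.eventually_gt_atTop y).exists

/-- The infimum is attained because `g₀` diverges, so the set of candidates is non-empty. -/
theorem lt_apply_compInvg (hg : Tendsto g₀ atTop atTop) {n : ℕ} (hn : 1 ≤ n) (y : ℝ) :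
    y < g₀ (compInvg n y g₀).toNNReal := by
  have hne := nonempty_lt_apply_div hg hn y
  have h := Nat.sInf_mem hne
  rw [Set.mem_ofPred_eq] at h
  convert h using 3
  unfold compInvg
  rw [Real.toNNReal_div (by positivity), Real.toNNReal_natCast, Real.toNNReal_natCast]

theorem compInvg_le_div {n k : ℕ} {y : ℝ} (h : y < g₀ ((k : ℝ≥0) / (n : ℝ≥0))) :
    compInvg n y g₀ ≤ k / n := by
  unfold compInvg
  gcongr
  exact Nat.sInf_le h

theorem compInvg_le (hg : StrictMono g₀) {n : ℕ} (hn : 1 ≤ n) {y : ℝ} {t : ℝ} (ht : 0 ≤ t)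
    (h : y < g₀ t.toNNReal) : compInvg n y g₀ ≤ t + 1 / n := by
  have hn' : (0 : ℝ) < n := by exact_mod_cast hn
  have h1 : t.toNNReal ≤ ((⌈n * t⌉₊ : ℕ) : ℝ≥0) / (n : ℝ≥0) := by
    rw [← NNReal.coe_le_coe, Real.coe_toNNReal _ ht]
    push_cast
    rw [le_div_iff₀ hn', mul_comm]
    exact Nat.le_ceil _
  refine (compInvg_le_div (k := ⌈n * t⌉₊)
    (h.trans_le (NNReal.coe_le_coe.2 (hg.monotone h1)))).trans ?_
  rw [div_le_iff₀ hn', add_mul, one_div, inv_mul_cancel₀ hn'.ne', mul_comm t]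
  exact (Nat.ceil_lt_add_one (by positivity)).le

/-- `compInvg` overestimates the inverse function: `g₀(dist) ≤ y < g₀(compInvg y)`, and `g₀` is
strictly increasing. This is the source of the guaranteed error bound. -/
theorem infDist_le_compInvg (hg : StrictMono g₀) (hg' : Tendsto g₀ atTop atTop) {n : ℕ}
    (hn : 1 ≤ n) {y : ℝ} {z : ℂ} {S : Set ℂ} (h : (g₀ (Metric.infNndist z S) : ℝ) ≤ y) :
    Metric.infDist z S ≤ compInvg n y g₀ := by
  have h1 := h.trans_lt (lt_apply_compInvg hg' hn y)
  have h2 := hg.lt_iff_lt.1 (NNReal.coe_lt_coe.1 h1)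
  rw [← NNReal.coe_lt_coe, Real.coe_toNNReal _ (compInvg_nonneg _ _ _), Metric.coe_infNndist] at h2
  exact h2.le

/-- A continuous strictly increasing function increases by a fixed amount on compact sets. -/
theorem exists_increment (hg : Continuous g₀) (hg' : StrictMono g₀) (R η : ℝ) (hη : 0 < η) :
    ∃ κ : ℝ, 0 < κ ∧ ∀ x : ℝ, 0 ≤ x → x ≤ R →
      (g₀ x.toNNReal : ℝ) + κ ≤ g₀ (x + η).toNNReal := by
  by_cases hR : 0 ≤ R
  · obtain ⟨x0, hx0, hmin⟩ := (isCompact_Icc (a := (0 : ℝ)) (b := R)).exists_isMinOn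
      (Set.nonempty_Icc.2 hR)
      (f := fun x : ℝ => (g₀ (x + η).toNNReal : ℝ) - g₀ x.toNNReal) (by fun_prop)
    refine ⟨(g₀ (x0 + η).toNNReal : ℝ) - g₀ x0.toNNReal, ?_, fun x hx hx' => ?_⟩
    rotate_left
    · have := hmin (Set.mem_Icc.2 ⟨hx, hx'⟩)
      rw [Set.mem_ofPred_eq] at this
      exact le_sub_iff_add_le'.1 this
    · rw [sub_pos, NNReal.coe_lt_coe]
      apply hg'
      rw [Real.toNNReal_lt_toNNReal_iff (by have := hx0.1; linarith)]
      linarith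
  · exact ⟨1, one_pos, fun x hx hx' => absurd (hx.trans hx') hR⟩

end CompInv

/-! ## Convergence of the routines -/

/-- The set computed by `compSpecUB`, for an arbitrary function `F`. -/
def minimiserSet (n : ℕ) (F : ℂ → ℝ) (g : ℕ → ℝ≥0 → ℝ≥0) : Set ℂ :=
  {w | ∃ z ∈ grid n, F z ≤ (‖z‖ ^ 2 + 1)⁻¹ ∧
    w ∈ Metric.closedBall z (compInvg n (F z) (g ⌈‖z‖⌉₊)) ∩ grid n ∧
      ∀ w' ∈ Metric.closedBall z (compInvg n (F z) (g ⌈‖z‖⌉₊)) ∩ grid n, F w ≤ F w'}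

theorem minimiserSet_finite {n : ℕ} (hn : 1 ≤ n) (F : ℂ → ℝ) (g : ℕ → ℝ≥0 → ℝ≥0) :
    (minimiserSet n F g).Finite :=
  (grid_finite hn).subset fun _ ⟨_, _, _, h, _⟩ => h.2

section Approx

variable {S : Set ℂ} {γ : ℂ → ℝ} {F : ℕ → ℂ → ℝ} {c : ℕ → ℝ} {g : ℕ → ℝ≥0 → ℝ≥0}

theorem eventually_one_div_le {δ : ℝ} (hδ : 0 < δ) (r : ℝ) :
    ∀ᶠ n : ℕ in atTop, 1 ≤ n ∧ (1 : ℝ) / n ≤ δ ∧ r ≤ n := by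
  filter_upwards [eventually_ge_atTop 1,
    (tendsto_one_div_atTop_nhds_zero_nat (𝕜 := ℝ)).eventually (ge_mem_nhds hδ),
    tendsto_natCast_atTop_atTop.eventually_ge_atTop r] with n h1 h2 h3 using ⟨h1, h2, h3⟩

theorem IsApprox.gamma_eq_zero (h : IsApprox S γ F c) {z : ℂ} (hz : z ∈ S) : γ z = 0 :=
  (h.mem_iff z).2 hz

/-- Uniform upper bounds near the compact parts of `S`. -/
theorem IsApprox.eventually_le (h : IsApprox S γ F c) (R δ : ℝ) (hδ : 0 < δ) :
    ∀ᶠ n : ℕ in atTop, ∀ l ∈ S, ‖l‖ ≤ R → ∀ w, F n w ≤ δ + ‖w - l‖ := by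
  have hcomp : IsCompact (S ∩ Metric.closedBall 0 R) :=
    (isCompact_closedBall _ _).inter_left h.closed
  obtain ⟨t, ht, hcov⟩ := hcomp.elim_nhds_subcover (fun x => Metric.ball x (δ / 4))
    (fun x _ => Metric.ball_mem_nhds x (by positivity))
  have h3 : ∀ᶠ n : ℕ in atTop, ∀ d ∈ t, ∀ w, F n w ≤ δ / 4 + ‖w - d‖ + 1 / n :=
    (Finset.eventually_all t).2 fun d hd => h.upper d _ (by
      rw [h.gamma_eq_zero (ht d hd).1]; positivity)
  filter_upwards [h3, eventually_one_div_le (δ := δ / 4) (by positivity) 0] with n h3 hn l hl hR w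
  obtain ⟨d, hd, hld⟩ := Set.mem_iUnion₂.1 (hcov ⟨hl, mem_closedBall_zero_iff.2 hR⟩)
  have h4 := h3 d hd w
  rw [Metric.mem_ball, dist_eq_norm] at hld
  have h5 : ‖w - d‖ ≤ ‖w - l‖ + ‖l - d‖ := norm_sub_le_norm_sub_add_norm_sub _ _ _
  linarith [hn.2.1]

theorem norm_le_norm_add_dist (w z : ℂ) : ‖w‖ ≤ ‖z‖ + dist w z := by
  rw [dist_eq_norm]
  calc ‖w‖ = ‖z + (w - z)‖ := by congr 1; abel
    _ ≤ _ := norm_add_le _ _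

/-- The values of `F` on the output of the routine tend to `0` uniformly. -/
theorem IsApprox.eventually_minimiser_le (h : IsApprox S γ F c) (hg : IsResolventControl g)
    (hγ : ∀ (m : ℕ) (z : ℂ), ‖z‖ ≤ m → (g m (Metric.infNndist z S) : ℝ) ≤ γ z)
    {δ : ℝ} (hδ : 0 < δ) :
    ∀ᶠ n : ℕ in atTop, ∀ w ∈ minimiserSet n (F n) g, F n w ≤ δ := by
  obtain ⟨l0, hl0⟩ := h.nonempty
  -- for `‖z‖ > R` the threshold is small
  set R : ℝ := max 1 δ⁻¹ with hRdef
  have hR1 : 1 ≤ R := le_max_left _ _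
  have hR2 : δ⁻¹ ≤ R := le_max_right _ _
  set R' : ℝ := R + ‖l0‖ with hR'
  -- `R'` bounds the distance to `S` from every `z` with `‖z‖ ≤ R`. The gain `κ m` of `g m` over a
  -- step `δ / 8` on `[0, R']` will absorb `c n`; only the finitely many `m ≤ ⌈R⌉` matter.
  choose κ hκ0 hκ using fun m => exists_increment (hg m).1 (hg m).2.1 R' (δ / 8) (by positivity)
  have hc : ∀ᶠ n in atTop, ∀ m ∈ Finset.range (⌈R⌉₊ + 1), c n < κ m :=
    (Finset.eventually_all _).2 fun m _ => h.tendsto_c.eventually (gt_mem_nhds (hκ0 m))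
  filter_upwards [hc, h.eventually_le (R + R') (δ / 4) (by positivity),
    eventually_one_div_le (δ := δ / 16) (by positivity) (R + R' + 2)] with n hc hF hn w hw
  obtain ⟨hn1, hn2, hn3⟩ := hn
  obtain ⟨z, hz, hFz, hwz, hmin⟩ := hw
  have hn' : (0 : ℝ) < n := by exact_mod_cast hn1
  by_cases hzR : R < ‖z‖
  · have h1 : F n w ≤ F n z :=
      hmin z ⟨Metric.mem_closedBall_self (compInvg_nonneg _ _ _), hz⟩
    have h2 : (‖z‖ ^ 2 + 1)⁻¹ ≤ δ := by
      rw [inv_le_comm₀ (by positivity) hδ]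
      nlinarith
    linarith
  · push Not at hzR
    set m := ⌈‖z‖⌉₊ with hm
    set ρ := compInvg n (F n z) (g m) with hρ
    have hρ0 : 0 ≤ ρ := compInvg_nonneg _ _ _
    have hmR : m ∈ Finset.range (⌈R⌉₊ + 1) :=
      Finset.mem_range.2 (Nat.lt_succ_of_le (Nat.ceil_mono hzR))
    have hcm := hc m hmR
    set d := Metric.infDist z S with hd
    have hd0 : 0 ≤ d := Metric.infDist_nonneg
    have hdR : d ≤ R' := by
      have h1 : d ≤ dist z l0 := Metric.infDist_le_dist_of_mem hl0
      have h2 : dist z l0 ≤ ‖z‖ + ‖l0‖ := by rw [dist_eq_norm]; exact norm_sub_le _ _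
      linarith
    -- The search radius almost reaches `S`: otherwise `g(ρ) + κ ≤ g(ρ + δ/8) ≤ g(d) ≤ γ z ≤ F z + c
    -- n < g(ρ) + κ`.
    have hdρ : d ≤ ρ + δ / 8 := by
      by_contra hcon
      push Not at hcon
      have h1 := hκ m ρ hρ0 (by linarith)
      have h2 := lt_apply_compInvg (hg m).2.2.2 hn1 (F n z)
      have h3 := hγ m z (Nat.le_ceil _)
      have h4 := h.lower n hn1 z
      have h5 : (g m (ρ + δ / 8).toNNReal : ℝ) ≤ g m (Metric.infNndist z S) := by
        rw [NNReal.coe_le_coe]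
        apply (hg m).2.1.monotone
        rw [Real.toNNReal_le_iff_le_coe, Metric.coe_infNndist]
        exact hcon.le
      rw [← hρ] at h2
      linarith
    obtain ⟨l, hl, hzl⟩ := h.closed.exists_infDist_eq_dist ⟨l0, hl0⟩ z
    rw [← hd] at hzl
    have hlR : ‖l‖ ≤ R + R' := by
      have := norm_le_norm_add_dist l z
      rw [dist_comm, ← hzl] at this
      linarith
    have hdiv : (2 : ℝ) / n = 2 * (1 / n) := by ring
    have hnp : (0 : ℝ) ≤ 1 / n := by positivity
    -- a grid point in the ball around `z` which is close to `l`
    have hex : ∃ w' ∈ grid n, dist w' z ≤ ρ ∧ ‖w' - l‖ ≤ δ / 2 := by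
      -- If the ball is too small for rounding to the grid, then `z` itself is already close to `l`.
      by_cases hρn : ρ < 2 / n
      · refine ⟨z, hz, by rwa [dist_self], ?_⟩
        rw [← dist_eq_norm, ← hzl]
        linarith
      · push Not at hρn
        -- Go from `z` towards `l`, stopping at `l` or `2/n` before leaving the ball, so that the
        -- rounded point is still admissible.
        set s := min d (ρ - 2 / n) with hs
        have hs0 : 0 ≤ s := le_min hd0 (by linarith)
        have hsd : s ≤ d := min_le_left _ _
        have hsρ : s ≤ ρ - 2 / n := min_le_right _ _
        have hds : d - s ≤ δ / 4 := by
          rcases min_choice d (ρ - 2 / n) with h1 | h1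
          · rw [hs, h1]; linarith
          · rw [hs, h1]; linarith
        set x : ℂ := z + ((s / d : ℝ) : ℂ) * (l - z) with hx
        have hlz : ‖l - z‖ = d := by rw [hzl, dist_comm, dist_eq_norm]
        have hxz : ‖x - z‖ ≤ s := by
          rw [hx, add_sub_cancel_left, norm_mul, hlz, Complex.norm_real, Real.norm_eq_abs,
            abs_of_nonneg (by positivity)]
          rcases hd0.eq_or_lt with h0 | h0
          · rw [← h0, mul_zero]; exact hs0
          · rw [div_mul_cancel₀ _ h0.ne']
        have hxl : ‖x - l‖ ≤ d - s := by
          rcases hd0.eq_or_lt with h0 | h0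
          · have : l = z := by
              rw [← h0] at hlz
              exact sub_eq_zero.1 (norm_eq_zero.1 hlz)
            rw [hx, this]
            simpa using hsd
          · have h1 : x - l = ((s / d - 1 : ℝ) : ℂ) * (l - z) := by
              rw [hx]; push_cast; ring
            rw [h1, norm_mul, hlz, Complex.norm_real, Real.norm_eq_abs, abs_sub_comm,
              abs_of_nonneg (by rw [sub_nonneg]; exact (div_le_one h0).2 hsd)]
            rw [sub_mul, one_mul, div_mul_cancel₀ _ h0.ne']
        have hxn : ‖x‖ + 2 / n ≤ n := by
          have h1 := norm_le_norm_add_dist x z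
          rw [dist_eq_norm] at h1
          have h2 : (1 : ℝ) / n ≤ 1 := by
            rw [div_le_one hn']; exact_mod_cast hn1
          linarith
        obtain ⟨w', hw', hw'x⟩ := exists_grid_near hn1 hxn
        refine ⟨w', hw', ?_, ?_⟩
        · rw [dist_eq_norm]
          have := norm_sub_le_norm_sub_add_norm_sub w' x z
          linarith
        · have := norm_sub_le_norm_sub_add_norm_sub w' x l
          linarith
    obtain ⟨w', hw', hw'1, hw'2⟩ := hex
    have h1 := hmin w' ⟨Metric.mem_closedBall.2 hw'1, hw'⟩
    have h2 := hF l hl hlR w'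
    linarith

/-- For `‖w‖ ≤ r` only finitely many `g_m` occur. Both `F n w` and `c n` are eventually controlled
by half of `g_m(δ/2)`, so the inverse is at most `δ/2` plus the rounding `1/n`. -/
theorem IsApprox.eventually_compInvg_le (h : IsApprox S γ F c) (hg : IsResolventControl g)
    (hγ : ∀ (m : ℕ) (z : ℂ), ‖z‖ ≤ m → (g m (Metric.infNndist z S) : ℝ) ≤ γ z)
    (r : ℝ) {δ : ℝ} (hδ : 0 < δ) :
    ∀ᶠ n : ℕ in atTop, ∀ w ∈ minimiserSet n (F n) g, ‖w‖ ≤ r →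
      compInvg n (F n w + c n) (g ⌈‖w‖⌉₊) ≤ δ := by
  have hpos : ∀ m, (0 : ℝ) < g m (δ / 2).toNNReal := fun m => by
    rw [NNReal.coe_pos, pos_iff_ne_zero, Ne, (hg m).2.2.1]
    simpa using hδ
  have h1 : ∀ᶠ n in atTop, ∀ m ∈ Finset.range (⌈r⌉₊ + 1),
      c n < g m (δ / 2).toNNReal / 2 ∧
        ∀ w ∈ minimiserSet n (F n) g, F n w ≤ g m (δ / 2).toNNReal / 2 :=
    (Finset.eventually_all _).2 fun m _ =>
      (h.tendsto_c.eventually (gt_mem_nhds (half_pos (hpos m)))).and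
        (h.eventually_minimiser_le hg hγ (half_pos (hpos m)))
  filter_upwards [h1, eventually_one_div_le (half_pos hδ) 0] with n h1 hn w hw hwr
  obtain ⟨h2, h3⟩ := h1 ⌈‖w‖⌉₊ (Finset.mem_range.2 (Nat.lt_succ_of_le (Nat.ceil_mono hwr)))
  have h4 := compInvg_le (hg ⌈‖w‖⌉₊).2.1 hn.1 (half_pos hδ).le
    (y := F n w + c n) (by linarith [h3 w hw])
  linarith [hn.2.1]

theorem IsApprox.infDist_le (h : IsApprox S γ F c) (hg : IsResolventControl g)
    (hγ : ∀ (m : ℕ) (z : ℂ), ‖z‖ ≤ m → (g m (Metric.infNndist z S) : ℝ) ≤ γ z)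
    {n : ℕ} (hn : 1 ≤ n) (w : ℂ) :
    Metric.infDist w S ≤ compInvg n (F n w + c n) (g ⌈‖w‖⌉₊) :=
  infDist_le_compInvg (hg _).2.1 (hg _).2.2.2 hn
    ((hγ _ _ (Nat.le_ceil _)).trans (h.lower n hn w))

/-- At grid points `z` within `2/n` of `l` the values of `F` tend to `0`. Eventually such a `z`
passes the threshold, which is bounded below near `l`, and its search radius is small, so its
minimisers stay close to `l`. -/
theorem IsApprox.eventually_exists_minimiser (h : IsApprox S γ F c) (hg : IsResolventControl g)
    {l : ℂ} (hl : l ∈ S) {δ : ℝ} (hδ : 0 < δ) :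
    ∀ᶠ n : ℕ in atTop, ∃ w ∈ minimiserSet n (F n) g, dist w l ≤ δ := by
  have hpos : ∀ m, (0 : ℝ) < g m (δ / 4).toNNReal := fun m => by
    rw [NNReal.coe_pos, pos_iff_ne_zero, Ne, (hg m).2.2.1]
    simpa using hδ
  have hup : ∀ κ : ℝ, 0 < κ → ∀ᶠ n : ℕ in atTop, ∀ z : ℂ, ‖z - l‖ ≤ 2 / n → F n z < κ := by
    intro κ hκ
    filter_upwards [h.upper l (κ / 8) (by rw [h.gamma_eq_zero hl]; positivity),
      eventually_one_div_le (δ := κ / 8) (by positivity) 0] with n h1 hn z hz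
    have h2 := h1 z
    have hdiv : (2 : ℝ) / n = 2 * (1 / n) := by ring
    linarith [hn.2.1]
  have h1 : ∀ᶠ n : ℕ in atTop, ∀ m ∈ Finset.range (⌈‖l‖ + 2⌉₊ + 1), ∀ z : ℂ, ‖z - l‖ ≤ 2 / n →
      F n z < g m (δ / 4).toNNReal :=
    (Finset.eventually_all _).2 fun m _ => hup _ (hpos m)
  filter_upwards [h1, hup (((‖l‖ + 2) ^ 2 + 1)⁻¹) (by positivity),
    eventually_one_div_le (δ := min (δ / 4) 1) (by positivity) (‖l‖ + 2)] with n h1 h2 hn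
  obtain ⟨hn1, hn2, hn3⟩ := hn
  have hdiv : (2 : ℝ) / n = 2 * (1 / n) := by ring
  have hn4 := hn2.trans (min_le_left _ _)
  have hn5 := hn2.trans (min_le_right _ _)
  obtain ⟨z, hz, hzl⟩ := exists_grid_near hn1 (x := l) (by linarith)
  have hznorm : ‖z‖ ≤ ‖l‖ + 2 := by
    have := norm_le_norm_add_dist z l
    rw [dist_eq_norm] at this
    linarith
  have hFz := h2 z hzl
  have hle : F n z ≤ (‖z‖ ^ 2 + 1)⁻¹ := by
    refine hFz.le.trans ?_
    gcongr
  have hρ := compInvg_le (hg ⌈‖z‖⌉₊).2.1 hn1 (by positivity : 0 ≤ δ / 4)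
    (h1 _ (Finset.mem_range.2 (Nat.lt_succ_of_le (Nat.ceil_mono hznorm))) z hzl)
  set near := Metric.closedBall z (compInvg n (F n z) (g ⌈‖z‖⌉₊)) ∩ grid n with hnear
  have hne : near.Nonempty := ⟨z, Metric.mem_closedBall_self (compInvg_nonneg _ _ _), hz⟩
  have hfin : near.Finite := (grid_finite hn1).subset Set.inter_subset_right
  obtain ⟨w, hw, hmin⟩ := Set.exists_min_image near (F n) hfin hne
  refine ⟨w, ⟨z, hz, hle, hw, hmin⟩, ?_⟩
  have h3 := Metric.mem_closedBall.1 hw.1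
  have h4 := dist_triangle w z l
  rw [← dist_eq_norm] at hzl
  linarith

/-- Convergence of `compSpecUB`. -/
theorem IsApprox.tendsto_minimiserSet (h : IsApprox S γ F c) (hg : IsResolventControl g)
    (hγ : ∀ (m : ℕ) (z : ℂ), ‖z‖ ≤ m → (g m (Metric.infNndist z S) : ℝ) ≤ γ z) :
    (∀ᶠ n in atTop, (minimiserSet n (F n) g).Nonempty) ∧
      Tendsto (fun n => dAW (minimiserSet n (F n) g) S) atTop (𝓝 0) := by
  refine tendsto_dAW_of_local h.closed h.nonempty (fun r δ hδ => ?_)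
    fun l hl δ hδ => h.eventually_exists_minimiser hg hl hδ
  filter_upwards [h.eventually_compInvg_le hg hγ r hδ, eventually_ge_atTop 1] with n h1 hn w hw hwr
  exact (h.infDist_le hg hγ hn w).trans (h1 w hw hwr)

/-- The set computed by `pseudoSpecUB`, for an arbitrary function `F`. -/
def sublevelGrid (n : ℕ) (F : ℂ → ℝ) (c ε : ℝ) : Set ℂ := {z | z ∈ grid n ∧ F z + c < ε}

theorem IsApprox.sublevelGrid_subset (h : IsApprox S γ F c) {n : ℕ} (hn : 1 ≤ n) (ε : ℝ) :
    sublevelGrid n (F n) (c n) ε ⊆ {z | γ z < ε} :=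
  fun z hz => (h.lower n hn z).trans_lt hz.2

/-- Convergence of `pseudoSpecUB`. -/
theorem IsApprox.tendsto_sublevelGrid (h : IsApprox S γ F c) {ε : ℝ} (hε : 0 < ε) :
    (∀ᶠ n in atTop, (sublevelGrid n (F n) (c n) ε).Nonempty) ∧
      Tendsto (fun n => dAW (sublevelGrid n (F n) (c n) ε) (closure {z | γ z < ε})) atTop
        (𝓝 0) := by
  refine tendsto_dAW_of_local isClosed_closure ?_ (fun r δ hδ => ?_) fun l hl δ hδ => ?_
  · obtain ⟨l, hl⟩ := h.nonempty
    exact ⟨l, subset_closure (by rw [Set.mem_ofPred_eq, h.gamma_eq_zero hl]; exact hε)⟩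
  · filter_upwards [eventually_ge_atTop 1] with n hn w hw _
    rw [Metric.infDist_zero_of_mem (subset_closure (h.sublevelGrid_subset hn ε hw))]
    exact hδ.le
  · obtain ⟨p, hp, hlp⟩ := Metric.mem_closure_iff.1 hl (δ / 2) (half_pos hδ)
    rw [Set.mem_ofPred_eq] at hp
    -- One eighth of the gap is spent on `κ`, two on moving from `p` to the grid, one on `1/n` and
    -- one on `c n`, which leaves the inequality strict.
    have hgap : 0 < (ε - γ p) / 8 := by linarith
    filter_upwards [h.upper p (γ p + (ε - γ p) / 8) (by linarith),
      h.tendsto_c.eventually (gt_mem_nhds hgap),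
      eventually_one_div_le (δ := min ((ε - γ p) / 8) (min (δ / 4) 1)) (by positivity)
        (‖p‖ + 2)] with n h1 h2 hn
    obtain ⟨hn1, hn2, hn3⟩ := hn
    have hdiv : (2 : ℝ) / n = 2 * (1 / n) := by ring
    have hn4 := hn2.trans (min_le_left _ _)
    have hn5 := hn2.trans ((min_le_right _ _).trans (min_le_left _ _))
    have hn6 := hn2.trans ((min_le_right _ _).trans (min_le_right _ _))
    obtain ⟨w, hw, hwp⟩ := exists_grid_near hn1 (x := p) (by linarith)
    refine ⟨w, ⟨hw, ?_⟩, ?_⟩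
    · have := h1 w
      linarith
    · rw [← dist_eq_norm] at hwp
      have := dist_triangle w p l
      rw [dist_comm p l] at this
      linarith

end Approx

/-! ## Diagonal operators -/

section Diagonal

variable {ι : Type*} {T : Ell2 ι →ₗ.[ℂ] Ell2 ι}

theorem col_eq_smul_of_diagonal (hd : ∀ i j, i ≠ j → entry T i j = 0) (j : ι) :
    col T j = entry T j j • basisVec j := by
  ext i
  rw [← entry_eq_col]
  change _ = entry T j j * basisVec j i
  by_cases h : i = j
  · rw [h, basisVec_apply_self, mul_one]
  · rw [hd i j h, basisVec_apply_ne h, mul_zero]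

/-- `T - z` multiplies each coordinate by a factor of modulus at least `κ`. -/
theorem norm_colComb_sub_of_diagonal (v : ℕ ≃ ι) (hd : ∀ i j, i ≠ j → entry T i j = 0) {z : ℂ}
    {κ : ℝ} (hκ0 : 0 ≤ κ) (hκ : ∀ j, κ ≤ ‖entry T j j - z‖) (n : ℕ) (x : Fin n → ℂ) :
    κ * ‖finVec v n x‖ ≤ ‖colComb v T n x - z • finVec v n x‖ := by
  have h1 : colComb v T n x - z • finVec v n x =
      finVec v n fun j => (entry T (v j) (v j) - z) * x j := by
    unfold colComb finVec
    rw [Finset.smul_sum, ← Finset.sum_sub_distrib]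
    refine Finset.sum_congr rfl fun j _ => ?_
    rw [col_eq_smul_of_diagonal hd]
    module
  rw [h1, ← pow_le_pow_iff_left₀ (by positivity) (norm_nonneg _) two_ne_zero, mul_pow,
    norm_sq_finVec, norm_sq_finVec, Finset.mul_sum]
  refine Finset.sum_le_sum fun j _ => ?_
  rw [norm_mul, mul_pow]
  gcongr
  exact hκ _

theorem le_invResolventNorm_of_diagonal (v : ℕ ≃ ι) (hT : IsAdmissible T)
    (hd : ∀ i j, i ≠ j → entry T i j = 0) {z : ℂ} {κ : ℝ} (hκ0 : 0 < κ)
    (hκ : ∀ j, κ ≤ ‖entry T j j - z‖) : κ ≤ invResolventNorm T z := by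
  have : Nonempty ι := ⟨v 0⟩
  refine le_invResolventNorm hT hκ0 (fun x hx => ?_) fun x hx => ?_
  · obtain ⟨n, hn⟩ := (eventually_truncate_eq v (x : Ell2 ι) hx).exists
    have h1 : finVec v n (fun i => (x : Ell2 ι) (v i)) = x := hn
    have h2 := norm_colComb_sub_of_diagonal v hd hκ0.le hκ n (fun i => (x : Ell2 ι) (v i))
    rw [← apply_finVec v hT.core.le_domain] at h2
    simp only [h1] at h2
    exact h2
  · obtain ⟨n, hn⟩ := (eventually_truncate_eq v (x : Ell2 ι) hx).exists
    have h1 : finVec v n (fun i => (x : Ell2 ι) (v i)) = x := hn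
    have h2 := norm_colComb_sub_of_diagonal (T := T.adjoint) (z := star z) v
      (fun i j hij => by rw [entry_adjoint hT, hd j i hij.symm, star_zero]) hκ0.le
      (fun j => by rw [entry_adjoint hT, ← star_sub, norm_star]; exact hκ j) n
      (fun i => (x : Ell2 ι) (v i))
    rw [← apply_finVec v hT.core_adjoint.le_domain] at h2
    simp only [h1] at h2
    exact h2

/-- The basis vector `e_j` is an eigenvector, so an inverse would send `0` to `e_j`. -/
theorem diagonal_entry_mem_spec (hT : IsAdmissible T) (hd : ∀ i j, i ≠ j → entry T i j = 0)
    (j : ι) : entry T j j ∈ spec T := by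
  rintro ⟨B, -, hB⟩
  have hj := hT.core.le_domain (basisVec_mem_basisSpan j)
  have h := hB ⟨_, hj⟩
  rw [← col_eq hj, col_eq_smul_of_diagonal hd, sub_self, map_zero] at h
  have h1 := norm_basisVec j
  simp only at h
  rw [← h, norm_zero] at h1
  exact zero_ne_one h1

theorem infDist_le_invResolventNorm_of_diagonal (v : ℕ ≃ ι) (hT : IsAdmissible T)
    (hd : ∀ i j, i ≠ j → entry T i j = 0) (z : ℂ) :
    Metric.infDist z (spec T) ≤ invResolventNorm T z := by
  by_cases h0 : Metric.infDist z (spec T) = 0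
  · rw [h0]; exact invResolventNorm_nonneg _ _
  · refine le_invResolventNorm_of_diagonal v hT hd
      (lt_of_le_of_ne Metric.infDist_nonneg (Ne.symm h0)) fun j => ?_
    rw [← dist_eq_norm, dist_comm]
    exact Metric.infDist_le_dist_of_mem (diagonal_entry_mem_spec hT hd j)

theorem hasResolventBound_of_diagonal (v : ℕ ≃ ι) (hT : IsAdmissible T)
    (hd : ∀ i j, i ≠ j → entry T i j = 0) {g : ℕ → ℝ≥0 → ℝ≥0} (hg : ∀ m x, g m x ≤ x) :
    HasResolventBound g T := fun m z _ =>
  (NNReal.coe_le_coe.2 (hg m _)).trans (infDist_le_invResolventNorm_of_diagonal v hT hd z)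

end Diagonal

/-! ## Diagonal operators of rank one -/

section RankOne

variable {ι : Type*}

theorem dense_basisSpan : Dense (basisSpan ι : Set (Ell2 ι)) := by
  rw [Submodule.dense_iff_topologicalClosure_eq_top, Submodule.topologicalClosure_eq_top_iff,
    Submodule.eq_bot_iff]
  intro x hx
  ext i
  rw [← inner_basisVec]
  exact (Submodule.mem_orthogonal _ _).1 hx _ (basisVec_mem_basisSpan i)

/-- The graph is the image of the continuous map `y ↦ (y, By)`, so density of `S` passes to the
graph. -/
theorem hasCore_of_dense {E : Type*} [NormedAddCommGroup E] [NormedSpace ℂ E] (B : E →L[ℂ] E)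
    {S : Submodule ℂ E} (hS : Dense (S : Set E)) :
    ((B : E →ₗ[ℂ] E).toPMap ⊤).IsClosed ∧ ((B : E →ₗ[ℂ] E).toPMap ⊤).HasCore S := by
  set f := (B : E →ₗ[ℂ] E).toPMap ⊤ with hf
  have hmem : ∀ p : E × E, p ∈ f.graph ↔ B p.1 = p.2 := by
    intro p
    rw [LinearPMap.mem_graph_iff]
    constructor
    · rintro ⟨y, h1, h2⟩
      rw [← h1, ← h2]
      rfl
    · intro h
      exact ⟨⟨p.1, trivial⟩, rfl, h⟩
  have hcl : f.IsClosed := by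
    have : (f.graph : Set (E × E)) = {p | B p.1 = p.2} := Set.ext hmem
    rw [LinearPMap.IsClosed, this]
    exact isClosed_eq (by fun_prop) (by fun_prop)
  refine ⟨hcl, fun _ _ => trivial, ?_⟩
  have hres : f.domRestrict S ≤ f := LinearPMap.domRestrict_le
  have hcb : (f.domRestrict S).IsClosable := hcl.isClosable.leIsClosable hres
  refine le_antisymm ?_ ?_
  · have h1 := hcl.isClosable.closure_mono hres
    have h2 : f.closure = f := LinearPMap.eq_of_eq_graph (by
      rw [← hcl.isClosable.graph_closure_eq_closure_graph]
      exact IsClosed.submodule_topologicalClosure_eq hcl)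
    rwa [h2] at h1
  · apply LinearPMap.le_of_le_graph
    rw [← hcb.graph_closure_eq_closure_graph]
    intro p hp
    rw [hmem] at hp
    rw [← SetLike.mem_coe, Submodule.topologicalClosure_coe]
    have hp' : p = (fun y => (y, B y)) p.1 := Prod.ext rfl hp.symm
    rw [hp']
    refine map_mem_closure (f := fun y : E => (y, B y)) (by fun_prop) (hS p.1) fun y hy => ?_
    rw [SetLike.mem_coe, LinearPMap.mem_graph_iff]
    have h3 : (f.domRestrict S) ⟨y, hy, trivial⟩ = f ⟨y, trivial⟩ := hres.2 rfl
    exact ⟨⟨y, hy, trivial⟩, rfl, h3.trans rfl⟩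

/-- The bounded operator `t |e_k⟩⟨e_k|`. -/
noncomputable def rankOneCLM (k : ι) (t : ℝ) : Ell2 ι →L[ℂ] Ell2 ι :=
  (innerSL ℂ (basisVec k)).smulRight ((t : ℂ) • basisVec k)

theorem rankOneCLM_apply (k : ι) (t : ℝ) (x : Ell2 ι) :
    rankOneCLM k t x = x k • ((t : ℂ) • basisVec k) := by
  rw [rankOneCLM, ContinuousLinearMap.smulRight_apply, innerSL_apply_apply, inner_basisVec]

theorem adjoint_rankOneCLM (k : ι) (t : ℝ) :
    ContinuousLinearMap.adjoint (rankOneCLM k t) = rankOneCLM k t := by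
  symm
  rw [ContinuousLinearMap.eq_adjoint_iff]
  intro x y
  rw [rankOneCLM_apply, rankOneCLM_apply, inner_smul_left, inner_smul_right, inner_smul_left,
    inner_smul_right, inner_basisVec, ← inner_conj_symm x, inner_basisVec, Complex.conj_ofReal]
  ring

/-- The operator `t |e_k⟩⟨e_k|`, as a partially defined operator. -/
noncomputable def rankOne (k : ι) (t : ℝ) : Ell2 ι →ₗ.[ℂ] Ell2 ι :=
  (rankOneCLM k t : Ell2 ι →ₗ[ℂ] Ell2 ι).toPMap ⊤

theorem adjoint_rankOne (k : ι) (t : ℝ) : (rankOne k t).adjoint = rankOne k t := by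
  unfold rankOne
  rw [ContinuousLinearMap.toPMap_adjoint_eq_adjoint_toPMap_of_dense _ (by simp),
    adjoint_rankOneCLM]

theorem isAdmissible_rankOne (k : ι) (t : ℝ) : IsAdmissible (rankOne k t) := by
  have h := hasCore_of_dense (rankOneCLM k t) (dense_basisSpan (ι := ι))
  refine ⟨h.1, ?_, h.2, ?_⟩
  · simp [rankOne]
  · rw [adjoint_rankOne]
    exact h.2

theorem col_rankOne (k : ι) (t : ℝ) (j : ι) :
    col (rankOne k t) j = basisVec j k • ((t : ℂ) • basisVec k) := by
  rw [col_eq (show basisVec j ∈ (rankOne k t).domain from trivial), ← rankOneCLM_apply]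
  rfl

theorem entry_rankOne_self (k : ι) (t : ℝ) : entry (rankOne k t) k k = t := by
  rw [entry, col_rankOne, inner_smul_right, inner_smul_right, inner_basisVec, basisVec_apply_self]
  simp

theorem entry_rankOne_ne {k i j : ι} (t : ℝ) (h : i ≠ k ∨ j ≠ k) : entry (rankOne k t) i j = 0 := by
  rw [entry, col_rankOne, inner_smul_right, inner_smul_right, inner_basisVec]
  rcases h with h | h
  · rw [basisVec_apply_ne h, mul_zero, mul_zero]
  · rw [basisVec_apply_ne h.symm, zero_mul]

theorem entry_rankOne_diagonal (k : ι) (t : ℝ) (i j : ι) (h : i ≠ j) :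
    entry (rankOne k t) i j = 0 := by
  apply entry_rankOne_ne
  by_contra hc
  push Not at hc
  exact h (hc.1.trans hc.2.symm)

theorem mem_spec_rankOne (k : ι) (t : ℝ) : (t : ℂ) ∈ spec (rankOne k t) := by
  rw [← entry_rankOne_self k t]
  exact diagonal_entry_mem_spec (isAdmissible_rankOne k t) (entry_rankOne_diagonal k t) k

theorem norm_le_invResolventNorm_zero (v : ℕ ≃ ι) (k : ι) (z : ℂ) :
    ‖z‖ ≤ invResolventNorm (rankOne k 0) z := by
  by_cases hz : ‖z‖ = 0
  · rw [hz]; exact invResolventNorm_nonneg _ _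
  refine le_invResolventNorm_of_diagonal v (isAdmissible_rankOne k 0) (entry_rankOne_diagonal k 0)
    (lt_of_le_of_ne (norm_nonneg _) (Ne.symm hz)) fun j => ?_
  have : entry (rankOne k 0) j j = 0 := by
    by_cases h : j = k
    · rw [h, entry_rankOne_self]; simp
    · exact entry_rankOne_ne 0 (.inl h)
  rw [this, zero_sub, norm_neg]

/-- The first distance is `0` because `t` is an eigenvalue; the second is `t` because the zero
operator has no spectrum away from `0`. -/
theorem one_le_infDist_sub_spec (v : ℕ ≃ ι) (k k' : ι) {t : ℝ} (ht : 1 ≤ t) :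
    1 ≤ |Metric.infDist (t : ℂ) (spec (rankOne k t)) -
      Metric.infDist (t : ℂ) (spec (rankOne k' 0))| := by
  have : Nonempty ι := ⟨k⟩
  have h0 := mem_spec_rankOne k' 0
  rw [Metric.infDist_zero_of_mem (mem_spec_rankOne k t), zero_sub, abs_neg]
  refine le_trans ?_ (le_abs_self _)
  rw [Metric.le_infDist ⟨_, h0⟩]
  intro z hz
  have h1 := norm_le_invResolventNorm_zero v k' z
  rw [invResolventNorm_eq_zero_iff.2 hz] at h1
  rw [norm_le_zero_iff.1 h1, dist_zero_right, Complex.norm_real, Real.norm_eq_abs]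
  exact ht.trans (le_abs_self _)

/-- For the zero operator `‖z‖ ≤ γ z`, so its pseudospectrum lies in the closed disc of radius `ε`,
at distance at least `1` from `t`. -/
theorem one_le_infDist_sub_pseudoSpec (v : ℕ ≃ ι) (k k' : ι) {ε t : ℝ} (hε : 0 < ε)
    (ht : ε + 1 ≤ t) :
    1 ≤ |Metric.infDist (t : ℂ) (pseudoSpec (rankOne k t) ε) -
      Metric.infDist (t : ℂ) (pseudoSpec (rankOne k' 0) ε)| := by
  have : Nonempty ι := ⟨k⟩
  have h0 := spec_subset_pseudoSpec ε (mem_spec_rankOne k' 0)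
  rw [Metric.infDist_zero_of_mem (spec_subset_pseudoSpec ε (mem_spec_rankOne k t)), zero_sub,
    abs_neg]
  refine le_trans ?_ (le_abs_self _)
  rw [Metric.le_infDist ⟨_, h0⟩]
  intro z hz
  rw [pseudoSpec_eq hε] at hz
  have h2 : ‖z‖ ≤ ε := by
    have hcl : IsClosed {z : ℂ | ‖z‖ ≤ ε} := isClosed_le continuous_norm continuous_const
    exact closure_minimal (fun z hz => (norm_le_invResolventNorm_zero v k' z).trans
      (le_of_lt hz)) hcl hz
  have h3 := norm_sub_norm_le (t : ℂ) z
  rw [Complex.norm_real, Real.norm_eq_abs] at h3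
  rw [dist_eq_norm]
  have := le_abs_self t
  linarith

end RankOne

/-! ## Lower bounds: the problems are not in `Δ₁` -/

universe u

/-- An algorithm that reads only `U` on the input `A` gives the same output on `B`. For a
sufficiently small guaranteed error this output predicts the distance of `x` to both solutions up to
less than `1/2`, which is impossible when these distances differ by at least `1`. -/
theorem not_deltaOne_of_adversary (P : Problem.{u}) (A : P.Dom) (x : ℂ)
    (h : ∀ U : Finset P.Idx, ∃ B, (∀ k ∈ U, P.eval k B = P.eval k A) ∧
      1 ≤ |Metric.infDist x (P.sol B).1 - Metric.infDist x (P.sol A).1|) :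
    ¬ DeltaOne .general P := by
  rintro ⟨Γ, hΓ, herr⟩
  obtain ⟨k, hk⟩ := exists_nat_ge ‖x‖
  obtain ⟨N, hN⟩ := exists_pow_lt_of_lt_one
    (show (0 : ℝ) < (2 : ℝ)⁻¹ ^ (k + 1) * (1 / 2) by positivity) (by norm_num : (2 : ℝ)⁻¹ < 1)
  obtain ⟨used, hused⟩ := hΓ.general N
  obtain ⟨B, hB, hfar⟩ := h (used A)
  have hAB := ((hused A).2 B hB).1
  have hk' : ‖x‖ ≤ k + 1 := by linarith
  have h1 := abs_infDist_sub_lt_of_dAW_lt hk' (by norm_num) ((herr N A).trans_lt hN)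
  have h2 := abs_infDist_sub_lt_of_dAW_lt hk' (by norm_num) ((herr N B).trans_lt hN)
  rw [hAB] at h2
  rw [abs_lt] at h1 h2
  rcases le_abs.1 hfar with h3 | h3 <;> linarith

/-- The operator `t |e_k⟩⟨e_k|` as an element of the class of operators on `ℓ²(ℕ)`. -/
noncomputable def DispOp.rankOne {f : ℕ → ℕ} (hf : ∀ n, n ≤ f n) (k : ℕ) (t : ℝ) : DispOp f where
  op := SCI.rankOne k t
  c := fun _ => 0
  admissible := isAdmissible_rankOne k t
  tendsto_c := tendsto_const_nhds
  dispersion_le := by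
    intro n
    -- A diagonal operator maps `e_j` with `j < n ≤ f n` to a multiple of itself, so nothing is cut
    -- off.
    have h : (1 - proj (f n)) ∘L mulProj (SCI.rankOne k t) n = 0 := by
      ext1 x
      rw [ContinuousLinearMap.comp_apply]
      unfold mulProj
      rw [_root_.sum_apply, map_sum]
      refine Finset.sum_eq_zero fun j hj => ?_
      have hj' : j < f n := (Finset.mem_range.1 hj).trans_le (hf n)
      rw [ContinuousLinearMap.smulRight_apply, map_smul,
        col_eq_smul_of_diagonal (entry_rankOne_diagonal k t), map_smul, _root_.sub_apply]
      have h1 : proj (f n) (basisVec j) = basisVec j := by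
        unfold proj
        rw [_root_.sum_apply, Finset.sum_eq_single j]
        · rw [ContinuousLinearMap.smulRight_apply, innerSL_apply_apply, inner_basisVec,
            basisVec_apply_self, one_smul]
        · intro i _ hij
          rw [ContinuousLinearMap.smulRight_apply, innerSL_apply_apply, inner_basisVec,
            basisVec_apply_ne hij, zero_smul]
        · intro h
          exact absurd (Finset.mem_range.2 hj') h
      rw [h1]
      simp
    unfold dispersion
    rw [adjoint_rankOne, h]
    simp
  spec_nonempty := ⟨_, mem_spec_rankOne k t⟩

/-- The adversary places the single non-zero entry in a row `k` that has not been examined; `f`, `c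
= 0` and the constant evaluations are the same for both operators. -/
theorem not_deltaOne_dispProblem {f : ℕ → ℕ} (hf : ∀ n, n ≤ f n) (Class : DispOp f → Prop)
    (Ξ : DispOp f → Cl) (K : Type) [Encodable K] (κ : K → ℂ) (t : ℝ)
    (hClass : ∀ A, A.IsDiagonal → Class A)
    (hΞ : ∀ k, 1 ≤ |Metric.infDist (t : ℂ) (Ξ (DispOp.rankOne hf k t)).1 -
      Metric.infDist (t : ℂ) (Ξ (DispOp.rankOne hf 0 0)).1|) :
    ¬ DeltaOne .general (dispProblem f Class Ξ K κ) := by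
  have hdiag : ∀ k t, Class (DispOp.rankOne hf k t) := fun k t =>
    hClass _ (entry_rankOne_diagonal k t)
  refine not_deltaOne_of_adversary _ ⟨DispOp.rankOne hf 0 0, hdiag 0 0⟩ t fun U => ?_
  let row : DispIdx ⊕ K → ℕ := fun k => match k with
    | .inl (.inl (i, _)) => i
    | _ => 0
  obtain ⟨k, hk⟩ := Infinite.exists_notMem_finset (U.image row)
  refine ⟨⟨DispOp.rankOne hf k t, hdiag k t⟩, fun e he => ?_, hΞ k⟩
  rcases e with (⟨i, j⟩ | n | n) | e
  · have hik : i ≠ k := by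
      rintro rfl
      exact hk (Finset.mem_image_of_mem row he)
    change entry (SCI.rankOne k t) i j = entry (SCI.rankOne 0 0) i j
    rw [entry_rankOne_ne t (.inl hik)]
    by_cases h : i = 0 ∧ j = 0
    · rw [h.1, h.2, entry_rankOne_self]; simp
    · rw [entry_rankOne_ne 0 (not_and_or.1 h)]
  · rfl
  · rfl
  · rfl

/-- The operator `t |e_k⟩⟨e_k|` as an element of the class of operators on a graph. -/
noncomputable def GraphOp.rankOne {V : Type u} (G : SimpleGraph V) (v : ℕ ≃ V) (k : ℕ) (t : ℝ) :
    GraphOp G v where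
  op := SCI.rankOne (v k) t
  S := id
  admissible := isAdmissible_rankOne _ t
  support := fun n m h => by
    have : v n ≠ v m := fun h' => (ne_of_lt h) (v.injective h')
    exact ⟨entry_rankOne_diagonal _ t _ _ this, entry_rankOne_diagonal _ t _ _ this.symm⟩
  spec_nonempty := ⟨_, mem_spec_rankOne _ t⟩

theorem not_deltaOne_graphProblem {V : Type u} (G : SimpleGraph V) (v : ℕ ≃ V)
    (Class : GraphOp G v → Prop) (Ξ : GraphOp G v → Cl) (K : Type) [Encodable K] (κ : K → ℂ)
    (t : ℝ) (hClass : ∀ k t, Class (GraphOp.rankOne G v k t))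
    (hΞ : ∀ k, 1 ≤ |Metric.infDist (t : ℂ) (Ξ (GraphOp.rankOne G v k t)).1 -
      Metric.infDist (t : ℂ) (Ξ (GraphOp.rankOne G v 0 0)).1|) :
    ¬ DeltaOne .general (graphProblem G v Class Ξ K κ) := by
  refine not_deltaOne_of_adversary _ ⟨GraphOp.rankOne G v 0 0, hClass 0 0⟩ t fun U => ?_
  let row : GraphIdx ⊕ K → ℕ := fun k => match k with
    | .inl (.inl (i, _)) => i
    | _ => 0
  obtain ⟨k, hk⟩ := Infinite.exists_notMem_finset (U.image row)
  refine ⟨⟨GraphOp.rankOne G v k t, hClass k t⟩, fun e he => ?_, hΞ k⟩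
  rcases e with (⟨i, j⟩ | n) | e
  · have hik : v i ≠ v k := by
      intro h
      rw [v.injective h] at he
      exact hk (Finset.mem_image_of_mem row he)
    change entry (SCI.rankOne (v k) t) (v i) (v j) = entry (SCI.rankOne (v 0) 0) (v i) (v j)
    rw [entry_rankOne_ne t (.inl hik)]
    by_cases h : v i = v 0 ∧ v j = v 0
    · rw [h.1, h.2, entry_rankOne_self]; simp
    · rw [entry_rankOne_ne 0 (not_and_or.1 h)]
  · rfl
  · rfl

/-! ## Primitive recursive functions: compositional rules -/

attribute [fun_prop] Primrec
attribute [fun_prop] PrimrecPred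

section Rules

variable {α β γ : Type*} [Primcodable α] [Primcodable β] [Primcodable γ]

@[fun_prop]
theorem primrec_id : Primrec (fun a : α => a) := Primrec.id

@[fun_prop]
theorem primrec_const (b : β) : Primrec (fun _ : α => b) := Primrec.const b

@[fun_prop]
theorem primrec_comp {f : β → γ} {g : α → β} (hf : Primrec f) (hg : Primrec g) :
    Primrec (fun a => f (g a)) := hf.comp hg

@[fun_prop]
theorem primrec_fst {f : α → β × γ} (hf : Primrec f) : Primrec (fun a => (f a).1) :=
  Primrec.fst.comp hf

@[fun_prop]
theorem primrec_snd {f : α → β × γ} (hf : Primrec f) : Primrec (fun a => (f a).2) :=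
  Primrec.snd.comp hf

@[fun_prop]
theorem primrec_mk {f : α → β} {g : α → γ} (hf : Primrec f) (hg : Primrec g) :
    Primrec (fun a => (f a, g a)) := hf.pair hg

@[fun_prop]
theorem primrec_add {f g : α → ℕ} (hf : Primrec f) (hg : Primrec g) :
    Primrec (fun a => f a + g a) := Primrec.nat_add.comp hf hg

@[fun_prop]
theorem primrec_sub {f g : α → ℕ} (hf : Primrec f) (hg : Primrec g) :
    Primrec (fun a => f a - g a) := Primrec.nat_sub.comp hf hg

@[fun_prop]
theorem primrec_mul {f g : α → ℕ} (hf : Primrec f) (hg : Primrec g) :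
    Primrec (fun a => f a * g a) := Primrec.nat_mul.comp hf hg

@[fun_prop]
theorem primrec_div {f g : α → ℕ} (hf : Primrec f) (hg : Primrec g) :
    Primrec (fun a => f a / g a) := Primrec.nat_div.comp hf hg

@[fun_prop]
theorem primrec_mod {f g : α → ℕ} (hf : Primrec f) (hg : Primrec g) :
    Primrec (fun a => f a % g a) := Primrec.nat_mod.comp hf hg

@[fun_prop]
theorem primrec_pow {f g : α → ℕ} (hf : Primrec f) (hg : Primrec g) :
    Primrec (fun a => f a ^ g a) :=
  (Primrec₂.unpaired'.1 Nat.Primrec.pow).comp hf hg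

@[fun_prop]
theorem primrec_natPair {f g : α → ℕ} (hf : Primrec f) (hg : Primrec g) :
    Primrec (fun a => Nat.pair (f a) (g a)) := Primrec₂.natPair.comp hf hg

@[fun_prop]
theorem primrec_unpair {f : α → ℕ} (hf : Primrec f) : Primrec (fun a => (f a).unpair) :=
  Primrec.unpair.comp hf

@[fun_prop]
theorem primrec_encode {f : α → β} (hf : Primrec f) : Primrec (fun a => Encodable.encode (f a)) :=
  Primrec.encode.comp hf

@[fun_prop]
theorem primrec_length {f : α → List β} (hf : Primrec f) : Primrec (fun a => (f a).length) :=
  Primrec.list_length.comp hf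

@[fun_prop]
theorem primrec_concat {f : α → List β} {g : α → β} (hf : Primrec f) (hg : Primrec g) :
    Primrec (fun a => f a ++ [g a]) := Primrec.list_concat.comp hf hg

@[fun_prop]
theorem primrec_getD {f : α → List β} {g : α → ℕ} (d : β) (hf : Primrec f) (hg : Primrec g) :
    Primrec (fun a => (f a).getD (g a) d) := (Primrec.list_getD d).comp hf hg

@[fun_prop]
theorem primrec_ite {p : α → Prop} [DecidablePred p] {f g : α → β} (hp : PrimrecPred p)
    (hf : Primrec f) (hg : Primrec g) : Primrec (fun a => if p a then f a else g a) :=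
  Primrec.ite hp hf hg

@[fun_prop]
theorem primrecPred_eq {f g : α → β} (hf : Primrec f) (hg : Primrec g) :
    PrimrecPred (fun a => f a = g a) := Primrec.eq.comp hf hg

@[fun_prop]
theorem primrecPred_lt {f g : α → ℕ} (hf : Primrec f) (hg : Primrec g) :
    PrimrecPred (fun a => f a < g a) := Primrec.nat_lt.comp hf hg

@[fun_prop]
theorem primrecPred_le {f g : α → ℕ} (hf : Primrec f) (hg : Primrec g) :
    PrimrecPred (fun a => f a ≤ g a) := Primrec.nat_le.comp hf hg

@[fun_prop]
theorem primrecPred_or {p q : α → Prop} (hp : PrimrecPred p) (hq : PrimrecPred q) :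
    PrimrecPred (fun a => p a ∨ q a) := hp.or hq

end Rules

/-! ## Codes of arithmetic expressions in the values of the oracle -/

/-- Every natural number is the code of an arithmetic expression in the real and imaginary parts
of the values of an oracle; this is its value. -/
noncomputable def evalCode (O : ℕ → ℂ) (t : ℕ) : ℝ :=
  -- The code `0` is separated because `t / 7 < t` fails there; its value agrees with that of the
  -- constant `0`.
  if _ht : t = 0 then 0
  else match t % 7 with
    | 0 => (t / 7 : ℕ)
    | 1 => (O (t / 7)).re
    | 2 => (O (t / 7)).im
    | 3 => evalCode O (t / 7).unpair.1 + evalCode O (t / 7).unpair.2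
    | 4 => evalCode O (t / 7).unpair.1 - evalCode O (t / 7).unpair.2
    | 5 => evalCode O (t / 7).unpair.1 * evalCode O (t / 7).unpair.2
    | _ => evalCode O (t / 7).unpair.1 / evalCode O (t / 7).unpair.2
termination_by t
decreasing_by
  all_goals
    have h1 := Nat.unpair_left_le (t / 7)
    have h2 := Nat.unpair_right_le (t / 7)
    omega

/-- The code of a constant. -/
def codeConst (k : ℕ) : ℕ := 7 * k
/-- The code of the real part of a value of the oracle. -/
def codeRe (k : ℕ) : ℕ := 7 * k + 1
/-- The code of the imaginary part of a value of the oracle. -/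
def codeIm (k : ℕ) : ℕ := 7 * k + 2
/-- The code of a sum. -/
def codeAdd (a b : ℕ) : ℕ := 7 * Nat.pair a b + 3
/-- The code of a difference. -/
def codeSub (a b : ℕ) : ℕ := 7 * Nat.pair a b + 4
/-- The code of a product. -/
def codeMul (a b : ℕ) : ℕ := 7 * Nat.pair a b + 5
/-- The code of a quotient. -/
def codeDiv (a b : ℕ) : ℕ := 7 * Nat.pair a b + 6

theorem seven_mul_add (k i : ℕ) (hi : i < 7) : (7 * k + i) % 7 = i ∧ (7 * k + i) / 7 = k := by
  omega

section Eval

variable (O : ℕ → ℂ)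

@[simp]
theorem evalCode_const (k : ℕ) : evalCode O (codeConst k) = k := by
  have h := seven_mul_add k 0 (by norm_num)
  rw [add_zero] at h
  unfold codeConst
  rw [evalCode]
  by_cases hk : k = 0
  · simp [hk]
  · simp [hk, h.2]

@[simp]
theorem evalCode_re (k : ℕ) : evalCode O (codeRe k) = (O k).re := by
  have h := seven_mul_add k 1 (by norm_num)
  unfold codeRe
  rw [evalCode]
  simp [h.1, h.2]

@[simp]
theorem evalCode_im (k : ℕ) : evalCode O (codeIm k) = (O k).im := by
  have h := seven_mul_add k 2 (by norm_num)
  unfold codeIm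
  rw [evalCode]
  simp [h.1, h.2]

@[simp]
theorem evalCode_add (a b : ℕ) : evalCode O (codeAdd a b) = evalCode O a + evalCode O b := by
  have h := seven_mul_add (Nat.pair a b) 3 (by norm_num)
  unfold codeAdd
  rw [evalCode]
  simp [h.1, h.2]

@[simp]
theorem evalCode_sub (a b : ℕ) : evalCode O (codeSub a b) = evalCode O a - evalCode O b := by
  have h := seven_mul_add (Nat.pair a b) 4 (by norm_num)
  unfold codeSub
  rw [evalCode]
  simp [h.1, h.2]

@[simp]
theorem evalCode_mul (a b : ℕ) : evalCode O (codeMul a b) = evalCode O a * evalCode O b := by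
  have h := seven_mul_add (Nat.pair a b) 5 (by norm_num)
  unfold codeMul
  rw [evalCode]
  simp [h.1, h.2]

@[simp]
theorem evalCode_div (a b : ℕ) : evalCode O (codeDiv a b) = evalCode O a / evalCode O b := by
  have h := seven_mul_add (Nat.pair a b) 6 (by norm_num)
  unfold codeDiv
  rw [evalCode]
  simp [h.1, h.2]

theorem evalCode_zero : evalCode O 0 = 0 := by
  rw [evalCode]; simp

theorem evalCode_of_ne_zero {t : ℕ} (ht : t ≠ 0) : evalCode O t = match t % 7 with
    | 0 => (t / 7 : ℕ)
    | 1 => (O (t / 7)).re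
    | 2 => (O (t / 7)).im
    | 3 => evalCode O (t / 7).unpair.1 + evalCode O (t / 7).unpair.2
    | 4 => evalCode O (t / 7).unpair.1 - evalCode O (t / 7).unpair.2
    | 5 => evalCode O (t / 7).unpair.1 * evalCode O (t / 7).unpair.2
    | _ => evalCode O (t / 7).unpair.1 / evalCode O (t / 7).unpair.2 := by
  conv_lhs => rw [evalCode, dif_neg ht]

/-- Subexpressions and oracle indices occurring in a code are smaller than the code, so codes below
`T` consult the oracle only below `T`. This makes the set of evaluations used finite. -/
theorem evalCode_congr {O O' : ℕ → ℂ} {T : ℕ} (h : ∀ k < T, O k = O' k) (t : ℕ) (ht : t < T) :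
    evalCode O t = evalCode O' t := by
  induction t using Nat.strong_induction_on with
  | _ t ih =>
    by_cases h0 : t = 0
    · rw [h0, evalCode_zero, evalCode_zero]
    have h1 := Nat.unpair_left_le (t / 7)
    have h2 := Nat.unpair_right_le (t / 7)
    have h3 : t / 7 < t := by omega
    rw [evalCode_of_ne_zero O h0, evalCode_of_ne_zero O' h0, h (t / 7) (by omega),
      ih _ (h1.trans_lt h3) (by omega), ih _ (h2.trans_lt h3) (by omega)]

open Classical in
/-- The signs of the values of the first `T` codes. -/
noncomputable def signs (T : ℕ) : List Bool :=
  (List.range T).map fun t => decide (0 < evalCode O t)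

theorem length_signs (T : ℕ) : (signs O T).length = T := by simp [signs]

open Classical in
theorem signs_succ (T : ℕ) : signs O (T + 1) = signs O T ++ [decide (0 < evalCode O T)] := by
  simp [signs, List.range_succ]

theorem signs_getElem?_true {T t : ℕ} :
    (signs O T)[t]? = some true ↔ t < T ∧ 0 < evalCode O t := by
  by_cases h : t < T
  · simp [signs, h]
  · simp [signs, h]

theorem signs_getElem?_false {T t : ℕ} :
    (signs O T)[t]? = some false ↔ t < T ∧ ¬ 0 < evalCode O t := by
  by_cases h : t < T
  · simp [signs, h]
  · simp [signs, h]

theorem signs_congr {O O' : ℕ → ℂ} {T T' : ℕ} (h : ∀ k < T, O k = O' k) (hT : T' ≤ T) :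
    signs O T' = signs O' T' := by
  unfold signs
  refine List.map_congr_left fun t ht => ?_
  rw [evalCode_congr h t ((List.mem_range.1 ht).trans_le hT)]

end Eval

section CodeRules

variable {α : Type*} [Primcodable α] {f g : α → ℕ}

@[fun_prop]
theorem primrec_codeConst (hf : Primrec f) : Primrec (fun a => codeConst (f a)) := by
  unfold codeConst; fun_prop

@[fun_prop]
theorem primrec_codeRe (hf : Primrec f) : Primrec (fun a => codeRe (f a)) := by
  unfold codeRe; fun_prop

@[fun_prop]
theorem primrec_codeIm (hf : Primrec f) : Primrec (fun a => codeIm (f a)) := by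
  unfold codeIm; fun_prop

@[fun_prop]
theorem primrec_codeAdd (hf : Primrec f) (hg : Primrec g) :
    Primrec (fun a => codeAdd (f a) (g a)) := by
  unfold codeAdd; fun_prop

@[fun_prop]
theorem primrec_codeSub (hf : Primrec f) (hg : Primrec g) :
    Primrec (fun a => codeSub (f a) (g a)) := by
  unfold codeSub; fun_prop

@[fun_prop]
theorem primrec_codeMul (hf : Primrec f) (hg : Primrec g) :
    Primrec (fun a => codeMul (f a) (g a)) := by
  unfold codeMul; fun_prop

@[fun_prop]
theorem primrec_codeDiv (hf : Primrec f) (hg : Primrec g) :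
    Primrec (fun a => codeDiv (f a) (g a)) := by
  unfold codeDiv; fun_prop

end CodeRules

/-! ## A machine which examines the signs of all codes -/

section InstrRules

variable {α : Type*} [Primcodable α] {f g h k : α → ℕ}

theorem primrec_instr_const (hf : Primrec f) (hg : Primrec g) (hh : Primrec h) :
    Primrec (fun a => Instr.const (f a) (g a) (h a)) :=
  (Primrec.of_equiv_symm (e := Instr.equivSum)).comp
    (Primrec.sumInl.comp (Primrec.sumInl.comp (hf.pair (hg.pair hh))))

theorem primrec_instr_query (hf : Primrec f) (hg : Primrec g) (hh : Primrec h) :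
    Primrec (fun a => Instr.query (f a) (g a) (h a)) :=
  (Primrec.of_equiv_symm (e := Instr.equivSum)).comp
    (Primrec.sumInl.comp (Primrec.sumInr.comp (Primrec.sumInl.comp (hf.pair (hg.pair hh)))))

theorem primrec_instr_branch (hf : Primrec f) (hg : Primrec g) (hh : Primrec h) :
    Primrec (fun a => Instr.branch (f a) (g a) (h a)) :=
  (Primrec.of_equiv_symm (e := Instr.equivSum)).comp
    (Primrec.sumInl.comp (Primrec.sumInr.comp (Primrec.sumInr.comp
      (Primrec.sumInl.comp (hf.pair (hg.pair hh))))))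

theorem primrec_instr_halt (hf : Primrec f) : Primrec (fun a => Instr.halt (f a)) :=
  (Primrec.of_equiv_symm (e := Instr.equivSum)).comp
    (Primrec.sumInl.comp (Primrec.sumInr.comp (Primrec.sumInr.comp (Primrec.sumInr.comp hf))))

theorem primrec_instr_add (hf : Primrec f) (hg : Primrec g) (hh : Primrec h) (hk : Primrec k) :
    Primrec (fun a => Instr.add (f a) (g a) (h a) (k a)) :=
  (Primrec.of_equiv_symm (e := Instr.equivSum)).comp
    (Primrec.sumInr.comp (Primrec.sumInl.comp (hf.pair (hg.pair (hh.pair hk)))))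

theorem primrec_instr_sub (hf : Primrec f) (hg : Primrec g) (hh : Primrec h) (hk : Primrec k) :
    Primrec (fun a => Instr.sub (f a) (g a) (h a) (k a)) :=
  (Primrec.of_equiv_symm (e := Instr.equivSum)).comp
    (Primrec.sumInr.comp (Primrec.sumInr.comp (Primrec.sumInl.comp
      (hf.pair (hg.pair (hh.pair hk))))))

theorem primrec_instr_mul (hf : Primrec f) (hg : Primrec g) (hh : Primrec h) (hk : Primrec k) :
    Primrec (fun a => Instr.mul (f a) (g a) (h a) (k a)) :=
  (Primrec.of_equiv_symm (e := Instr.equivSum)).comp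
    (Primrec.sumInr.comp (Primrec.sumInr.comp (Primrec.sumInr.comp (Primrec.sumInl.comp
      (hf.pair (hg.pair (hh.pair hk)))))))

theorem primrec_instr_div (hf : Primrec f) (hg : Primrec g) (hh : Primrec h) (hk : Primrec k) :
    Primrec (fun a => Instr.div (f a) (g a) (h a) (k a)) :=
  (Primrec.of_equiv_symm (e := Instr.equivSum)).comp
    (Primrec.sumInr.comp (Primrec.sumInr.comp (Primrec.sumInr.comp (Primrec.sumInr.comp
      (hf.pair (hg.pair (hh.pair hk)))))))

end InstrRules

/-- The instruction which computes the value of the code `t` and stores it in the register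
`2 t + 1`. -/
def codeInstr (t s : ℕ) : Instr :=
  if t % 7 = 0 then .const (2 * t + 1) (t / 7) s
  else if t % 7 = 1 then .query (2 * t + 1) (t / 7) s
  -- A query fills two consecutive registers. Starting at `2 t` puts the imaginary part into `2 t +
  -- 1`; the other part always falls into an even register, where no value of a code is kept.
  else if t % 7 = 2 then .query (2 * t) (t / 7) s
  else if t % 7 = 3 then
    .add (2 * t + 1) (2 * (t / 7).unpair.1 + 1) (2 * (t / 7).unpair.2 + 1) s
  else if t % 7 = 4 then
    .sub (2 * t + 1) (2 * (t / 7).unpair.1 + 1) (2 * (t / 7).unpair.2 + 1) s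
  else if t % 7 = 5 then
    .mul (2 * t + 1) (2 * (t / 7).unpair.1 + 1) (2 * (t / 7).unpair.2 + 1) s
  else .div (2 * t + 1) (2 * (t / 7).unpair.1 + 1) (2 * (t / 7).unpair.2 + 1) s

/-- The `j`-th instruction of the output phase, in which `x / N - N` is written for all
`x ∈ xs`. -/
def outInstr (N : ℕ) (xs : List ℕ) (j s : ℕ) : Instr :=
  -- Coordinate number `j / 4` goes into the register of that number; `xs.length` is the first
  -- register not needed for coordinates, and it holds `N`.
  if xs.length ≤ j / 4 then .halt (xs.length / 2)
  else if j % 4 = 0 then .const xs.length N s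
  else if j % 4 = 1 then .const (j / 4) (xs.getD (j / 4) 0) s
  else if j % 4 = 2 then .div (j / 4) (j / 4) xs.length s
  else .sub (j / 4) (j / 4) xs.length s

/-- The control state on input `n`, in the phase `j`, after the signs `h` have been obtained. -/
def ctrl (n j : ℕ) (h : List Bool) : ℕ := Encodable.encode (n, j, h)

/-- The instruction executed in the control state `ctrl n j h`. -/
def signInstr (D : ℕ → List Bool → Option (ℕ × List ℕ)) (n j : ℕ) (h : List Bool) : Instr :=
  -- Once `D` accepts the signs, `j` counts the output instructions. Before that, `j = 0` evaluates
  -- the next code and any other `j` branches on its sign and appends the sign to the record.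
  ((D n h).map fun o => outInstr o.1 o.2 j (ctrl n (j + 1) h)).getD
    (if j = 0 then codeInstr h.length (ctrl n 1 h)
      else .branch (2 * h.length + 1) (ctrl n 0 (h ++ [true])) (ctrl n 0 (h ++ [false])))

theorem primrec_ctrl {α : Type*} [Primcodable α] {f g : α → ℕ} {h : α → List Bool}
    (hf : Primrec f) (hg : Primrec g) (hh : Primrec h) :
    Primrec (fun a => ctrl (f a) (g a) (h a)) := by
  unfold ctrl; fun_prop

theorem primrec_codeInstr {α : Type*} [Primcodable α] {f g : α → ℕ}
    (hf : Primrec f) (hg : Primrec g) : Primrec (fun a => codeInstr (f a) (g a)) := by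
  unfold codeInstr
  refine .ite (by fun_prop) (primrec_instr_const (by fun_prop) (by fun_prop) hg) ?_
  refine .ite (by fun_prop) (primrec_instr_query (by fun_prop) (by fun_prop) hg) ?_
  refine .ite (by fun_prop) (primrec_instr_query (by fun_prop) (by fun_prop) hg) ?_
  refine .ite (by fun_prop) (primrec_instr_add (by fun_prop) (by fun_prop) (by fun_prop) hg) ?_
  refine .ite (by fun_prop) (primrec_instr_sub (by fun_prop) (by fun_prop) (by fun_prop) hg) ?_
  refine .ite (by fun_prop) (primrec_instr_mul (by fun_prop) (by fun_prop) (by fun_prop) hg) ?_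
  exact primrec_instr_div (by fun_prop) (by fun_prop) (by fun_prop) hg

theorem primrec_outInstr {α : Type*} [Primcodable α] {f g h : α → ℕ} {l : α → List ℕ}
    (hf : Primrec f) (hl : Primrec l) (hg : Primrec g) (hh : Primrec h) :
    Primrec (fun a => outInstr (f a) (l a) (g a) (h a)) := by
  unfold outInstr
  refine .ite (by fun_prop) (primrec_instr_halt (by fun_prop)) ?_
  refine .ite (by fun_prop) (primrec_instr_const (by fun_prop) hf hh) ?_
  refine .ite (by fun_prop) (primrec_instr_const (by fun_prop) (by fun_prop) hh) ?_
  refine .ite (by fun_prop) (primrec_instr_div (by fun_prop) (by fun_prop) (by fun_prop) hh) ?_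
  exact primrec_instr_sub (by fun_prop) (by fun_prop) (by fun_prop) hh

theorem primrec_signInstr {D : ℕ → List Bool → Option (ℕ × List ℕ)} (hD : Primrec₂ D) :
    Primrec (fun p : ℕ × ℕ × List Bool => signInstr D p.1 p.2.1 p.2.2) := by
  unfold signInstr
  refine Primrec.option_getD.comp (Primrec.option_map (hD.comp (by fun_prop) (by fun_prop)) ?_) ?_
  · exact primrec_outInstr (by fun_prop) (by fun_prop) (by fun_prop)
      (primrec_ctrl (by fun_prop) (by fun_prop) (by fun_prop))
  · refine .ite (by fun_prop) (primrec_codeInstr (by fun_prop)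
      (primrec_ctrl (by fun_prop) (by fun_prop) (by fun_prop))) ?_
    exact primrec_instr_branch (by fun_prop) (primrec_ctrl (by fun_prop) (by fun_prop)
      (by fun_prop)) (primrec_ctrl (by fun_prop) (by fun_prop) (by fun_prop))

/-- The machine which, on input `n`, determines the signs of the codes `0, 1, 2, …` until
`D n` accepts the list of the signs, and then writes the output found by `D n`. -/
def signMachine (D : ℕ → List Bool → Option (ℕ × List ℕ)) (hD : Primrec₂ D) : Machine where
  start n := ctrl n 0 []
  prog s := ((Encodable.decode s : Option (ℕ × ℕ × List Bool)).map
    fun p => signInstr D p.1 p.2.1 p.2.2).getD (.halt 0)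
  start_computable := (primrec_ctrl (by fun_prop) (by fun_prop) (by fun_prop)).to_comp
  prog_computable := by
    refine Primrec.to_comp (Primrec.option_getD.comp (Primrec.option_map Primrec.decode ?_) ?_)
    · exact (primrec_signInstr hD).comp Primrec.snd
    · exact Primrec.const _

section Run

variable {D : ℕ → List Bool → Option (ℕ × List ℕ)} (hD : Primrec₂ D) (O : ℕ → ℂ)

theorem signMachine_prog (n j : ℕ) (h : List Bool) :
    (signMachine D hD).prog (ctrl n j h) = signInstr D n j h := by
  simp [signMachine, ctrl, Encodable.encodek]

/-- The registers with odd numbers less than `2 T` contain the values of the codes. -/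
def HoldsCodes (T : ℕ) (reg : ℕ → ℝ) : Prop := ∀ t < T, reg (2 * t + 1) = evalCode O t

/-- The operands of the code `T` are smaller codes, so their values are already in registers and one
instruction suffices. -/
theorem step_code {n T : ℕ} {h : List Bool} (hh : h.length = T) (hDn : D n h = none)
    {reg : ℕ → ℝ} (hreg : HoldsCodes O T reg) :
    ∃ reg', (signMachine D hD).step O ⟨ctrl n 0 h, reg⟩ = ⟨ctrl n 1 h, reg'⟩ ∧
      HoldsCodes O (T + 1) reg' := by
  have hprog : (signMachine D hD).prog (ctrl n 0 h) = codeInstr T (ctrl n 1 h) := by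
    rw [signMachine_prog, signInstr, hDn, ← hh]
    rfl
  have key : ∀ reg' : ℕ → ℝ, (∀ t < T, reg' (2 * t + 1) = reg (2 * t + 1)) →
      reg' (2 * T + 1) = evalCode O T → HoldsCodes O (T + 1) reg' := by
    intro reg' h1 h2 t ht
    rcases Nat.lt_succ_iff_lt_or_eq.1 ht with h3 | rfl
    · rw [h1 t h3, hreg t h3]
    · exact h2
  have hval : evalCode O T = match T % 7 with
    | 0 => ((T / 7 : ℕ) : ℝ)
    | 1 => (O (T / 7)).re
    | 2 => (O (T / 7)).im
    | 3 => evalCode O (T / 7).unpair.1 + evalCode O (T / 7).unpair.2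
    | 4 => evalCode O (T / 7).unpair.1 - evalCode O (T / 7).unpair.2
    | 5 => evalCode O (T / 7).unpair.1 * evalCode O (T / 7).unpair.2
    | _ => evalCode O (T / 7).unpair.1 / evalCode O (T / 7).unpair.2 := by
    by_cases h0 : T = 0
    · subst h0; simp [evalCode_zero]
    · exact evalCode_of_ne_zero O h0
  have h1 := Nat.unpair_left_le (T / 7)
  have h2 := Nat.unpair_right_le (T / 7)
  have hlt : T % 7 ≠ 0 → T / 7 < T := by omega
  have hmod : T % 7 < 7 := Nat.mod_lt _ (by norm_num)
  unfold Machine.step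
  simp only [hprog, codeInstr]
  generalize hr : T % 7 = r at *
  interval_cases r <;> simp only [reduceIte, OfNat.ofNat_ne_zero, OfNat.ofNat_ne_one, one_ne_zero,
    Nat.reduceEqDiff] <;> refine ⟨_, rfl, key _ (fun t ht => ?_) ?_⟩
  all_goals try
    rw [Function.update_of_ne (by omega)]
  all_goals try
    rw [Function.update_of_ne (by omega)]
  all_goals try
    rw [Function.update_self, hval]
  all_goals try
    rw [hreg _ (h1.trans_lt (hlt (by norm_num))), hreg _ (h2.trans_lt (hlt (by norm_num)))]
  all_goals rfl

theorem step_branch {n T : ℕ} (hDn : D n (signs O T) = none) {reg : ℕ → ℝ}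
    (hreg : HoldsCodes O (T + 1) reg) :
    (signMachine D hD).step O ⟨ctrl n 1 (signs O T), reg⟩ =
      ⟨ctrl n 0 (signs O (T + 1)), reg⟩ := by
  have hprog : (signMachine D hD).prog (ctrl n 1 (signs O T)) = .branch (2 * T + 1)
      (ctrl n 0 (signs O T ++ [true])) (ctrl n 0 (signs O T ++ [false])) := by
    rw [signMachine_prog, signInstr, hDn, length_signs]
    rfl
  unfold Machine.step
  simp only [hprog]
  have hr := hreg T (Nat.lt_succ_self T)
  rw [signs_succ]
  by_cases h : 0 < evalCode O T <;> simp [hr, h]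

theorem iterate_signs {n T : ℕ} (h : ∀ T' < T, D n (signs O T') = none) :
    ∃ reg, ((signMachine D hD).step O)^[2 * T] ⟨(signMachine D hD).start n, fun _ => 0⟩ =
      ⟨ctrl n 0 (signs O T), reg⟩ ∧ HoldsCodes O T reg := by
  induction T with
  | zero => exact ⟨fun _ => 0, by simp [signMachine, signs], fun t ht => absurd ht (by omega)⟩
  | succ T ih =>
    obtain ⟨reg, h1, h2⟩ := ih fun T' hT' => h T' (by omega)
    have h0 := h T (Nat.lt_succ_self T)
    obtain ⟨reg', h3, h4⟩ := step_code hD O (length_signs O T) h0 h2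
    refine ⟨reg', ?_, h4⟩
    rw [show 2 * (T + 1) = 2 * T + 1 + 1 by ring, Function.iterate_succ_apply',
      Function.iterate_succ_apply', h1, h3, step_branch hD O h0 h4]

theorem signMachine_prog_of_some {n N : ℕ} {h : List Bool} {xs : List ℕ}
    (hDn : D n h = some (N, xs)) (j : ℕ) :
    (signMachine D hD).prog (ctrl n j h) = outInstr N xs j (ctrl n (j + 1) h) := by
  rw [signMachine_prog, signInstr, hDn]
  rfl

/-- Each coordinate takes four instructions: load `N`, load `x`, divide, subtract. The codes held in
the registers are no longer needed and may be overwritten. -/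
theorem iterate_output {n N : ℕ} {h : List Bool} {xs : List ℕ} (hDn : D n h = some (N, xs))
    (reg : ℕ → ℝ) (i : ℕ) (hi : i ≤ xs.length) :
    ∃ reg', ((signMachine D hD).step O)^[4 * i] ⟨ctrl n 0 h, reg⟩ = ⟨ctrl n (4 * i) h, reg'⟩ ∧
      ∀ k < i, reg' k = (xs.getD k 0 : ℝ) / N - N := by
  induction i with
  | zero => exact ⟨reg, rfl, fun k hk => absurd hk (by omega)⟩
  | succ i ih =>
    obtain ⟨reg', h1, h2⟩ := ih (by omega)
    have hlt : ¬ xs.length ≤ i := by omega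
    have hne : i ≠ xs.length := by omega
    have e0 : (4 * i) / 4 = i ∧ (4 * i) % 4 = 0 := by omega
    have e1 : (4 * i + 1) / 4 = i ∧ (4 * i + 1) % 4 = 1 := by omega
    have e2 : (4 * i + 1 + 1) / 4 = i ∧ (4 * i + 1 + 1) % 4 = 2 := by omega
    have e3 : (4 * i + 1 + 1 + 1) / 4 = i ∧ (4 * i + 1 + 1 + 1) % 4 = 3 := by omega
    have s0 : ∀ r : ℕ → ℝ, (signMachine D hD).step O ⟨ctrl n (4 * i) h, r⟩ =
        ⟨ctrl n (4 * i + 1) h, Function.update r xs.length N⟩ := by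
      intro r
      unfold Machine.step
      simp only [signMachine_prog_of_some hD hDn, outInstr, e0.1, e0.2, hlt, if_false, if_true]
    have s1 : ∀ r : ℕ → ℝ, (signMachine D hD).step O ⟨ctrl n (4 * i + 1) h, r⟩ =
        ⟨ctrl n (4 * i + 1 + 1) h, Function.update r i (xs.getD i 0 : ℕ)⟩ := by
      intro r
      unfold Machine.step
      simp [signMachine_prog_of_some hD hDn, outInstr, e1.1, e1.2, hlt]
    have s2 : ∀ r : ℕ → ℝ, (signMachine D hD).step O ⟨ctrl n (4 * i + 1 + 1) h, r⟩ =
        ⟨ctrl n (4 * i + 1 + 1 + 1) h, Function.update r i (r i / r xs.length)⟩ := by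
      intro r
      unfold Machine.step
      simp [signMachine_prog_of_some hD hDn, outInstr, e2.1, e2.2, hlt]
    have s3 : ∀ r : ℕ → ℝ, (signMachine D hD).step O ⟨ctrl n (4 * i + 1 + 1 + 1) h, r⟩ =
        ⟨ctrl n (4 * i + 1 + 1 + 1 + 1) h, Function.update r i (r i - r xs.length)⟩ := by
      intro r
      unfold Machine.step
      simp [signMachine_prog_of_some hD hDn, outInstr, e3.1, e3.2, hlt]
    rw [show 4 * (i + 1) = 4 * i + 1 + 1 + 1 + 1 by ring, Function.iterate_succ_apply',
      Function.iterate_succ_apply', Function.iterate_succ_apply', Function.iterate_succ_apply',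
      h1, s0, s1, s2, s3]
    refine ⟨_, rfl, fun k hk => ?_⟩
    rcases Nat.lt_succ_iff_lt_or_eq.1 hk with h3 | rfl
    · rw [Function.update_of_ne (by omega), Function.update_of_ne (by omega),
        Function.update_of_ne (by omega), Function.update_of_ne (by omega), h2 k h3]
    · simp only [Function.update_self, Function.update_of_ne hne.symm]

/-- The points with coordinates `x / N - N`, for consecutive pairs of elements of `xs`. -/
noncomputable def outPoints (N : ℕ) (xs : List ℕ) : List ℂ :=
  List.ofFn fun i : Fin (xs.length / 2) =>
    (⟨(xs.getD (2 * i) 0 : ℝ) / N - N, (xs.getD (2 * i + 1) 0 : ℝ) / N - N⟩ : ℂ)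

theorem signMachine_outputs {n T N : ℕ} {xs : List ℕ} (h : ∀ T' < T, D n (signs O T') = none)
    (hDn : D n (signs O T) = some (N, xs)) :
    (signMachine D hD).Outputs O n (outPoints N xs) := by
  obtain ⟨reg, h1, -⟩ := iterate_signs hD O h
  obtain ⟨reg', h2, h3⟩ := iterate_output hD O hDn reg xs.length le_rfl
  refine ⟨4 * xs.length + 2 * T, xs.length / 2, ⟨ctrl n (4 * xs.length) (signs O T), reg'⟩,
    ?_, ?_, ?_⟩
  · rw [Function.iterate_add_apply, h1, h2]
  · rw [signMachine_prog_of_some hD hDn, outInstr, if_pos]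
    omega
  · unfold outPoints
    congr 1
    ext1 i
    have hi := i.2
    have e1 := h3 (2 * i) (by omega)
    have e2 := h3 (2 * i + 1) (by omega)
    simp only [e1, e2]

end Run

/-! ## Towers computed by such machines -/

/-- The tower stops at the first number of signs that `D` accepts. Only evaluations with encoding
below that time matter, which gives a general algorithm; `k₀` merely keeps the set of evaluations
non-empty. Convergence is inherited because `N > n`. -/
theorem realises_of_decider (P : Problem.{u}) (R : ℕ → P.Dom → Set ℂ) (k₀ : P.Idx)
    {D : ℕ → List Bool → Option (ℕ × List ℕ)} (hD : Primrec₂ D)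
    (hR : ∀ A, (∀ n, 1 ≤ n → (R n A).Finite) ∧ (∀ᶠ n in atTop, (R n A).Nonempty) ∧
      Tendsto (fun n => dAW (R n A) (P.sol A).1) atTop (𝓝 0))
    (htot : ∀ n A, ∃ T o, D n (signs (P.oracle A) T) = some o)
    (hsound : ∀ n A T N xs, D n (signs (P.oracle A) T) = some (N, xs) →
      n < N ∧ R N A = {z | z ∈ outPoints N xs} ∧ (R N A).Nonempty ∧
        ∃ X : Cl, R N A ⊆ X.1 ∧ dAW X.1 (P.sol A).1 ≤ (2 : ℝ)⁻¹ ^ n) :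
    Realises P R := by
  classical
  refine ⟨hR, ?_⟩
  let time : ℕ → P.Dom → ℕ := fun n A => Nat.find (htot n A)
  have hhalts : ∀ n A, ∃ o, D n (signs (P.oracle A) (time n A)) = some o := fun n A =>
    Nat.find_spec (htot n A)
  have hmin : ∀ n A, ∀ T' < time n A, D n (signs (P.oracle A) T') = none := fun n A T' hT' => by
    have h := Nat.find_min (htot n A) hT'
    push Not at h
    exact Option.eq_none_iff_forall_ne_some.2 h
  choose o ho using hhalts
  have hs : ∀ n A, _ := fun n A => hsound n A (time n A) (o n A).1 (o n A).2 (ho n A)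
  have hlt : ∀ n A, n < (o n A).1 := fun n A => (hs n A).1
  let Γ : ℕ → P.Dom → Cl := fun n A => ⟨R (o n A).1 A,
    ((hR A).1 _ (by have := hlt n A; omega)).isClosed, (hs n A).2.2.1⟩
  have hΓ : ∀ n A, (Γ n A).1 = {z | z ∈ outPoints (o n A).1 (o n A).2} := fun n A => (hs n A).2.1
  choose X hX using fun n A => (hs n A).2.2.2
  refine ⟨Γ, ⟨⟨fun n => ?_, fun _ => ⟨signMachine D hD, fun n A => ?_⟩, fun A => ?_⟩, X, hX⟩,
    fun n A => (o n A).1, fun n A => ⟨hlt n A, rfl⟩⟩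
  · refine ⟨fun A => insert k₀ (((List.range (time n A)).filterMap P.enc.decode).toFinset),
      fun A => ⟨Finset.insert_nonempty _ _, fun B hB => ?_⟩⟩
    have hO : ∀ k < time n A, P.oracle B k = P.oracle A k := by
      intro k hk
      unfold Problem.oracle
      cases hdec : P.enc.decode k with
      | none => rfl
      | some i =>
        refine hB i (Finset.mem_insert_of_mem ?_)
        rw [List.mem_toFinset, List.mem_filterMap]
        exact ⟨k, List.mem_range.2 hk, hdec⟩
    -- All initial records of signs agree up to this time, so `B` is accepted no later than `A`, and
    -- an earlier acceptance of `B` would be one of `A`.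
    have hst : time n B = time n A := by
      have h1 : D n (signs (P.oracle B) (time n A)) = some (o n A) := by
        rw [signs_congr hO le_rfl, ho]
      refine le_antisymm (Nat.find_min' _ ⟨_, h1⟩) ?_
      by_contra hcon
      push Not at hcon
      have h2 := hmin n A _ hcon
      rw [← signs_congr hO hcon.le, ho] at h2
      cases h2
    have hoo : o n B = o n A := by
      have h1 := ho n B
      rw [hst, signs_congr hO le_rfl, ho] at h1
      exact (Option.some.inj h1).symm
    refine ⟨Subtype.ext ?_, ?_⟩
    · rw [hΓ, hΓ, hoo]
    · simp only [hst]
  · exact ⟨_, signMachine_outputs hD (P.oracle A) (hmin n A) (ho n A), hΓ n A⟩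
  · have h1 : Tendsto (fun n => (o n A).1) atTop atTop :=
      tendsto_atTop_mono (fun n => (hlt n A).le) tendsto_id
    exact (hR A).2.2.comp h1

/-! ## Functions computed from the signs of codes -/

section OracleComputable

variable {X : Type*} {α β γ : Type*} [Primcodable α] [Primcodable β] [Primcodable γ]
  {𝒪 : X → ℕ → ℂ}

/-- `F A a` can be computed from `a` and the signs of sufficiently many codes, evaluated with the
oracle `𝒪 A`; with too few signs the computation does not give a result. -/
def OracleComputable (𝒪 : X → ℕ → ℂ) (F : X → α → β) : Prop :=
  ∃ D : α → List Bool → Option β, Primrec₂ D ∧ ∀ A a,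
    (∀ T b, D a (signs (𝒪 A) T) = some b → b = F A a) ∧
      ∀ᶠ T in atTop, D a (signs (𝒪 A) T) = some (F A a)

open Classical in
/-- `p A a` can be decided from `a` and the signs of sufficiently many codes. -/
def OracleDecidable (𝒪 : X → ℕ → ℂ) (p : X → α → Prop) : Prop :=
  OracleComputable 𝒪 fun A a => decide (p A a)

theorem OracleComputable.of_primrec {f : α → β} (hf : Primrec f) :
    OracleComputable 𝒪 fun _ => f :=
  ⟨fun a _ => some (f a), Primrec.option_some.comp (hf.comp Primrec.fst),
    fun _ _ => ⟨fun _ _ h => (Option.some.inj h).symm, Eventually.of_forall fun _ => rfl⟩⟩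

/-- Partial results are always correct, and both procedures give one from some number of signs on;
these two properties survive chaining. -/
theorem OracleComputable.comp {F : X → β → γ} {G : X → α → β} (hF : OracleComputable 𝒪 F)
    (hG : OracleComputable 𝒪 G) : OracleComputable 𝒪 fun A a => F A (G A a) := by
  obtain ⟨D, hD, hD'⟩ := hF
  obtain ⟨E, hE, hE'⟩ := hG
  refine ⟨fun a h => (E a h).bind fun b => D b h, ?_, fun A a => ⟨fun T c hc => ?_, ?_⟩⟩
  · exact Primrec.option_bind hE (hD.comp Primrec.snd (Primrec.snd.comp Primrec.fst))
  · obtain ⟨b, hb, hc⟩ := Option.bind_eq_some_iff.1 hc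
    rw [(hD' A b).1 T c hc, (hE' A a).1 T b hb]
  · filter_upwards [(hE' A a).2, (hD' A (G A a)).2] with T h1 h2
    rw [h1, Option.bind_some, h2]

theorem OracleComputable.map {f : β → γ} {G : X → α → β} (hf : Primrec f)
    (hG : OracleComputable 𝒪 G) : OracleComputable 𝒪 fun A a => f (G A a) :=
  (OracleComputable.of_primrec hf).comp hG

theorem OracleComputable.comp_primrec {F : X → β → γ} {f : α → β} (hF : OracleComputable 𝒪 F)
    (hf : Primrec f) : OracleComputable 𝒪 fun A a => F A (f a) :=
  hF.comp (OracleComputable.of_primrec hf)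

theorem OracleComputable.pair {F : X → α → β} {G : X → α → γ} (hF : OracleComputable 𝒪 F)
    (hG : OracleComputable 𝒪 G) : OracleComputable 𝒪 fun A a => (F A a, G A a) := by
  obtain ⟨D, hD, hD'⟩ := hF
  obtain ⟨E, hE, hE'⟩ := hG
  refine ⟨fun a h => (D a h).bind fun b => (E a h).map fun c => (b, c), ?_,
    fun A a => ⟨fun T p hp => ?_, ?_⟩⟩
  · refine Primrec.option_bind hD (Primrec.option_map (hE.comp (Primrec.fst.comp Primrec.fst)
      (Primrec.snd.comp Primrec.fst)) ?_)
    exact (Primrec.snd.comp Primrec.fst).pair Primrec.snd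
  · obtain ⟨b, hb, hc⟩ := Option.bind_eq_some_iff.1 hp
    obtain ⟨c, hc', rfl⟩ := Option.map_eq_some_iff.1 hc
    rw [(hD' A a).1 T b hb, (hE' A a).1 T c hc']
  · filter_upwards [(hE' A a).2, (hD' A a).2] with T h1 h2
    rw [h1, h2]
    rfl

/-- Recursion over a natural number. -/
theorem OracleComputable.natRec {F : X → α → β} {G : X → α × ℕ × β → β}
    (hF : OracleComputable 𝒪 F) (hG : OracleComputable 𝒪 G) :
    OracleComputable 𝒪 fun A (a : α × ℕ) =>
      Nat.rec (motive := fun _ => β) (F A a.1) (fun n b => G A (a.1, n, b)) a.2 := by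
  obtain ⟨D, hD, hD'⟩ := hF
  obtain ⟨E, hE, hE'⟩ := hG
  refine ⟨fun a h => Nat.rec (motive := fun _ => Option β) (D a.1 h)
    (fun n b => b.bind fun b => E (a.1, n, b) h) a.2, ?_, fun A a => ⟨?_, ?_⟩⟩
  · refine Primrec.nat_rec' (h := fun (y : (α × ℕ) × List Bool) (r : ℕ × Option β) =>
      r.2.bind fun b => E (y.1.1, r.1, b) y.2) (Primrec.snd.comp Primrec.fst)
      (hD.comp (Primrec.fst.comp Primrec.fst) Primrec.snd) ?_
    have h1 : Primrec fun y : (((α × ℕ) × List Bool) × ℕ × Option β) × β =>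
        (y.1.1.1.1, y.1.2.1, y.2) := by fun_prop
    have h2 : Primrec fun y : (((α × ℕ) × List Bool) × ℕ × Option β) × β => y.1.1.2 := by
      fun_prop
    exact Primrec.option_bind (Primrec.snd.comp Primrec.snd) (hE.comp h1 h2)
  · obtain ⟨a, n⟩ := a
    intro T b hb
    induction n generalizing b with
    | zero => exact (hD' A a).1 T b hb
    | succ n ih =>
      obtain ⟨c, hc, hb⟩ := Option.bind_eq_some_iff.1 hb
      rw [(hE' A _).1 T b hb, ih c hc]
  · obtain ⟨a, n⟩ := a
    induction n with
    | zero => exact (hD' A a).2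
    | succ n ih =>
      filter_upwards [ih, (hE' A (a, n, Nat.rec (motive := fun _ => β) (F A a)
        (fun n b => G A (a, n, b)) n)).2] with T h1 h2
      rw [h1, Option.bind_some, h2]

/-- Unbounded search. -/
theorem OracleDecidable.find {p : X → α × ℕ → Prop} (hp : OracleDecidable 𝒪 p) {G : X → α → ℕ}
    (hG : ∀ A a, p A (a, G A a)) (hG' : ∀ A a, ∀ k < G A a, ¬ p A (a, k)) :
    OracleComputable 𝒪 G := by
  classical
  obtain ⟨D, hD, hD'⟩ := hp
  -- The first candidate not yet refuted. It is accepted only if it is already confirmed; if it is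
  -- undecided there is no result, so no smaller solution can be skipped.
  let idx : α → List Bool → ℕ := fun a h =>
    (List.range h.length).findIdx fun k => !decide (D (a, k) h = some false)
  have hidx : Primrec₂ idx := by
    refine Primrec.list_findIdx (Primrec.list_range.comp (by fun_prop)) ?_
    refine Primrec.not.comp (PrimrecPred.decide ?_)
    exact Primrec.eq.comp (hD.comp (by fun_prop) (by fun_prop)) (by fun_prop)
  refine ⟨fun a h => if D (a, idx a h) h = some true then some (idx a h) else none, ?_,
    fun A a => ⟨fun T b hb => ?_, ?_⟩⟩
  · exact Primrec.ite (Primrec.eq.comp (hD.comp ((by fun_prop : Primrec Prod.fst).pair hidx)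
      (by fun_prop)) (by fun_prop)) (Primrec.option_some.comp hidx) (by fun_prop)
  · simp only at hb
    split_ifs at hb with h1
    obtain rfl := Option.some.inj hb
    have h2 := (hD' A _).1 T _ h1
    have h3 : p A (a, idx a (signs (𝒪 A) T)) := by simpa using h2.symm
    refine le_antisymm ?_ ?_
    · by_contra hcon
      push Not at hcon
      have h4 := List.not_of_lt_findIdx (p := fun k => !decide (D (a, k) (signs (𝒪 A) T) =
        some false)) (xs := List.range (signs (𝒪 A) T).length) hcon
      simp only [List.getElem_range] at h4
      have h5 : D (a, G A a) (signs (𝒪 A) T) = some false := by simpa using h4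
      have h6 := (hD' A _).1 T _ h5
      exact absurd (hG A a) (by simpa using h6.symm)
    · by_contra hcon
      push Not at hcon
      exact hG' A a _ hcon h3
  · have h1 : ∀ᶠ T in atTop, ∀ k ∈ Finset.range (G A a + 1),
        D (a, k) (signs (𝒪 A) T) = some (decide (p A (a, k))) :=
      (Finset.eventually_all _).2 fun k _ => (hD' A (a, k)).2
    filter_upwards [h1, eventually_gt_atTop (G A a)] with T h2 hT
    have h3 : idx a (signs (𝒪 A) T) = G A a := by
      refine (List.findIdx_eq (by simpa [length_signs] using hT)).2 ⟨?_, fun j hj => ?_⟩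
      · rw [List.getElem_range, h2 _ (Finset.mem_range.2 (Nat.lt_succ_self _))]
        simp [hG A a]
      · rw [List.getElem_range, h2 _ (Finset.mem_range.2 (by omega))]
        simp [hG' A a j hj]
    rw [h3, if_pos]
    rw [h2 _ (Finset.mem_range.2 (Nat.lt_succ_self _))]
    simp [hG A a]

theorem OracleDecidable.of_primrec {p : α → Prop} (hp : PrimrecPred p) :
    OracleDecidable 𝒪 fun _ => p := by
  classical
  unfold OracleDecidable
  exact OracleComputable.of_primrec (hp.decide.of_eq fun a => by congr)

theorem OracleDecidable.comp {p : X → β → Prop} {G : X → α → β} (hp : OracleDecidable 𝒪 p)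
    (hG : OracleComputable 𝒪 G) : OracleDecidable 𝒪 fun A a => p A (G A a) :=
  OracleComputable.comp (F := fun A b => @decide (p A b) (Classical.propDecidable _)) hp hG

theorem OracleDecidable.comp_primrec {p : X → β → Prop} {f : α → β} (hp : OracleDecidable 𝒪 p)
    (hf : Primrec f) : OracleDecidable 𝒪 fun A a => p A (f a) :=
  hp.comp (OracleComputable.of_primrec hf)

/-- A primitive recursive condition on a computed value. -/
theorem OracleComputable.decidable {p : β → Prop} {G : X → α → β} (hG : OracleComputable 𝒪 G)
    (hp : PrimrecPred p) : OracleDecidable 𝒪 fun A a => p (G A a) :=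
  (OracleDecidable.of_primrec hp).comp hG

theorem OracleDecidable.of_iff {p q : X → α → Prop} (hp : OracleDecidable 𝒪 p)
    (h : ∀ A a, p A a ↔ q A a) : OracleDecidable 𝒪 q := by
  have : p = q := by
    ext A a; exact h A a
  rwa [← this]

theorem OracleDecidable.not {p : X → α → Prop} (hp : OracleDecidable 𝒪 p) :
    OracleDecidable 𝒪 fun A a => ¬ p A a := by
  classical
  have := OracleComputable.map Primrec.not hp
  unfold OracleDecidable
  simpa using this

theorem OracleDecidable.and {p q : X → α → Prop} (hp : OracleDecidable 𝒪 p)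
    (hq : OracleDecidable 𝒪 q) : OracleDecidable 𝒪 fun A a => p A a ∧ q A a := by
  classical
  have := OracleComputable.map (f := fun x : Bool × Bool => x.1 && x.2) Primrec.and (OracleComputable.pair hp hq)
  unfold OracleDecidable
  simpa using this

theorem OracleDecidable.or {p q : X → α → Prop} (hp : OracleDecidable 𝒪 p)
    (hq : OracleDecidable 𝒪 q) : OracleDecidable 𝒪 fun A a => p A a ∨ q A a :=
  ((hp.not.and hq.not).not).of_iff fun _ _ => by tauto

theorem OracleDecidable.imp {p q : X → α → Prop} (hp : OracleDecidable 𝒪 p)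
    (hq : OracleDecidable 𝒪 q) : OracleDecidable 𝒪 fun A a => p A a → q A a :=
  (hp.not.or hq).of_iff fun _ _ => by tauto

open Classical in
/-- The list of all `k < f A a` with `p A (a, k)`. -/
theorem OracleDecidable.filter {p : X → α × ℕ → Prop} (hp : OracleDecidable 𝒪 p) {f : X → α → ℕ}
    (hf : OracleComputable 𝒪 f) :
    OracleComputable 𝒪 fun A a => (List.range (f A a)).filter fun k => p A (a, k) := by
  have h1 : OracleComputable 𝒪 fun A (x : α × ℕ × List ℕ) =>
      if p A (x.1, x.2.1) then x.2.2 ++ [x.2.1] else x.2.2 := by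
    have h2 : OracleComputable 𝒪 fun A (x : α × ℕ × List ℕ) => (decide (p A (x.1, x.2.1)), x) :=
      (hp.comp_primrec (f := fun x : α × ℕ × List ℕ => (x.1, x.2.1)) (by fun_prop)).pair
        (.of_primrec (by fun_prop))
    have h3 : Primrec fun y : Bool × α × ℕ × List ℕ =>
        if y.1 = true then y.2.2.2 ++ [y.2.2.1] else y.2.2.2 := by fun_prop
    have := OracleComputable.map h3 h2
    simpa using this
  have h2 := (OracleComputable.natRec (F := fun _ (_ : α) => ([] : List ℕ))
    (.of_primrec (by fun_prop)) h1).comp (OracleComputable.pair (.of_primrec Primrec.id) hf)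
  convert h2 using 3 with A a
  simp only [id]
  induction f A a with
  | zero => rfl
  | succ n ih =>
    rw [List.range_succ, List.filter_append, ih]
    by_cases h : p A (a, n) <;> simp [h]

theorem OracleDecidable.forall_lt {p : X → α × ℕ → Prop} (hp : OracleDecidable 𝒪 p)
    {f : X → α → ℕ} (hf : OracleComputable 𝒪 f) :
    OracleDecidable 𝒪 fun A a => ∀ k < f A a, p A (a, k) := by
  classical
  refine ((hp.not.filter hf).decidable (p := fun l => l = []) (by fun_prop)).of_iff fun A a => ?_
  rw [List.filter_eq_nil_iff]
  simp

theorem OracleDecidable.exists_lt {p : X → α × ℕ → Prop} (hp : OracleDecidable 𝒪 p)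
    {f : X → α → ℕ} (hf : OracleComputable 𝒪 f) :
    OracleDecidable 𝒪 fun A a => ∃ k < f A a, p A (a, k) :=
  (hp.not.forall_lt hf).not.of_iff fun A a => by push Not; rfl

/-- The sign of a code. -/
theorem OracleDecidable.pos {c : α → ℕ} (hc : Primrec c) :
    OracleDecidable 𝒪 fun A a => 0 < evalCode (𝒪 A) (c a) := by
  classical
  refine ⟨fun a h => h[c a]?, Primrec.list_getElem?.comp (by fun_prop) (by fun_prop),
    fun A a => ⟨fun T b hb => ?_, ?_⟩⟩
  · cases b
    · simp [(signs_getElem?_false _).1 hb |>.2]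
    · simp [(signs_getElem?_true _).1 hb |>.2]
  · filter_upwards [eventually_gt_atTop (c a)] with T hT
    by_cases h : 0 < evalCode (𝒪 A) (c a)
    · rw [(signs_getElem?_true _).2 ⟨hT, h⟩]; simp [h]
    · rw [(signs_getElem?_false _).2 ⟨hT, h⟩]; simp [h]

end OracleComputable

theorem realises_of_oracleComputable (P : Problem.{u}) (R : ℕ → P.Dom → Set ℂ) (k₀ : P.Idx)
    {F : P.Dom → ℕ → ℕ × List ℕ} (hF : OracleComputable P.oracle F)
    (hR : ∀ A, (∀ n, 1 ≤ n → (R n A).Finite) ∧ (∀ᶠ n in atTop, (R n A).Nonempty) ∧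
      Tendsto (fun n => dAW (R n A) (P.sol A).1) atTop (𝓝 0))
    (hsound : ∀ n A, n < (F A n).1 ∧ R (F A n).1 A = {z | z ∈ outPoints (F A n).1 (F A n).2} ∧
      (R (F A n).1 A).Nonempty ∧
        ∃ X : Cl, R (F A n).1 A ⊆ X.1 ∧ dAW X.1 (P.sol A).1 ≤ (2 : ℝ)⁻¹ ^ n) :
    Realises P R := by
  obtain ⟨D, hD, hD'⟩ := hF
  refine realises_of_decider P R k₀ hD hR (fun n A => ?_) fun n A T N xs h => ?_
  · obtain ⟨T, hT⟩ := (hD' A n).2.exists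
    exact ⟨T, _, hT⟩
  · have := hsound n A
    rwa [← (hD' A n).1 T _ h] at this

/-! ## Positive definiteness by division-free elimination -/

section Elimination

/-- The quadratic form of the upper left `n × n` section of an infinite matrix. -/
noncomputable def quadForm (n : ℕ) (E : ℕ → ℕ → ℂ) (x : ℕ → ℂ) : ℂ :=
  ∑ i ∈ Finset.range n, ∑ j ∈ Finset.range n, star (x i) * E i j * x j

/-- One step of division-free elimination. -/
def schurStep (E : ℕ → ℕ → ℂ) (i j : ℕ) : ℂ :=
  E 0 0 * E (i + 1) (j + 1) - E (i + 1) 0 * E 0 (j + 1)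

variable {E : ℕ → ℕ → ℂ}

theorem star_schurStep (hE : ∀ i j, star (E i j) = E j i) (i j : ℕ) :
    star (schurStep E i j) = schurStep E j i := by
  simp only [schurStep, star_sub, star_mul', hE]
  ring

/-- Completing the square in `x 0`, multiplied by the pivot `E 0 0` so that no division occurs. -/
theorem quadForm_succ (hE : ∀ i j, star (E i j) = E j i) (n : ℕ) (x : ℕ → ℂ) :
    E 0 0 * quadForm (n + 1) E x =
      (‖E 0 0 * x 0 + ∑ j ∈ Finset.range n, E 0 (j + 1) * x (j + 1)‖ ^ 2 : ℝ) +
        quadForm n (schurStep E) (fun i => x (i + 1)) := by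
  set s := ∑ j ∈ Finset.range n, E 0 (j + 1) * x (j + 1) with hs
  have hs' : star s = ∑ i ∈ Finset.range n, star (x (i + 1)) * E (i + 1) 0 := by
    rw [hs, star_sum]
    exact Finset.sum_congr rfl fun i _ => by rw [star_mul, hE]
  set T := quadForm n (fun i j => E (i + 1) (j + 1)) (fun i => x (i + 1)) with hT
  have h1 : quadForm (n + 1) E x = star (x 0) * E 0 0 * x 0 + star (x 0) * s + star s * x 0 + T := by
    simp only [quadForm]
    rw [Finset.sum_range_succ', Finset.sum_range_succ']
    simp only [Finset.sum_range_succ' _ n, Finset.sum_add_distrib]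
    rw [hs', hs, Finset.mul_sum, Finset.sum_mul]
    simp only [hT, quadForm, mul_assoc]
    ring
  have h2 : quadForm n (schurStep E) (fun i => x (i + 1)) = E 0 0 * T - star s * s := by
    rw [hs', hs, hT]
    simp only [quadForm, schurStep]
    rw [Finset.mul_sum, Finset.sum_mul_sum, ← Finset.sum_sub_distrib]
    refine Finset.sum_congr rfl fun i _ => ?_
    rw [Finset.mul_sum, ← Finset.sum_sub_distrib]
    exact Finset.sum_congr rfl fun j _ => by ring
  have h3 : ((‖E 0 0 * x 0 + s‖ ^ 2 : ℝ) : ℂ) = star (E 0 0 * x 0 + s) * (E 0 0 * x 0 + s) := by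
    have := Complex.conj_mul' (E 0 0 * x 0 + s)
    rw [Complex.star_def, this]
    push_cast
    rfl
  rw [h1, h2, h3, star_add, star_mul', hE]
  ring

/-- Positive definiteness of the `n × n` section. -/
def PosOn (n : ℕ) (E : ℕ → ℕ → ℂ) : Prop :=
  ∀ x : ℕ → ℂ, (∃ i < n, x i ≠ 0) → 0 < (quadForm n E x).re

/-- The pivot is the value of the form at the first unit vector. With a positive pivot, completing
the square reduces definiteness to the eliminated matrix. -/
theorem posOn_succ_iff (hE : ∀ i j, star (E i j) = E j i) (n : ℕ) :
    PosOn (n + 1) E ↔ 0 < (E 0 0).re ∧ PosOn n (schurStep E) := by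
  have him : (E 0 0).im = 0 := Complex.conj_eq_iff_im.1 (hE 0 0)
  have hre : ∀ w : ℂ, (E 0 0 * w).re = (E 0 0).re * w.re := fun w => by
    rw [Complex.mul_re, him, zero_mul, sub_zero]
  have hstep : ∀ x : ℕ → ℂ, (E 0 0).re * (quadForm (n + 1) E x).re =
      ‖E 0 0 * x 0 + ∑ j ∈ Finset.range n, E 0 (j + 1) * x (j + 1)‖ ^ 2 +
        (quadForm n (schurStep E) (fun i => x (i + 1))).re := fun x => by
    rw [← hre, quadForm_succ hE, Complex.add_re, Complex.ofReal_re]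
  constructor
  · intro h
    have h0 : 0 < (E 0 0).re := by
      have := h (fun i => if i = 0 then 1 else 0) ⟨0, by omega, by simp⟩
      simpa [quadForm, Finset.sum_range_succ'] using this
    refine ⟨h0, fun y ⟨i, hi, hy⟩ => ?_⟩
    have hne : E 0 0 ≠ 0 := fun h => by simp [h] at h0
    -- The coordinate `x 0` is chosen so that the square vanishes, leaving only the form of the
    -- eliminated matrix at `y`.
    let x : ℕ → ℂ := fun k => Nat.casesOn k
      (-(∑ j ∈ Finset.range n, E 0 (j + 1) * y j) / E 0 0) y
    have h1 := hstep x
    have h2 : E 0 0 * x 0 + ∑ j ∈ Finset.range n, E 0 (j + 1) * x (j + 1) = 0 := by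
      change E 0 0 * ((-∑ j ∈ Finset.range n, E 0 (j + 1) * y j) / E 0 0) +
        ∑ j ∈ Finset.range n, E 0 (j + 1) * y j = 0
      rw [mul_div_cancel₀ _ hne, neg_add_cancel]
    rw [h2, norm_zero, zero_pow two_ne_zero, zero_add] at h1
    have h3 := mul_pos h0 (h x ⟨i + 1, by omega, hy⟩)
    rw [h1] at h3
    exact h3
  · rintro ⟨h0, h⟩ x ⟨i, hi, hx⟩
    refine pos_of_mul_pos_right (b := (quadForm (n + 1) E x).re) ?_ h0.le
    rw [hstep]
    by_cases hex : ∃ j < n, x (j + 1) ≠ 0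
    · have := h (fun i => x (i + 1)) hex
      positivity
    · push Not at hex
      have hi0 : i = 0 := by
        by_contra hne
        obtain ⟨j, rfl⟩ := Nat.exists_eq_succ_of_ne_zero hne
        exact hx (hex j (by omega))
      subst hi0
      have h1 : ∑ j ∈ Finset.range n, E 0 (j + 1) * x (j + 1) = 0 :=
        Finset.sum_eq_zero fun j hj => by rw [hex j (Finset.mem_range.1 hj), mul_zero]
      have h2 : quadForm n (schurStep E) (fun i => x (i + 1)) = 0 :=
        Finset.sum_eq_zero fun j hj => Finset.sum_eq_zero fun k hk => by
          simp only [hex k (Finset.mem_range.1 hk), mul_zero]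
      have hne : E 0 0 ≠ 0 := fun h => by simp [h] at h0
      rw [h1, h2, add_zero, Complex.zero_re, add_zero]
      have := norm_pos_iff.2 (mul_ne_zero hne hx)
      positivity

/-- The section is positive definite if and only if all pivots are positive. -/
theorem posOn_iff_pivots (hE : ∀ i j, star (E i j) = E j i) (n : ℕ) :
    PosOn n E ↔ ∀ k < n, 0 < (schurStep^[k] E 0 0).re := by
  induction n generalizing E with
  | zero => simp [PosOn]
  | succ n ih =>
    rw [posOn_succ_iff hE, ih (star_schurStep hE)]
    constructor
    · rintro ⟨h0, h⟩ (_ | k) hk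
      · exact h0
      · exact h k (by omega)
    · exact fun h => ⟨h 0 (by omega), fun k hk => h (k + 1) (by omega)⟩

/-- The matrix `b* b - s`, where `b` has `m` rows. -/
def gramForm (m : ℕ) (b : ℕ → ℕ → ℂ) (s : ℂ) (i j : ℕ) : ℂ :=
  (∑ r ∈ Finset.range m, star (b r i) * b r j) - if i = j then s else 0

theorem star_gramForm (m : ℕ) (b : ℕ → ℕ → ℂ) (s : ℝ) (i j : ℕ) :
    star (gramForm m b s i j) = gramForm m b s j i := by
  unfold gramForm
  rw [star_sub, star_sum]
  congr 1
  · exact Finset.sum_congr rfl fun r _ => by rw [star_mul, star_star]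
  · by_cases h : i = j
    · simp [h]
    · simp [h, Ne.symm h]

theorem quadForm_gramForm (n m : ℕ) (b : ℕ → ℕ → ℂ) (s : ℝ) (x : ℕ → ℂ) :
    (quadForm n (gramForm m b s) x).re =
      ∑ r ∈ Finset.range m, ‖∑ i ∈ Finset.range n, b r i * x i‖ ^ 2 -
        s * ∑ i ∈ Finset.range n, ‖x i‖ ^ 2 := by
  have h1 : quadForm n (gramForm m b s) x =
      ∑ r ∈ Finset.range m, star (∑ i ∈ Finset.range n, b r i * x i) *
        (∑ i ∈ Finset.range n, b r i * x i) - s * ∑ i ∈ Finset.range n, star (x i) * x i := by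
    have h2 : ∀ i ∈ Finset.range n, ∑ j ∈ Finset.range n, star (x i) * gramForm m b s i j * x j =
        ∑ r ∈ Finset.range m, ∑ j ∈ Finset.range n, star (b r i * x i) * (b r j * x j) -
          s * (star (x i) * x i) := by
      intro i hi
      rw [Finset.sum_comm]
      have h3 : s * (star (x i) * x i) = ∑ j ∈ Finset.range n,
          if i = j then s * (star (x i) * x j) else 0 := by
        rw [Finset.sum_ite_eq, if_pos hi]
      rw [h3, ← Finset.sum_sub_distrib]
      refine Finset.sum_congr rfl fun j _ => ?_
      unfold gramForm
      rw [mul_sub, sub_mul, Finset.mul_sum, Finset.sum_mul]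
      congr 1
      · exact Finset.sum_congr rfl fun r _ => by rw [star_mul]; ring
      · split_ifs <;> ring
    unfold quadForm
    rw [Finset.sum_congr rfl h2, Finset.sum_sub_distrib, ← Finset.mul_sum, Finset.sum_comm]
    congr 1
    exact Finset.sum_congr rfl fun r _ => by rw [star_sum, Finset.sum_mul_sum]
  have h4 : ∀ w : ℂ, star w * w = ((‖w‖ ^ 2 : ℝ) : ℂ) := fun w => by
    have := Complex.conj_mul' w
    rw [Complex.star_def, this]
    push_cast
    rfl
  rw [h1]
  simp only [h4]
  rw [← Complex.ofReal_sum, ← Complex.ofReal_sum, ← Complex.ofReal_mul, ← Complex.ofReal_sub,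
    Complex.ofReal_re]

open Matrix in
/-- Positive definiteness in terms of the pivots of the elimination. -/
theorem posDef_iff_pivots {m n l : ℕ} (hn : 1 ≤ n) (b : ℕ → ℕ → ℂ) (B : Matrix (Fin m) (Fin n) ℂ)
    (hB : ∀ (i : Fin m) (j : Fin n), b i j = n * B i j) :
    (B.conjTranspose * B - (((l : ℂ) / n) ^ 2) • (1 : Matrix (Fin n) (Fin n) ℂ)).PosDef ↔
      ∀ k < n, 0 < (schurStep^[k] (gramForm m b ((l : ℝ) ^ 2 : ℝ)) 0 0).re := by
  have hn' : (0 : ℝ) < n := by exact_mod_cast hn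
  rw [show ((l : ℂ) / n) = (((l : ℝ) / n : ℝ) : ℂ) by push_cast; rfl, posDef_gram_sub_iff,
    ← posOn_iff_pivots (star_gramForm m b _)]
  -- Replacing `B` by `n B` and `l/n` by `l` multiplies the form by `n²` and clears the
  -- denominators.
  have key : ∀ x : ℕ → ℂ, (quadForm n (gramForm m b ((l : ℝ) ^ 2 : ℝ)) x).re =
      (n : ℝ) ^ 2 * (∑ i, ‖(B *ᵥ fun j => x j) i‖ ^ 2 - ((l : ℝ) / n) ^ 2 *
        ∑ j : Fin n, ‖x j‖ ^ 2) := by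
    intro x
    rw [quadForm_gramForm, mul_sub, div_pow, ← mul_assoc,
      mul_div_cancel₀ _ (by positivity), Fin.sum_univ_eq_sum_range (fun j => ‖x j‖ ^ 2)]
    congr 1
    rw [← Fin.sum_univ_eq_sum_range (fun r => ‖∑ i ∈ Finset.range n, b r i * x i‖ ^ 2),
      Finset.mul_sum Finset.univ]
    refine Finset.sum_congr rfl fun r _ => ?_
    have h1 : ∑ i ∈ Finset.range n, b r i * x i = n * (B *ᵥ fun j => x j) r := by
      rw [← Fin.sum_univ_eq_sum_range (fun i => b r i * x i), Matrix.mulVec, dotProduct,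
        Finset.mul_sum]
      exact Finset.sum_congr rfl fun j _ => by rw [hB]; ring
    rw [h1, norm_mul, mul_pow, Complex.norm_natCast]
  have hpos : ∀ t : ℝ, 0 < (n : ℝ) ^ 2 * t ↔ 0 < t := fun t => by
    constructor
    · exact fun h => pos_of_mul_pos_right h (by positivity)
    · exact fun h => by positivity
  constructor
  · rintro h x ⟨i, hi, hx⟩
    rw [key, hpos, sub_pos]
    exact h _ fun h0 => hx (congrFun h0 ⟨i, hi⟩)
  · intro h x hx
    obtain ⟨i, hi⟩ := Function.ne_iff.1 hx
    let y : ℕ → ℂ := fun k => if hk : k < n then x ⟨k, hk⟩ else 0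
    have hy : (fun j : Fin n => y j) = x := by
      ext j; simp [y]
    have h1 := h y ⟨i, i.2, by simpa [y] using hi⟩
    rw [key, hpos, sub_pos, hy] at h1
    have hy' : ∀ j : Fin n, y j = x j := fun j => congrFun hy j
    simpa only [hy'] using h1

end Elimination

/-! ## Codes for the pivots -/

/-- The value of a pair of codes. -/
noncomputable def evalPair (O : ℕ → ℂ) (c : ℕ × ℕ) : ℂ := ⟨evalCode O c.1, evalCode O c.2⟩

/-- Pairs of codes for the sum. -/
def pairAdd (c d : ℕ × ℕ) : ℕ × ℕ := (codeAdd c.1 d.1, codeAdd c.2 d.2)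

/-- Pairs of codes for the difference. -/
def pairSub (c d : ℕ × ℕ) : ℕ × ℕ := (codeSub c.1 d.1, codeSub c.2 d.2)

/-- Pairs of codes for the product. -/
def pairMul (c d : ℕ × ℕ) : ℕ × ℕ :=
  (codeSub (codeMul c.1 d.1) (codeMul c.2 d.2), codeAdd (codeMul c.1 d.2) (codeMul c.2 d.1))

/-- Pairs of codes for the complex conjugate. -/
def pairConj (c : ℕ × ℕ) : ℕ × ℕ := (c.1, codeSub (codeConst 0) c.2)

section PairEval

variable (O : ℕ → ℂ)

@[simp]
theorem evalPair_add (c d : ℕ × ℕ) : evalPair O (pairAdd c d) = evalPair O c + evalPair O d := by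
  apply Complex.ext <;> simp [evalPair, pairAdd]

@[simp]
theorem evalPair_sub (c d : ℕ × ℕ) : evalPair O (pairSub c d) = evalPair O c - evalPair O d := by
  apply Complex.ext <;> simp [evalPair, pairSub]

@[simp]
theorem evalPair_mul (c d : ℕ × ℕ) : evalPair O (pairMul c d) = evalPair O c * evalPair O d := by
  apply Complex.ext <;> simp [evalPair, pairMul]

@[simp]
theorem evalPair_conj (c : ℕ × ℕ) : evalPair O (pairConj c) = star (evalPair O c) := by
  apply Complex.ext <;> simp [evalPair, pairConj]

@[simp]
theorem evalPair_const (k : ℕ) : evalPair O (codeConst k, codeConst 0) = k := by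
  apply Complex.ext <;> simp [evalPair]

end PairEval

section PairRules

variable {α : Type*} [Primcodable α] {f g : α → ℕ × ℕ}

@[fun_prop]
theorem primrec_pairAdd (hf : Primrec f) (hg : Primrec g) :
    Primrec (fun a => pairAdd (f a) (g a)) := by
  unfold pairAdd; fun_prop

@[fun_prop]
theorem primrec_pairSub (hf : Primrec f) (hg : Primrec g) :
    Primrec (fun a => pairSub (f a) (g a)) := by
  unfold pairSub; fun_prop

@[fun_prop]
theorem primrec_pairMul (hf : Primrec f) (hg : Primrec g) :
    Primrec (fun a => pairMul (f a) (g a)) := by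
  unfold pairMul; fun_prop

@[fun_prop]
theorem primrec_pairConj (hf : Primrec f) : Primrec (fun a => pairConj (f a)) := by
  unfold pairConj; fun_prop

end PairRules

/-- The number of coordinates of points of the grid. -/
def gridSize (N : ℕ) : ℕ := 2 * (N * N) + 1

@[fun_prop]
theorem primrec_gridSize {α : Type*} [Primcodable α] {f : α → ℕ} (hf : Primrec f) :
    Primrec (fun a => gridSize (f a)) := by
  unfold gridSize; fun_prop

/-- The point with number `x` of the square which contains the grid. -/
noncomputable def gridPoint (N x : ℕ) : ℂ :=
  ⟨((x / gridSize N : ℕ) : ℝ) / N - N, ((x % gridSize N : ℕ) : ℝ) / N - N⟩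

/-- The codes of the entries of `N B` (if `t = 0`) or `N C` (otherwise), where `B` and `C` are the
sections of `A - z` and `(A - z)*`, at the point `z` with number `x`. -/
def sectionCode (code : ℕ → ℕ → ℕ × ℕ) (N x t r i : ℕ) : ℕ × ℕ :=
  if t = 0 then
    pairSub (pairMul (codeConst N, codeConst 0) (code r i))
      (if r = i then (codeSub (codeConst (x / gridSize N)) (codeConst (N * N)),
        codeSub (codeConst (x % gridSize N)) (codeConst (N * N))) else (codeConst 0, codeConst 0))
  else
    pairConj (pairSub (pairMul (codeConst N, codeConst 0) (code i r))
      (if r = i then (codeSub (codeConst (x / gridSize N)) (codeConst (N * N)),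
        codeSub (codeConst (x % gridSize N)) (codeConst (N * N))) else (codeConst 0, codeConst 0)))

theorem primrec_sectionCode {code : ℕ → ℕ → ℕ × ℕ} (hcode : Primrec₂ code) {α : Type*}
    [Primcodable α] {N x t r i : α → ℕ} (hN : Primrec N) (hx : Primrec x) (ht : Primrec t)
    (hr : Primrec r) (hi : Primrec i) :
    Primrec (fun a => sectionCode code (N a) (x a) (t a) (r a) (i a)) := by
  have h1 := hcode.comp hr hi
  have h2 := hcode.comp hi hr
  unfold sectionCode
  refine Primrec.ite (by fun_prop) ?_ (primrec_pairConj ?_)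
  · exact primrec_pairSub (primrec_pairMul (by fun_prop) h1) (by fun_prop)
  · exact primrec_pairSub (primrec_pairMul (by fun_prop) h2) (by fun_prop)

/-- The codes of the entries of the matrices which have to be positive definite. -/
def gramCode (code : ℕ → ℕ → ℕ × ℕ) (N m x l t i j : ℕ) : ℕ × ℕ :=
  pairSub (Nat.rec (motive := fun _ => ℕ × ℕ) (codeConst 0, codeConst 0)
    (fun r acc => pairAdd acc (pairMul (pairConj (sectionCode code N x t r i))
      (sectionCode code N x t r j))) m)
    (if i = j then (codeConst (l * l), codeConst 0) else (codeConst 0, codeConst 0))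

theorem primrec_gramCode {code : ℕ → ℕ → ℕ × ℕ} (hcode : Primrec₂ code) {α : Type*}
    [Primcodable α] {N m x l t i j : α → ℕ} (hN : Primrec N) (hm : Primrec m) (hx : Primrec x)
    (hl : Primrec l) (ht : Primrec t) (hi : Primrec i) (hj : Primrec j) :
    Primrec (fun a => gramCode code (N a) (m a) (x a) (l a) (t a) (i a) (j a)) := by
  unfold gramCode
  have h1 : Primrec fun y : α × ℕ × ℕ × ℕ => sectionCode code (N y.1) (x y.1) (t y.1) y.2.1 (i y.1) :=
    primrec_sectionCode hcode (by fun_prop) (by fun_prop) (by fun_prop) (by fun_prop) (by fun_prop)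
  have h2 : Primrec fun y : α × ℕ × ℕ × ℕ => sectionCode code (N y.1) (x y.1) (t y.1) y.2.1 (j y.1) :=
    primrec_sectionCode hcode (by fun_prop) (by fun_prop) (by fun_prop) (by fun_prop) (by fun_prop)
  exact primrec_pairSub (Primrec.nat_rec' (h := fun a y => pairAdd y.2
      (pairMul (pairConj (sectionCode code (N a) (x a) (t a) y.1 (i a)))
        (sectionCode code (N a) (x a) (t a) y.1 (j a)))) hm (by fun_prop)
    (primrec_pairAdd (by fun_prop) (primrec_pairMul (primrec_pairConj h1) h2))) (by fun_prop)

/-- The codes of the entries after `k` steps of the elimination. -/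
def elimCodes (code : ℕ → ℕ → ℕ × ℕ) (N m x l t k : ℕ) : List (ℕ × ℕ) :=
  Nat.rec (motive := fun _ => List (ℕ × ℕ))
    ((List.range (N * N)).map fun s => gramCode code N m x l t (s / N) (s % N))
    (fun _ tbl => (List.range (N * N)).map fun s =>
      pairSub (pairMul (tbl.getD 0 (0, 0)) (tbl.getD ((s / N + 1) * N + (s % N + 1)) (0, 0)))
        (pairMul (tbl.getD ((s / N + 1) * N) (0, 0)) (tbl.getD (s % N + 1) (0, 0)))) k

theorem primrec_elimCodes {code : ℕ → ℕ → ℕ × ℕ} (hcode : Primrec₂ code) {α : Type*}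
    [Primcodable α] {N m x l t k : α → ℕ} (hN : Primrec N) (hm : Primrec m) (hx : Primrec x)
    (hl : Primrec l) (ht : Primrec t) (hk : Primrec k) :
    Primrec (fun a => elimCodes code (N a) (m a) (x a) (l a) (t a) (k a)) := by
  unfold elimCodes
  have h1 : Primrec fun a => List.range (N a * N a) := Primrec.list_range.comp (by fun_prop)
  have h2 : Primrec fun y : α × ℕ => gramCode code (N y.1) (m y.1) (x y.1) (l y.1) (t y.1)
      (y.2 / N y.1) (y.2 % N y.1) :=
    primrec_gramCode hcode (by fun_prop) (by fun_prop) (by fun_prop) (by fun_prop)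
      (by fun_prop) (by fun_prop) (by fun_prop)
  have h3 : Primrec fun y : (α × ℕ × List (ℕ × ℕ)) × ℕ =>
      pairSub (pairMul (y.1.2.2.getD 0 (0, 0))
          (y.1.2.2.getD ((y.2 / N y.1.1 + 1) * N y.1.1 + (y.2 % N y.1.1 + 1)) (0, 0)))
        (pairMul (y.1.2.2.getD ((y.2 / N y.1.1 + 1) * N y.1.1) (0, 0))
          (y.1.2.2.getD (y.2 % N y.1.1 + 1) (0, 0))) := by fun_prop
  exact Primrec.nat_rec' (h := fun a (z : ℕ × List (ℕ × ℕ)) => (List.range (N a * N a)).map fun s =>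
      pairSub (pairMul (z.2.getD 0 (0, 0)) (z.2.getD ((s / N a + 1) * N a + (s % N a + 1)) (0, 0)))
        (pairMul (z.2.getD ((s / N a + 1) * N a) (0, 0)) (z.2.getD (s % N a + 1) (0, 0))))
    hk (Primrec.list_map h1 h2) (Primrec.list_map (h1.comp Primrec.fst) h3)

section Values

variable {O : ℕ → ℂ} {code : ℕ → ℕ → ℕ × ℕ} {a : ℕ → ℕ → ℂ}

/-- The values of the codes `gramCode`. -/
theorem evalPair_gramCode (N m x l t i j : ℕ) :
    evalPair O (gramCode code N m x l t i j) =
      gramForm m (fun r i => evalPair O (sectionCode code N x t r i)) ((l : ℝ) ^ 2 : ℝ) i j := by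
  unfold gramCode gramForm
  rw [evalPair_sub]
  congr 1
  · induction m with
    | zero => simp
    | succ m ih => rw [Finset.sum_range_succ, ← ih]; simp
  · split_ifs
    · rw [evalPair_const]; push_cast; ring
    · rw [evalPair_const]; push_cast; ring

/-- Each step reads one row and one column further, so the part of the finite table that is valid
shrinks by one. The corner entry is still valid for all `k < N`, and only this entry is needed. -/
theorem evalPair_elimCodes {N m x l t k i j : ℕ} (hi : i + k < N) (hj : j + k < N) :
    evalPair O ((elimCodes code N m x l t k).getD (i * N + j) (0, 0)) =
      schurStep^[k] (gramForm m (fun r i => evalPair O (sectionCode code N x t r i))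
        ((l : ℝ) ^ 2 : ℝ)) i j := by
  have hlt : ∀ i j, i < N → j < N →
      i * N + j < N * N ∧ (i * N + j) / N = i ∧ (i * N + j) % N = j := by
    intro i j hi hj
    have hN : 0 < N := by omega
    refine ⟨?_, ?_, ?_⟩
    · calc i * N + j < i * N + N := by omega
        _ = (i + 1) * N := by ring
        _ ≤ N * N := Nat.mul_le_mul_right _ hi
    · rw [mul_comm, Nat.mul_add_div hN, Nat.div_eq_of_lt hj, add_zero]
    · rw [mul_comm, Nat.mul_add_mod, Nat.mod_eq_of_lt hj]
  induction k generalizing i j with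
  | zero =>
    obtain ⟨h1, h2, h3⟩ := hlt i j hi hj
    rw [Function.iterate_zero, id, ← evalPair_gramCode]
    simp [elimCodes, List.getD_eq_getElem?_getD, List.getElem?_map, List.getElem?_range h1, h2, h3]
  | succ k ih =>
    obtain ⟨h1, h2, h3⟩ := hlt i j (by omega) (by omega)
    rw [Function.iterate_succ_apply', schurStep, ← ih (i := 0) (j := 0) (by omega) (by omega),
      ← ih (i := i + 1) (j := j + 1) (by omega) (by omega),
      ← ih (i := i + 1) (j := 0) (by omega) (by omega),
      ← ih (i := 0) (j := j + 1) (by omega) (by omega), ← evalPair_mul, ← evalPair_mul,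
      ← evalPair_sub]
    congr 1
    have h4 : elimCodes code N m x l t (k + 1) = (List.range (N * N)).map fun s =>
      pairSub (pairMul ((elimCodes code N m x l t k).getD 0 (0, 0))
        ((elimCodes code N m x l t k).getD ((s / N + 1) * N + (s % N + 1)) (0, 0)))
        (pairMul ((elimCodes code N m x l t k).getD ((s / N + 1) * N) (0, 0))
          ((elimCodes code N m x l t k).getD (s % N + 1) (0, 0))) := rfl
    rw [h4, List.getD_eq_getElem?_getD, List.getElem?_map, List.getElem?_range h1]
    simp [h2, h3]

theorem evalPair_gridPoint {N : ℕ} (hN : 1 ≤ N) (x : ℕ) :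
    evalPair O (codeSub (codeConst (x / gridSize N)) (codeConst (N * N)),
      codeSub (codeConst (x % gridSize N)) (codeConst (N * N))) = N * gridPoint N x := by
  have hN' : (N : ℝ) ≠ 0 := by positivity
  apply Complex.ext
  · simp only [evalPair, gridPoint, evalCode_sub, evalCode_const, Complex.mul_re,
      Complex.natCast_re, Complex.natCast_im]
    push_cast
    field_simp
    ring
  · simp only [evalPair, gridPoint, evalCode_sub, evalCode_const, Complex.mul_im,
      Complex.natCast_re, Complex.natCast_im]
    push_cast
    field_simp
    ring

theorem evalPair_sectionCode_zero (hcode : ∀ i j, evalPair O (code i j) = a i j) {N : ℕ}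
    (hN : 1 ≤ N) (x : ℕ) {m : ℕ} (i : Fin m) (j : Fin N) :
    evalPair O (sectionCode code N x 0 i j) = N * rectSection a m N (gridPoint N x) i j := by
  have h0 : evalPair O (codeConst 0, codeConst 0) = 0 := by simp
  simp only [sectionCode, rectSection, Matrix.of_apply, if_true, evalPair_sub, evalPair_mul,
    evalPair_const, hcode]
  rw [mul_sub]
  congr 1
  split_ifs
  · exact evalPair_gridPoint hN x
  · rw [h0, mul_zero]

theorem evalPair_sectionCode_one (hcode : ∀ i j, evalPair O (code i j) = a i j) {N : ℕ}
    (hN : 1 ≤ N) (x : ℕ) {m : ℕ} (i : Fin m) (j : Fin N) :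
    evalPair O (sectionCode code N x 1 i j) =
      N * rectSection (fun i j => star (a j i)) m N (star (gridPoint N x)) i j := by
  have h0 : evalPair O (codeConst 0, codeConst 0) = 0 := by simp
  simp only [sectionCode, rectSection, Matrix.of_apply, one_ne_zero, if_false, evalPair_conj,
    evalPair_sub, evalPair_mul, evalPair_const, hcode]
  rw [mul_sub, star_sub, star_mul', star_natCast]
  congr 1
  split_ifs
  · rw [evalPair_gridPoint hN x, star_mul', star_natCast]
  · rw [h0, mul_zero, star_zero]

/-- The stopping condition in the definition of `distSpec` in terms of signs of codes. -/
theorem mem_stopSet_iff_codes (hcode : ∀ i j, evalPair O (code i j) = a i j) {N : ℕ}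
    (hN : 1 ≤ N) (m x l : ℕ) :
    l ∈ stopSet a N m (gridPoint N x) ↔ 1 ≤ l ∧
      ¬ ∀ t < 2, ∀ k < N, 0 < evalCode O ((elimCodes code N m x l t k).getD 0 (0, 0)).1 := by
  have key : ∀ t k, k < N →
      evalCode O ((elimCodes code N m x l t k).getD 0 (0, 0)).1 =
        (schurStep^[k] (gramForm m (fun r i => evalPair O (sectionCode code N x t r i))
          ((l : ℝ) ^ 2 : ℝ)) 0 0).re := by
    intro t k hk
    rw [← evalPair_elimCodes (by omega) (by omega), zero_mul, zero_add]
    rfl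
  have h2 : ∀ t, (∀ k < N, 0 < evalCode O ((elimCodes code N m x l t k).getD 0 (0, 0)).1) ↔
      ∀ k < N, 0 < (schurStep^[k] (gramForm m (fun r i => evalPair O (sectionCode code N x t r i))
          ((l : ℝ) ^ 2 : ℝ)) 0 0).re := fun t =>
    forall_congr' fun k => forall_congr' fun hk => by rw [key t k hk]
  have h3 : ∀ p : ℕ → Prop, (∀ t < 2, p t) ↔ p 0 ∧ p 1 := fun p =>
    ⟨fun h => ⟨h 0 (by omega), h 1 (by omega)⟩, fun h t ht => by interval_cases t <;> simp [h]⟩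
  rw [h3, h2, h2, ← posDef_iff_pivots hN _ _ (evalPair_sectionCode_zero hcode hN x),
    ← posDef_iff_pivots hN _ _ (evalPair_sectionCode_one hcode hN x)]
  rfl

end Values

/-! ## The value of `distSpec` is computed from signs of codes -/

open Classical in
/-- The number `l` such that `distSpec` has the value `l / N`. -/
noncomputable def level (a : ℕ → ℕ → ℂ) (m N x : ℕ) : ℕ :=
  if N = 0 then 0 else sInf (stopSet a N m (gridPoint N x))

theorem level_div (a : ℕ → ℕ → ℂ) (m N x : ℕ) :
    (level a m N x : ℝ) / N = distSpec a N m (gridPoint N x) := by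
  rw [distSpec_eq]
  unfold level
  split_ifs with h
  · simp [h]
  · rfl

/-- An unbounded search for the least `l` satisfying the stopping condition, which ends because such
`l` exist. The alternative that the section size is `0` makes the search stop at `0`, the default
value. -/
theorem oracleComputable_level {X : Type*} {𝒪 : X → ℕ → ℂ} {a : X → ℕ → ℕ → ℂ}
    {code : ℕ → ℕ → ℕ × ℕ} (hcode : Primrec₂ code)
    (hval : ∀ A i j, evalPair (𝒪 A) (code i j) = a A i j) {rows : X → ℕ → ℕ}
    (hrows : OracleComputable 𝒪 rows)
    (hne : ∀ A n z, 1 ≤ n → (stopSet (a A) n (rows A n) z).Nonempty) :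
    OracleComputable 𝒪 fun A (y : ℕ × ℕ) => level (a A) (rows A y.1) y.1 y.2 := by
  have h1 : OracleDecidable 𝒪 fun A (y : ((ℕ × ℕ × ℕ × ℕ) × ℕ) × ℕ) => 0 < evalCode (𝒪 A)
      ((elimCodes code y.1.1.1 y.1.1.2.1 y.1.1.2.2.1 y.1.1.2.2.2 y.1.2 y.2).getD 0 (0, 0)).1 :=
    .pos (primrec_fst (primrec_getD _ (primrec_elimCodes hcode (by fun_prop) (by fun_prop)
      (by fun_prop) (by fun_prop) (by fun_prop) (by fun_prop)) (by fun_prop)))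
  have h2 := (h1.forall_lt (f := fun _ y => y.1.1) (.of_primrec (by fun_prop))).forall_lt
    (f := fun _ _ => 2) (.of_primrec (by fun_prop))
  have h3 : OracleDecidable 𝒪 fun A (y : (ℕ × ℕ) × ℕ) => y.1.1 = 0 ∨ (1 ≤ y.2 ∧
      ¬ ∀ t < 2, ∀ k < y.1.1, 0 < evalCode (𝒪 A)
        ((elimCodes code y.1.1 (rows A y.1.1) y.1.2 y.2 t k).getD 0 (0, 0)).1) := by
    refine .or (.of_primrec (by fun_prop)) (.and (.of_primrec (by fun_prop)) (.not ?_))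
    have h4 : OracleComputable 𝒪 fun A (y : (ℕ × ℕ) × ℕ) => (y.1.1, rows A y.1.1, y.1.2, y.2) :=
      .pair (.of_primrec (by fun_prop)) (.pair (hrows.comp_primrec (by fun_prop))
        (.of_primrec (by fun_prop)))
    exact h2.comp h4
  refine h3.find (fun A y => ?_) fun A y k hk => ?_
  · by_cases h0 : y.1 = 0
    · exact Or.inl h0
    · right
      have h5 := Nat.sInf_mem (hne A y.1 (gridPoint y.1 y.2) (by omega))
      rw [mem_stopSet_iff_codes (hval A) (by omega)] at h5
      simpa only [level, if_neg h0] using h5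
  · unfold level at hk
    split_ifs at hk with h0
    · exact absurd hk (by omega)
    · have h5 := Nat.notMem_of_lt_sInf hk
      rw [mem_stopSet_iff_codes (hval A) (by omega)] at h5
      rintro (h | h)
      · exact h0 h
      · exact h5 h

/-! ## The numbering of the grid -/

/-- The square of the distance of two points of the grid, multiplied by `N ^ 2`. -/
def gridDistSq (N x y : ℕ) : ℕ :=
  ((x / gridSize N - y / gridSize N) + (y / gridSize N - x / gridSize N)) ^ 2 +
    ((x % gridSize N - y % gridSize N) + (y % gridSize N - x % gridSize N)) ^ 2

/-- The number of the origin. -/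
def gridOrigin (N : ℕ) : ℕ := N * N * gridSize N + N * N

/-- The square of the absolute value of a point of the grid, multiplied by `N ^ 2`. -/
def gridNormSq (N x : ℕ) : ℕ := gridDistSq N (gridOrigin N) x

@[fun_prop]
theorem primrec_gridDistSq {α : Type*} [Primcodable α] {f g h : α → ℕ} (hf : Primrec f)
    (hg : Primrec g) (hh : Primrec h) : Primrec (fun a => gridDistSq (f a) (g a) (h a)) := by
  unfold gridDistSq; fun_prop

@[fun_prop]
theorem primrec_gridNormSq {α : Type*} [Primcodable α] {f g : α → ℕ} (hf : Primrec f)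
    (hg : Primrec g) : Primrec (fun a => gridNormSq (f a) (g a)) := by
  unfold gridNormSq gridOrigin; fun_prop

theorem gridSize_pos (N : ℕ) : 0 < gridSize N := Nat.succ_pos _

theorem gridPoint_mul_add (N p : ℕ) {q : ℕ} (hq : q < gridSize N) :
    gridPoint N (p * gridSize N + q) = ⟨(p : ℝ) / N - N, (q : ℝ) / N - N⟩ := by
  unfold gridPoint
  rw [mul_comm, Nat.mul_add_div (gridSize_pos N), Nat.div_eq_of_lt hq, add_zero, Nat.mul_add_mod,
    Nat.mod_eq_of_lt hq]

theorem gridPoint_origin (N : ℕ) : gridPoint N (gridOrigin N) = 0 := by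
  rw [gridOrigin, gridPoint_mul_add _ _ (by unfold gridSize; omega)]
  by_cases hN : (N : ℝ) = 0
  · apply Complex.ext <;> simp [hN]
  · apply Complex.ext <;> simp [hN]

theorem sq_mul_dist_gridPoint_sq {N : ℕ} (hN : 1 ≤ N) (x y : ℕ) :
    (N * dist (gridPoint N x) (gridPoint N y)) ^ 2 = gridDistSq N x y := by
  have hN' : (N : ℝ) ≠ 0 := by positivity
  -- With truncated subtraction one of the two differences is `0`, so their sum is `|p - q|`.
  have key : ∀ p q : ℕ, (((p - q) + (q - p) : ℕ) : ℝ) ^ 2 = ((p : ℝ) - q) ^ 2 := by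
    intro p q
    rcases le_total p q with h | h
    · rw [Nat.sub_eq_zero_of_le h, zero_add, Nat.cast_sub h]; ring
    · rw [Nat.sub_eq_zero_of_le h, add_zero, Nat.cast_sub h]
  rw [Complex.dist_eq, mul_pow, ← Complex.normSq_eq_norm_sq, Complex.normSq_apply, gridDistSq]
  push_cast only [Nat.cast_add, Nat.cast_pow]
  rw [← Nat.cast_add, ← Nat.cast_add, key, key]
  simp only [gridPoint, Complex.sub_re, Complex.sub_im]
  field_simp
  ring

theorem dist_gridPoint_le_iff {N : ℕ} (hN : 1 ≤ N) (x y k : ℕ) :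
    dist (gridPoint N x) (gridPoint N y) ≤ k / N ↔ gridDistSq N x y ≤ k * k := by
  have hN' : (0 : ℝ) < N := by exact_mod_cast hN
  rw [le_div_iff₀' hN', ← pow_le_pow_iff_left₀ (by positivity) (by positivity) two_ne_zero,
    sq_mul_dist_gridPoint_sq hN, sq]
  exact_mod_cast Iff.rfl

theorem sq_mul_norm_gridPoint_sq {N : ℕ} (hN : 1 ≤ N) (x : ℕ) :
    (N * ‖gridPoint N x‖) ^ 2 = gridNormSq N x := by
  rw [gridNormSq, ← sq_mul_dist_gridPoint_sq hN, gridPoint_origin, dist_zero_left]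

theorem norm_gridPoint_le_iff {N : ℕ} (hN : 1 ≤ N) (x k : ℕ) :
    ‖gridPoint N x‖ ≤ k ↔ gridNormSq N x ≤ (N * k) * (N * k) := by
  have hN' : (0 : ℝ) < N := by exact_mod_cast hN
  rw [← mul_le_mul_iff_right₀ hN', ← pow_le_pow_iff_left₀ (by positivity) (by positivity) two_ne_zero,
    sq_mul_norm_gridPoint_sq hN, sq]
  exact_mod_cast Iff.rfl

/-- The point with number `x` belongs to the grid. -/
def OnGrid (N x : ℕ) : Prop := gridNormSq N x ≤ (N * N) * (N * N)

@[fun_prop]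
theorem primrecPred_onGrid {α : Type*} [Primcodable α] {f g : α → ℕ} (hf : Primrec f)
    (hg : Primrec g) : PrimrecPred (fun a => OnGrid (f a) (g a)) := by
  unfold OnGrid; fun_prop

/-- The integer coordinates of a grid point lie in `[-N², N²]`; shifting them by `N²` gives the two
digits of its number in base `gridSize N`. -/
theorem exists_gridPoint_eq {N : ℕ} (hN : 1 ≤ N) {z : ℂ} (hz : z ∈ grid N) :
    ∃ x < gridSize N * gridSize N, gridPoint N x = z := by
  have hN' : (0 : ℝ) < N := by exact_mod_cast hN
  obtain ⟨h, p, q, rfl⟩ := hz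
  have hre : (((p : ℂ) + q * Complex.I) / N).re = p / N := by
    rw [Complex.div_natCast_re]; simp
  have him : (((p : ℂ) + q * Complex.I) / N).im = q / N := by
    rw [Complex.div_natCast_im]; simp
  have h1 := (Complex.abs_re_le_norm _).trans h
  have h2 := (Complex.abs_im_le_norm _).trans h
  rw [hre, abs_div, abs_of_pos hN', div_le_iff₀ hN'] at h1
  rw [him, abs_div, abs_of_pos hN', div_le_iff₀ hN'] at h2
  have h1' : |p| ≤ ((N * N : ℕ) : ℤ) := by exact_mod_cast h1
  have h2' : |q| ≤ ((N * N : ℕ) : ℤ) := by exact_mod_cast h2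
  rw [abs_le] at h1' h2'
  obtain ⟨p', hp'⟩ := Int.eq_ofNat_of_zero_le (show 0 ≤ p + ((N * N : ℕ) : ℤ) by linarith)
  obtain ⟨q', hq'⟩ := Int.eq_ofNat_of_zero_le (show 0 ≤ q + ((N * N : ℕ) : ℤ) by linarith)
  have hp : p' < gridSize N := by unfold gridSize; omega
  have hq : q' < gridSize N := by unfold gridSize; omega
  refine ⟨p' * gridSize N + q', ?_, ?_⟩
  · calc p' * gridSize N + q' < p' * gridSize N + gridSize N := by omega
      _ = (p' + 1) * gridSize N := by ring
      _ ≤ gridSize N * gridSize N := Nat.mul_le_mul_right _ hp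
  · rw [gridPoint_mul_add _ _ hq]
    have e1 : (p' : ℝ) = p + N * N := by exact_mod_cast hp'.symm
    have e2 : (q' : ℝ) = q + N * N := by exact_mod_cast hq'.symm
    apply Complex.ext
    · rw [hre, e1]; field_simp; ring
    · rw [him, e2]; field_simp; ring

theorem gridPoint_mem_grid_iff {N : ℕ} (hN : 1 ≤ N) (x : ℕ) :
    gridPoint N x ∈ grid N ↔ OnGrid N x := by
  have hN' : (N : ℝ) ≠ 0 := by positivity
  rw [OnGrid, ← norm_gridPoint_le_iff hN]
  refine ⟨fun h => h.1, fun h => ⟨h, (x / gridSize N : ℕ) - (N * N : ℕ),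
    (x % gridSize N : ℕ) - (N * N : ℕ), ?_⟩⟩
  unfold gridPoint
  generalize x / gridSize N = p
  generalize x % gridSize N = q
  apply Complex.ext
  · rw [Complex.div_natCast_re]
    simp
    field_simp
  · rw [Complex.div_natCast_im]
    simp
    field_simp

/-- Quantification over the grid. -/
theorem exists_mem_grid_iff {N : ℕ} (hN : 1 ≤ N) (p : ℂ → Prop) :
    (∃ z ∈ grid N, p z) ↔ ∃ x < gridSize N * gridSize N, OnGrid N x ∧ p (gridPoint N x) := by
  constructor
  · rintro ⟨z, hz, h⟩
    obtain ⟨x, hx, rfl⟩ := exists_gridPoint_eq hN hz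
    exact ⟨x, hx, (gridPoint_mem_grid_iff hN x).1 hz, h⟩
  · rintro ⟨x, -, h, h'⟩
    exact ⟨_, (gridPoint_mem_grid_iff hN x).2 h, h'⟩

/-! ## Output of lists of points -/

/-- The coordinates of the points with numbers in `ys`. -/
def gridCoords (N : ℕ) (ys : List ℕ) : List ℕ :=
  (List.range (2 * ys.length)).map fun i =>
    if i % 2 = 0 then ys.getD (i / 2) 0 / gridSize N else ys.getD (i / 2) 0 % gridSize N

theorem primrec_gridCoords : Primrec₂ gridCoords := by
  unfold gridCoords
  have h : Primrec fun y : (ℕ × List ℕ) × ℕ => if y.2 % 2 = 0 then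
    y.1.2.getD (y.2 / 2) 0 / gridSize y.1.1 else y.1.2.getD (y.2 / 2) 0 % gridSize y.1.1 := by
    fun_prop
  exact Primrec.list_map (Primrec.list_range.comp (by fun_prop)) h

theorem mem_outPoints_gridCoords (N : ℕ) (ys : List ℕ) (z : ℂ) :
    z ∈ outPoints N (gridCoords N ys) ↔ ∃ y ∈ ys, gridPoint N y = z := by
  have hlen : (gridCoords N ys).length / 2 = ys.length := by simp [gridCoords]
  have h1 : ∀ i < ys.length, (gridCoords N ys).getD (2 * i) 0 = ys.getD i 0 / gridSize N := by
    intro i hi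
    rw [gridCoords, List.getD_eq_getElem?_getD, List.getElem?_map, List.getElem?_range (by omega)]
    simp
  have h2 : ∀ i < ys.length, (gridCoords N ys).getD (2 * i + 1) 0 = ys.getD i 0 % gridSize N := by
    intro i hi
    rw [gridCoords, List.getD_eq_getElem?_getD, List.getElem?_map, List.getElem?_range (by omega)]
    have e1 : (2 * i + 1) % 2 = 1 := by omega
    have e2 : (2 * i + 1) / 2 = i := by omega
    simp [e1, e2]
  unfold outPoints
  rw [List.mem_ofFn', Set.mem_range]
  constructor
  · rintro ⟨i, rfl⟩
    have hi : (i : ℕ) < ys.length := hlen ▸ i.2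
    refine ⟨ys.getD i 0, ?_, ?_⟩
    · rw [List.getD_eq_getElem _ _ hi]
      exact List.getElem_mem _
    · rw [h1 _ hi, h2 _ hi]
      rfl
  · rintro ⟨y, hy, rfl⟩
    obtain ⟨i, hi, rfl⟩ := List.getElem_of_mem hy
    refine ⟨⟨i, hlen ▸ hi⟩, ?_⟩
    simp only
    rw [h1 _ hi, h2 _ hi, List.getD_eq_getElem _ _ hi]
    rfl

section Output

variable {X : Type*} {𝒪 : X → ℕ → ℂ}

open Classical in
/-- The numbers of the points which satisfy a predicate. -/
noncomputable def outNumbers (p : X → ℕ × ℕ → Prop) (A : X) (N : ℕ) : List ℕ :=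
  (List.range (gridSize N * gridSize N)).filter fun x => p A (N, x)

theorem oracleComputable_output {p : X → ℕ × ℕ → Prop} (hp : OracleDecidable 𝒪 p) {G : X → ℕ → ℕ}
    (hG : OracleComputable 𝒪 G) :
    OracleComputable 𝒪 fun A n => (G A n, gridCoords (G A n) (outNumbers p A (G A n))) := by
  refine hG.pair (OracleComputable.comp (F := fun A N => gridCoords N (outNumbers p A N)) ?_ hG)
  have h1 : OracleComputable 𝒪 fun A N => outNumbers p A N := hp.filter (.of_primrec (by fun_prop))
  exact OracleComputable.map primrec_gridCoords
    (OracleComputable.pair (.of_primrec Primrec.id) h1)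

theorem setOf_mem_output {p : X → ℕ × ℕ → Prop} {R : Set ℂ} {A : X} {N : ℕ} (hN : 1 ≤ N)
    (hR : R ⊆ grid N) (hp : ∀ x, p A (N, x) ↔ gridPoint N x ∈ R) :
    R = {z | z ∈ outPoints N (gridCoords N (outNumbers p A N))} := by
  ext z
  rw [Set.mem_ofPred_eq, mem_outPoints_gridCoords]
  simp only [outNumbers, List.mem_filter, List.mem_range, decide_eq_true_eq, hp]
  constructor
  · intro hz
    obtain ⟨x, hx, rfl⟩ := exists_gridPoint_eq hN (hR hz)
    exact ⟨x, ⟨hx, hz⟩, rfl⟩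
  · rintro ⟨y, ⟨-, h⟩, rfl⟩
    exact h

end Output

/-! ## The routine for pseudospectra -/

theorem dAW_self (C : Set ℂ) : dAW C C = 0 := by simp [dAW]

section Pseudospectrum

variable {P : Problem.{u}} {lv : P.Dom → ℕ × ℕ → ℕ} {φ : P.Dom → ℕ → ℂ → ℝ} {S : P.Dom → Set ℂ}
  {γ : P.Dom → ℂ → ℝ} {c : P.Dom → ℕ → ℝ} {ccode : ℕ → ℕ}

theorem oracleDecidable_sublevel (hlv : OracleComputable P.oracle lv) (hcc : Primrec ccode)
    (εcode : ℕ) :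
    OracleDecidable P.oracle fun A (y : ℕ × ℕ) => OnGrid y.1 y.2 ∧ 0 < evalCode (P.oracle A)
      (codeSub εcode (codeAdd (codeDiv (codeConst (lv A y)) (codeConst y.1)) (ccode y.1))) := by
  refine .and (.of_primrec (by fun_prop)) ?_
  have h1 : OracleDecidable P.oracle fun A (y : ℕ × ℕ) => 0 < evalCode (P.oracle A)
      (codeSub εcode (codeAdd (codeDiv (codeConst y.2) (codeConst y.1)) (ccode y.1))) :=
    .pos (by fun_prop)
  have h2 : OracleComputable P.oracle fun A (y : ℕ × ℕ) => (y.1, lv A y) :=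
    .pair (.of_primrec (by fun_prop)) hlv
  have h3 := OracleDecidable.comp h1 h2
  exact h3

/-- If the values of `F` on the grid are computed from signs of codes, then the outputs
`sublevelGrid` can be chosen adaptively by a machine. -/
theorem realises_sublevelGrid (k₀ : P.Idx) (hlv : OracleComputable P.oracle lv)
    (hφ : ∀ A N x, (lv A (N, x) : ℝ) / N = φ A N (gridPoint N x))
    (happ : ∀ A, IsApprox (S A) (γ A) (φ A) (c A)) {ε : ℝ} (hε : 0 < ε)
    (hsol : ∀ A, (P.sol A).1 = closure {z | γ A z < ε}) (hcc : Primrec ccode)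
    (hc : ∀ A N, evalCode (P.oracle A) (ccode N) = c A N) {εcode : ℕ}
    (hεc : ∀ A, evalCode (P.oracle A) εcode = ε) :
    Realises P fun n A => sublevelGrid n (φ A n) (c A n) ε := by
  classical
  set p : P.Dom → ℕ × ℕ → Prop := fun A y => OnGrid y.1 y.2 ∧ 0 < evalCode (P.oracle A)
    (codeSub εcode (codeAdd (codeDiv (codeConst (lv A y)) (codeConst y.1)) (ccode y.1))) with hpdef
  have hp : OracleDecidable P.oracle p := oracleDecidable_sublevel hlv hcc εcode
  have hmem : ∀ A N x, 1 ≤ N →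
      (p A (N, x) ↔ gridPoint N x ∈ sublevelGrid N (φ A N) (c A N) ε) := by
    intro A N x hN
    simp only [hpdef, evalCode_sub, evalCode_add, evalCode_div, evalCode_const, hφ, hc, hεc, sub_pos]
    rw [← gridPoint_mem_grid_iff hN]
    rfl
  have hsub : ∀ A N, sublevelGrid N (φ A N) (c A N) ε ⊆ grid N := fun A N z hz => hz.1
  have hne : ∀ A N, 1 ≤ N → ((∃ x < gridSize N * gridSize N, p A (N, x)) ↔
      (sublevelGrid N (φ A N) (c A N) ε).Nonempty) := by
    intro A N hN
    constructor
    · rintro ⟨x, -, h⟩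
      exact ⟨_, (hmem A N x hN).1 h⟩
    · rintro ⟨z, hz⟩
      obtain ⟨x, hx, rfl⟩ := exists_gridPoint_eq hN (hsub A N hz)
      exact ⟨x, hx, (hmem A N x hN).2 hz⟩
  have htend := fun A => (happ A).tendsto_sublevelGrid hε
  have hex : ∀ A n, ∃ N, n < N ∧ ∃ x < gridSize N * gridSize N, p A (N, x) := by
    intro A n
    obtain ⟨N, h1, h2⟩ := ((htend A).1.and (eventually_gt_atTop n)).exists
    exact ⟨N, h2, (hne A N (by omega)).2 h1⟩
  have hG : OracleComputable P.oracle fun A n => Nat.find (hex A n) := by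
    have h1 : OracleDecidable P.oracle fun A (y : ℕ × ℕ) =>
        y.1 < y.2 ∧ ∃ x < gridSize y.2 * gridSize y.2, p A (y.2, x) :=
      .and (.of_primrec (by fun_prop))
        ((hp.comp_primrec (f := fun y : (ℕ × ℕ) × ℕ => (y.1.2, y.2)) (by fun_prop)).exists_lt
          (.of_primrec (by fun_prop)))
    exact h1.find (fun A n => Nat.find_spec (hex A n)) fun A n k hk => Nat.find_min (hex A n) hk
  refine realises_of_oracleComputable P _ k₀ (oracleComputable_output hp hG)
    (fun A => ⟨fun n hn => (grid_finite hn).subset (hsub A n), (htend A).1, ?_⟩) fun n A => ?_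
  · rw [hsol A]
    exact (htend A).2
  · obtain ⟨h1, h2⟩ := Nat.find_spec (hex A n)
    have hN : 1 ≤ Nat.find (hex A n) := by omega
    -- The enclosing set is the exact solution, with error `0`.
    refine ⟨h1, setOf_mem_output hN (hsub A _) fun x => hmem A _ x hN, (hne A _ hN).1 h2,
      P.sol A, ?_, ?_⟩
    · rw [hsol A]
      exact ((happ A).sublevelGrid_subset hN ε).trans subset_closure
    · rw [dAW_self]
      positivity

end Pseudospectrum

/-! ## The routine for spectra -/

section Spectrum

variable {P : Problem.{u}} {lv : P.Dom → ℕ × ℕ → ℕ} {φ : P.Dom → ℕ → ℂ → ℝ} {S : P.Dom → Set ℂ}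
  {γ : P.Dom → ℂ → ℝ} {c : P.Dom → ℕ → ℝ} {ccode : ℕ → ℕ} {g : ℕ → ℝ≥0 → ℝ≥0}
  {gcode : ℕ × ℕ × ℕ → ℕ}

open Classical in
/-- The number `k` such that `compInvg` at the point with number `y.2` has the value `k / y.1`. -/
noncomputable def radiusIndex (lv : ℕ × ℕ → ℕ) (g : ℕ → ℝ≥0 → ℝ≥0) (y : ℕ × ℕ) : ℕ :=
  if y.1 = 0 then 0 else
    sInf {k : ℕ | (lv y : ℝ) / y.1 < g ⌈‖gridPoint y.1 y.2‖⌉₊ ((k : ℝ≥0) / (y.1 : ℝ≥0))}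

theorem radiusIndex_div (lv : ℕ × ℕ → ℕ) (g : ℕ → ℝ≥0 → ℝ≥0) (N x : ℕ) :
    (radiusIndex lv g (N, x) : ℝ) / N =
      compInvg N (lv (N, x) / N) (g ⌈‖gridPoint N x‖⌉₊) := by
  unfold radiusIndex compInvg
  by_cases h : N = 0
  · simp [h]
  · simp [h]

/-- The ceiling is found by comparing integer squares, which avoids square roots. For `N = 0` the
point is `0`, by division by zero, and the search stops at once. -/
theorem oracleComputable_ceil :
    OracleComputable P.oracle fun _ (y : ℕ × ℕ) => ⌈‖gridPoint y.1 y.2‖⌉₊ := by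
  have h1 : OracleDecidable P.oracle fun _ (y : (ℕ × ℕ) × ℕ) => y.1.1 = 0 ∨
      gridNormSq y.1.1 y.1.2 ≤ (y.1.1 * y.2) * (y.1.1 * y.2) := .of_primrec (by fun_prop)
  refine h1.find (fun A y => ?_) fun A y k hk => ?_
  · by_cases h0 : y.1 = 0
    · exact Or.inl h0
    · exact Or.inr ((norm_gridPoint_le_iff (N := y.1) (by omega) _ _).1 (Nat.le_ceil _))
  · rw [Nat.lt_ceil] at hk
    rintro (h | h)
    · simp only at h
      have h2 : gridPoint y.1 y.2 = 0 := by
        rw [h]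
        apply Complex.ext <;> simp [gridPoint]
      rw [h2, norm_zero] at hk
      exact hk.not_ge (Nat.cast_nonneg _)
    · by_cases h0 : y.1 = 0
      · have h2 : gridPoint y.1 y.2 = 0 := by
          rw [h0]
          apply Complex.ext <;> simp [gridPoint]
        rw [h2, norm_zero] at hk
        exact hk.not_ge (Nat.cast_nonneg _)
      · exact hk.not_ge ((norm_gridPoint_le_iff (N := y.1) (by omega) _ _).2 h)

theorem oracleComputable_radiusIndex (hlv : OracleComputable P.oracle lv)
    (hg : IsResolventControl g) (hgc : Primrec gcode)
    (hgv : ∀ A m k N, 1 ≤ N → evalCode (P.oracle A) (gcode (m, k, N)) =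
      g m ((k : ℝ≥0) / (N : ℝ≥0))) :
    OracleComputable P.oracle fun A => radiusIndex (lv A) g := by
  have h1 : OracleDecidable P.oracle fun A (y : (ℕ × ℕ × ℕ) × ℕ) => y.1.1 = 0 ∨
      0 < evalCode (P.oracle A) (codeSub (gcode (y.1.2.2, y.2, y.1.1))
        (codeDiv (codeConst y.1.2.1) (codeConst y.1.1))) :=
    .or (.of_primrec (by fun_prop)) (.pos (by fun_prop))
  have h2 : OracleComputable P.oracle fun A (y : (ℕ × ℕ) × ℕ) =>
      ((y.1.1, lv A y.1, ⌈‖gridPoint y.1.1 y.1.2‖⌉₊), y.2) :=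
    .pair (.pair (.of_primrec (by fun_prop)) (.pair (hlv.comp_primrec (by fun_prop))
      (oracleComputable_ceil.comp_primrec (f := fun y : (ℕ × ℕ) × ℕ => y.1) (by fun_prop))))
        (.of_primrec (by fun_prop))
  have h3 := OracleDecidable.comp h1 h2
  have hset : ∀ A (y : ℕ × ℕ) (k : ℕ), y.1 ≠ 0 →
      (0 < evalCode (P.oracle A) (codeSub (gcode (⌈‖gridPoint y.1 y.2‖⌉₊, k, y.1))
        (codeDiv (codeConst (lv A y)) (codeConst y.1))) ↔
      (lv A y : ℝ) / y.1 < g ⌈‖gridPoint y.1 y.2‖⌉₊ ((k : ℝ≥0) / (y.1 : ℝ≥0))) := by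
    intro A y k h0
    rw [evalCode_sub, evalCode_div, evalCode_const, evalCode_const, hgv A _ _ _ (by omega), sub_pos]
  refine h3.find (fun A y => ?_) fun A y k hk => ?_
  · by_cases h0 : y.1 = 0
    · exact Or.inl h0
    · refine Or.inr ((hset A y _ h0).2 ?_)
      have hne : {k : ℕ | (lv A y : ℝ) / y.1 <
          g ⌈‖gridPoint y.1 y.2‖⌉₊ ((k : ℝ≥0) / (y.1 : ℝ≥0))}.Nonempty :=
        nonempty_lt_apply_div (hg _).2.2.2 (by omega) _
      unfold radiusIndex
      rw [if_neg h0]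
      exact Nat.sInf_mem hne
  · unfold radiusIndex at hk
    split_ifs at hk with h0
    · exact absurd hk (by omega)
    · rintro (h | h)
      · exact h0 h
      · exact Nat.notMem_of_lt_sInf hk ((hset A y k h0).1 h)

/-- The points of the output of `minimiserSet`, in terms of numbers of points. -/
def IsOutput (lv κ : ℕ × ℕ → ℕ) (y : ℕ × ℕ) : Prop :=
  OnGrid y.1 y.2 ∧ ∃ x < gridSize y.1 * gridSize y.1, OnGrid y.1 x ∧
    lv (y.1, x) * (gridNormSq y.1 x + y.1 * y.1) ≤ y.1 * y.1 * y.1 ∧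
    gridDistSq y.1 y.2 x ≤ κ (y.1, x) * κ (y.1, x) ∧
    ∀ x' < gridSize y.1 * gridSize y.1, OnGrid y.1 x' →
      gridDistSq y.1 x' x ≤ κ (y.1, x) * κ (y.1, x) → lv y ≤ lv (y.1, x')

theorem oracleDecidable_isOutput (hlv : OracleComputable P.oracle lv)
    {κ : P.Dom → ℕ × ℕ → ℕ} (hκ : OracleComputable P.oracle κ) :
    OracleDecidable P.oracle fun A => IsOutput (lv A) (κ A) := by
  unfold IsOutput
  refine .and (.of_primrec (by fun_prop)) (.exists_lt (p := fun A (y : (ℕ × ℕ) × ℕ) =>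
    OnGrid y.1.1 y.2 ∧ lv A (y.1.1, y.2) * (gridNormSq y.1.1 y.2 + y.1.1 * y.1.1) ≤
      y.1.1 * y.1.1 * y.1.1 ∧
    gridDistSq y.1.1 y.1.2 y.2 ≤ κ A (y.1.1, y.2) * κ A (y.1.1, y.2) ∧
    ∀ x' < gridSize y.1.1 * gridSize y.1.1, OnGrid y.1.1 x' →
      gridDistSq y.1.1 x' y.2 ≤ κ A (y.1.1, y.2) * κ A (y.1.1, y.2) → lv A y.1 ≤ lv A (y.1.1, x'))
    ?_ (.of_primrec (by fun_prop)))
  refine .and (.of_primrec (by fun_prop)) (.and ?_ (.and ?_ ?_))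
  · have h1 : OracleComputable P.oracle fun A (y : (ℕ × ℕ) × ℕ) => (y, lv A (y.1.1, y.2)) :=
      .pair (.of_primrec (by fun_prop)) (hlv.comp_primrec (f := fun y : (ℕ × ℕ) × ℕ =>
        (y.1.1, y.2)) (by fun_prop))
    exact h1.decidable (p := fun z : ((ℕ × ℕ) × ℕ) × ℕ =>
      z.2 * (gridNormSq z.1.1.1 z.1.2 + z.1.1.1 * z.1.1.1) ≤ z.1.1.1 * z.1.1.1 * z.1.1.1)
      (by fun_prop)
  · have h1 : OracleComputable P.oracle fun A (y : (ℕ × ℕ) × ℕ) => (y, κ A (y.1.1, y.2)) :=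
      .pair (.of_primrec (by fun_prop)) (hκ.comp_primrec (f := fun y : (ℕ × ℕ) × ℕ =>
        (y.1.1, y.2)) (by fun_prop))
    exact h1.decidable (p := fun z : ((ℕ × ℕ) × ℕ) × ℕ =>
      gridDistSq z.1.1.1 z.1.1.2 z.1.2 ≤ z.2 * z.2) (by fun_prop)
  · refine .forall_lt (p := fun A (y : ((ℕ × ℕ) × ℕ) × ℕ) => OnGrid y.1.1.1 y.2 →
      gridDistSq y.1.1.1 y.2 y.1.2 ≤ κ A (y.1.1.1, y.1.2) * κ A (y.1.1.1, y.1.2) →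
        lv A y.1.1 ≤ lv A (y.1.1.1, y.2)) ?_ (.of_primrec (by fun_prop))
    refine .imp (.of_primrec (by fun_prop)) (.imp ?_ ?_)
    · have h1 : OracleComputable P.oracle fun A (y : ((ℕ × ℕ) × ℕ) × ℕ) =>
          (y, κ A (y.1.1.1, y.1.2)) :=
        .pair (.of_primrec (by fun_prop)) (hκ.comp_primrec (f := fun y : ((ℕ × ℕ) × ℕ) × ℕ =>
          (y.1.1.1, y.1.2)) (by fun_prop))
      exact h1.decidable (p := fun z : (((ℕ × ℕ) × ℕ) × ℕ) × ℕ =>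
        gridDistSq z.1.1.1.1 z.1.2 z.1.1.2 ≤ z.2 * z.2) (by fun_prop)
    · have h1 : OracleComputable P.oracle fun A (y : ((ℕ × ℕ) × ℕ) × ℕ) =>
          (lv A y.1.1, lv A (y.1.1.1, y.2)) :=
        .pair (hlv.comp_primrec (by fun_prop)) (hlv.comp_primrec
          (f := fun y : ((ℕ × ℕ) × ℕ) × ℕ => (y.1.1.1, y.2)) (by fun_prop))
      exact h1.decidable (p := fun z : ℕ × ℕ => z.1 ≤ z.2) (by fun_prop)

/-- All values of `F`, radii and coordinates are multiples of `1/N`, so after clearing denominators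
every comparison in the routine is one between natural numbers. -/
theorem isOutput_iff {lv : ℕ × ℕ → ℕ} {φ : ℕ → ℂ → ℝ} {N : ℕ} (hN : 1 ≤ N)
    (hφ : ∀ N x, (lv (N, x) : ℝ) / N = φ N (gridPoint N x)) (w : ℕ) :
    IsOutput lv (radiusIndex lv g) (N, w) ↔ gridPoint N w ∈ minimiserSet N (φ N) g := by
  have hN' : (0 : ℝ) < N := by exact_mod_cast hN
  have hdist : ∀ x y, gridPoint N y ∈ Metric.closedBall (gridPoint N x)
      (compInvg N (φ N (gridPoint N x)) (g ⌈‖gridPoint N x‖⌉₊)) ↔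
      gridDistSq N y x ≤ radiusIndex lv g (N, x) * radiusIndex lv g (N, x) := fun x y => by
    rw [Metric.mem_closedBall, ← hφ, ← radiusIndex_div, dist_gridPoint_le_iff hN]
  have hthr : ∀ x, φ N (gridPoint N x) ≤ (‖gridPoint N x‖ ^ 2 + 1)⁻¹ ↔
      lv (N, x) * (gridNormSq N x + N * N) ≤ N * N * N := fun x => by
    have h1 : (gridNormSq N x : ℝ) + N * N = N ^ 2 * (‖gridPoint N x‖ ^ 2 + 1) := by
      rw [← sq_mul_norm_gridPoint_sq hN]; ring
    have h2 : lv (N, x) * (gridNormSq N x + N * N) ≤ N * N * N ↔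
        (lv (N, x) : ℝ) * (gridNormSq N x + N * N) ≤ N * N * N := by exact_mod_cast Iff.rfl
    rw [h2, h1, ← hφ, div_le_iff₀ hN', ← div_eq_inv_mul, le_div_iff₀ (by positivity),
      show (lv (N, x) : ℝ) * (N ^ 2 * (‖gridPoint N x‖ ^ 2 + 1)) =
        N ^ 2 * (lv (N, x) * (‖gridPoint N x‖ ^ 2 + 1)) by ring,
      show (N : ℝ) * N * N = N ^ 2 * N by ring, mul_le_mul_iff_right₀ (by positivity)]
  have hle : ∀ x y, φ N (gridPoint N x) ≤ φ N (gridPoint N y) ↔ lv (N, x) ≤ lv (N, y) :=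
    fun x y => by
    rw [← hφ, ← hφ, div_le_div_iff_of_pos_right hN', Nat.cast_le]
  unfold IsOutput minimiserSet
  rw [Set.mem_ofPred_eq, exists_mem_grid_iff hN]
  simp only [Set.mem_inter_iff]
  constructor
  · rintro ⟨h1, x, hx, hx', h2, h3, h4⟩
    refine ⟨x, hx, hx', (hthr x).2 h2, ⟨(hdist x w).2 h3, (gridPoint_mem_grid_iff hN w).2 h1⟩, ?_⟩
    rintro w' ⟨hw, hw'⟩
    obtain ⟨y, hy, rfl⟩ := exists_gridPoint_eq hN hw'
    exact (hle w y).2 (h4 y hy ((gridPoint_mem_grid_iff hN y).1 hw') ((hdist x y).1 hw))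
  · rintro ⟨x, hx, hx', h2, ⟨h3, h1⟩, h4⟩
    refine ⟨(gridPoint_mem_grid_iff hN w).1 h1, x, hx, hx', (hthr x).1 h2, (hdist x w).1 h3, ?_⟩
    intro y hy hy' h5
    exact (hle w y).1 (h4 _ ⟨(hdist x y).2 h5, (gridPoint_mem_grid_iff hN y).2 hy'⟩)

end Spectrum

section Spectrum

variable {P : Problem.{u}} {lv : P.Dom → ℕ × ℕ → ℕ} {φ : P.Dom → ℕ → ℂ → ℝ} {S : P.Dom → Set ℂ}
  {γ : P.Dom → ℂ → ℝ} {c : P.Dom → ℕ → ℝ} {ccode : ℕ → ℕ} {g : ℕ → ℝ≥0 → ℝ≥0}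
  {gcode : ℕ × ℕ × ℕ → ℕ}

/-- The error estimate at a point is at most `2⁻¹ ^ (n + 1)`. -/
def IsAccurate (O : ℕ → ℂ) (lv : ℕ × ℕ → ℕ) (gcode : ℕ × ℕ × ℕ → ℕ) (ccode : ℕ → ℕ)
    (y : ℕ × ℕ × ℕ) : Prop :=
  0 < evalCode O (codeSub (gcode (⌈‖gridPoint y.2.1 y.2.2‖⌉₊, y.2.1 / 2 ^ (y.1 + 1), y.2.1))
    (codeAdd (codeDiv (codeConst (lv y.2)) (codeConst y.2.1)) (ccode y.2.1)))

theorem oracleDecidable_isAccurate (hlv : OracleComputable P.oracle lv) (hgc : Primrec gcode)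
    (hcc : Primrec ccode) :
    OracleDecidable P.oracle fun A => IsAccurate (P.oracle A) (lv A) gcode ccode := by
  have h1 : OracleDecidable P.oracle fun A (z : (ℕ × ℕ × ℕ) × ℕ × ℕ) => 0 < evalCode (P.oracle A)
      (codeSub (gcode (z.2.2, z.1.2.1 / 2 ^ (z.1.1 + 1), z.1.2.1))
        (codeAdd (codeDiv (codeConst z.2.1) (codeConst z.1.2.1)) (ccode z.1.2.1))) :=
    .pos (by fun_prop)
  have h2 : OracleComputable P.oracle fun A (y : ℕ × ℕ × ℕ) =>
      (y, lv A y.2, ⌈‖gridPoint y.2.1 y.2.2‖⌉₊) :=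
    .pair (.of_primrec (by fun_prop)) (.pair (hlv.comp_primrec (by fun_prop))
      (oracleComputable_ceil.comp_primrec (f := fun y : ℕ × ℕ × ℕ => y.2) (by fun_prop)))
  have h3 := OracleDecidable.comp h1 h2
  exact h3

theorem div_two_pow_div_le {N n : ℕ} : ((N / 2 ^ (n + 1) : ℕ) : ℝ) / N ≤ (2 : ℝ)⁻¹ ^ (n + 1) := by
  by_cases hN : N = 0
  · simp [hN]
  have hN' : (0 : ℝ) < N := by positivity
  rw [div_le_iff₀ hN', inv_pow, ← div_eq_inv_mul]
  exact_mod_cast Nat.cast_div_le (m := N) (n := 2 ^ (n + 1)) (α := ℝ)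

/-- The quotient `N / 2 ^ (n + 1)` is at least `2`, so rounding it down loses at most half of it. -/
theorem le_div_two_pow_div {N n : ℕ} (hN : 2 ^ (n + 2) ≤ N) :
    (2 : ℝ)⁻¹ ^ (n + 2) ≤ ((N / 2 ^ (n + 1) : ℕ) : ℝ) / N := by
  have hN' : (0 : ℝ) < N := by
    exact_mod_cast lt_of_lt_of_le (by positivity) hN
  have h1 : (2 : ℝ) ^ (n + 2) ≤ N := by exact_mod_cast hN
  have h2 : (N : ℝ) < 2 ^ (n + 1) * ((N / 2 ^ (n + 1) : ℕ) + 1) := by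
    exact_mod_cast Nat.lt_mul_div_succ N (show 0 < 2 ^ (n + 1) by positivity)
  have h3 : (0 : ℝ) < 2 ^ (n + 1) := by positivity
  rw [le_div_iff₀ hN', inv_pow, inv_mul_le_iff₀ (by positivity)]
  rw [pow_succ] at h1 ⊢
  nlinarith

/-- If the values of `F` on the grid are computed from signs of codes, then the outputs
`minimiserSet` can be chosen adaptively by a machine. -/
theorem realises_minimiserSet (k₀ : P.Idx) (hlv : OracleComputable P.oracle lv)
    (hφ : ∀ A N x, (lv A (N, x) : ℝ) / N = φ A N (gridPoint N x))
    (happ : ∀ A, IsApprox (S A) (γ A) (φ A) (c A)) (hsol : ∀ A, (P.sol A).1 = S A)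
    (hg : IsResolventControl g)
    (hγ : ∀ A (m : ℕ) (z : ℂ), ‖z‖ ≤ m → (g m (Metric.infNndist z (S A)) : ℝ) ≤ γ A z)
    (hcc : Primrec ccode) (hc : ∀ A N, evalCode (P.oracle A) (ccode N) = c A N)
    (hgc : Primrec gcode)
    (hgv : ∀ A m k N, 1 ≤ N → evalCode (P.oracle A) (gcode (m, k, N)) =
      g m ((k : ℝ≥0) / (N : ℝ≥0))) :
    Realises P fun n A => minimiserSet n (φ A n) g := by
  classical
  set p : P.Dom → ℕ × ℕ → Prop := fun A => IsOutput (lv A) (radiusIndex (lv A) g) with hpdef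
  have hp : OracleDecidable P.oracle p :=
    oracleDecidable_isOutput hlv (oracleComputable_radiusIndex hlv hg hgc hgv)
  have hmem : ∀ A N x, 1 ≤ N → (p A (N, x) ↔ gridPoint N x ∈ minimiserSet N (φ A N) g) :=
    fun A N x hN => isOutput_iff hN (hφ A) x
  have hsub : ∀ A N, minimiserSet N (φ A N) g ⊆ grid N := fun A N _ ⟨_, _, _, h, _⟩ => h.2
  have htend := fun A => (happ A).tendsto_minimiserSet hg (hγ A)
  have hacc : ∀ A n N x, 1 ≤ N → (IsAccurate (P.oracle A) (lv A) gcode ccode (n, N, x) ↔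
      φ A N (gridPoint N x) + c A N < g ⌈‖gridPoint N x‖⌉₊
        (((N / 2 ^ (n + 1) : ℕ) : ℝ≥0) / (N : ℝ≥0))) := by
    intro A n N x hN
    unfold IsAccurate
    rw [evalCode_sub, evalCode_add, evalCode_div, evalCode_const, evalCode_const, hgv A _ _ _ hN,
      hc, sub_pos, hφ]
  -- the condition under which the output is accepted
  let test : P.Dom → ℕ × ℕ → Prop := fun A y =>
    y.1 < y.2.unpair.1 ∧
    (∃ x < gridSize y.2.unpair.1 * gridSize y.2.unpair.1, p A (y.2.unpair.1, x) ∧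
      gridNormSq y.2.unpair.1 x ≤
        (y.2.unpair.1 * y.2.unpair.2) * (y.2.unpair.1 * y.2.unpair.2)) ∧
    ∀ x < gridSize y.2.unpair.1 * gridSize y.2.unpair.1, p A (y.2.unpair.1, x) →
      gridNormSq y.2.unpair.1 x ≤ (y.2.unpair.1 * (4 * y.1 + 10 + y.2.unpair.2)) *
        (y.2.unpair.1 * (4 * y.1 + 10 + y.2.unpair.2)) →
      IsAccurate (P.oracle A) (lv A) gcode ccode (y.1, y.2.unpair.1, x)
  have htest : OracleDecidable P.oracle test := by
    have h1 : OracleDecidable P.oracle fun A (z : (ℕ × ℕ) × ℕ) => p A (z.1.2.unpair.1, z.2) :=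
      hp.comp_primrec (f := fun z : (ℕ × ℕ) × ℕ => (z.1.2.unpair.1, z.2)) (by fun_prop)
    have h2 : OracleDecidable P.oracle fun A (z : (ℕ × ℕ) × ℕ) =>
        IsAccurate (P.oracle A) (lv A) gcode ccode (z.1.1, z.1.2.unpair.1, z.2) :=
      (oracleDecidable_isAccurate hlv hgc hcc).comp_primrec
        (f := fun z : (ℕ × ℕ) × ℕ => (z.1.1, z.1.2.unpair.1, z.2)) (by fun_prop)
    refine .and (.of_primrec (by fun_prop)) (.and ?_ ?_)
    · exact (h1.and (.of_primrec (p := fun z : (ℕ × ℕ) × ℕ => gridNormSq z.1.2.unpair.1 z.2 ≤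
        (z.1.2.unpair.1 * z.1.2.unpair.2) * (z.1.2.unpair.1 * z.1.2.unpair.2))
        (by fun_prop))).exists_lt (.of_primrec (by fun_prop))
    · exact (h1.imp ((OracleDecidable.of_primrec (p := fun z : (ℕ × ℕ) × ℕ =>
        gridNormSq z.1.2.unpair.1 z.2 ≤ (z.1.2.unpair.1 * (4 * z.1.1 + 10 + z.1.2.unpair.2)) *
          (z.1.2.unpair.1 * (4 * z.1.1 + 10 + z.1.2.unpair.2))) (by fun_prop)).imp
            h2)).forall_lt (.of_primrec (by fun_prop))
  have hex : ∀ A n, ∃ s, test A (n, s) := by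
    intro A n
    obtain ⟨l, hl⟩ := (happ A).nonempty
    -- Eventually some output point lies within `1` of the spectral point `l`, so `W` bounds its
    -- modulus. The search runs over codes of pairs `(N, W)`, since `W` is not known beforehand.
    set W : ℕ := ⌈‖l‖⌉₊ + 1 with hW
    obtain ⟨N, ⟨⟨w, hw, hwl⟩, h2⟩, h3, h4⟩ :=
      ((((happ A).eventually_exists_minimiser hg hl one_pos).and
        ((happ A).eventually_compInvg_le hg (hγ A) ((4 * n + 10 + W : ℕ) : ℝ)
          (δ := (2 : ℝ)⁻¹ ^ (n + 2)) (by positivity))).and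
        ((eventually_gt_atTop n).and (eventually_ge_atTop (2 ^ (n + 2))))).exists
    have hN : 1 ≤ N := by omega
    refine ⟨Nat.pair N W, ?_⟩
    simp only [test, Nat.unpair_pair]
    refine ⟨h3, ?_, fun x hx hpx hxn => ?_⟩
    · obtain ⟨x, hx, rfl⟩ := exists_gridPoint_eq hN (hsub A N hw)
      refine ⟨x, hx, (hmem A N x hN).2 hw, (norm_gridPoint_le_iff hN x W).1 ?_⟩
      have h5 := norm_le_norm_add_dist (gridPoint N x) l
      have h6 := Nat.le_ceil ‖l‖
      rw [hW]
      push_cast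
      linarith
    · rw [hacc A n N x hN]
      have h5 := h2 _ ((hmem A N x hN).1 hpx) ((norm_gridPoint_le_iff hN x _).2 hxn)
      -- The estimate was required to be at most `2⁻⁽ⁿ⁺²⁾`, which is below the rounded value of
      -- `2⁻⁽ⁿ⁺¹⁾` on the grid used by the test.
      refine (lt_apply_compInvg (hg ⌈‖gridPoint N x‖⌉₊).2.2.2 hN _).trans_le ?_
      refine NNReal.coe_le_coe.2 ((hg _).2.1.monotone ?_)
      rw [← NNReal.coe_le_coe, Real.coe_toNNReal _ (compInvg_nonneg _ _ _)]
      push_cast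
      exact h5.trans (le_div_two_pow_div h4)
  have hG : OracleComputable P.oracle fun A n => (Nat.find (hex A n)).unpair.1 := by
    have h1 : OracleComputable P.oracle fun A n => Nat.find (hex A n) :=
      htest.find (fun A n => Nat.find_spec (hex A n)) fun A n k hk => Nat.find_min (hex A n) hk
    exact OracleComputable.map (f := fun s : ℕ => s.unpair.1) (by fun_prop) h1
  refine realises_of_oracleComputable P _ k₀ (oracleComputable_output hp hG)
    (fun A => ⟨fun n hn => minimiserSet_finite hn _ g, (htend A).1, ?_⟩) fun n A => ?_
  · rw [hsol A]
    exact (htend A).2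
  · obtain ⟨h1, ⟨x, hx, hpx, hxW⟩, h3⟩ := Nat.find_spec (hex A n)
    set N := (Nat.find (hex A n)).unpair.1 with hNdef
    set W := (Nat.find (hex A n)).unpair.2
    simp only at h1 hx hpx hxW h3
    have hN : 1 ≤ N := by omega
    have hne : gridPoint N x ∈ minimiserSet N (φ A N) g := (hmem A N x hN).1 hpx
    -- The enclosing set is the output together with the spectrum. The accepted test bounds the
    -- error at all output points in the ball that matters for the precision `2⁻ⁿ`.
    refine ⟨h1, setOf_mem_output hN (hsub A _) fun x => hmem A _ x hN, ⟨_, hne⟩,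
      ⟨minimiserSet N (φ A N) g ∪ S A,
        ((minimiserSet_finite hN _ g).isClosed).union (happ A).closed, ⟨_, Or.inl hne⟩⟩,
      Set.subset_union_left, ?_⟩
    rw [hsol A]
    refine dAW_union_le hne ((norm_gridPoint_le_iff hN x W).2 hxW) (happ A).nonempty
      fun w hw hwn => ?_
    obtain ⟨y, hy, rfl⟩ := exists_gridPoint_eq hN (hsub A N hw)
    have h4 := h3 y hy ((hmem A N y hN).2 hw) ((norm_gridPoint_le_iff hN y _).1
      (by push_cast; exact hwn))
    rw [hacc A n N y hN] at h4
    exact ((happ A).infDist_le hg (hγ A) hN _).trans ((compInvg_le_div h4).trans div_two_pow_div_le)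

end Spectrum

/-! ### Consequences for `Σ₁`, error bounds, and access to evaluations through the oracle. -/

theorem Realises.sigmaOne {P : Problem.{u}} {R : ℕ → P.Dom → Set ℂ} (h : Realises P R) :
    SigmaOne .arithmetic P := by
  obtain ⟨-, Γ, hΓ, -⟩ := h
  exact ⟨⟨Γ, hΓ.1⟩, Γ, hΓ⟩

theorem isResolventControl_id : IsResolventControl fun _ => id := fun _ =>
  ⟨continuous_id, strictMono_id, fun _ => Iff.rfl, tendsto_id⟩

theorem IsApprox.hasErrorBounds {P : Problem.{u}} {φ : P.Dom → ℕ → ℂ → ℝ} {S : P.Dom → Set ℂ}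
    {γ : P.Dom → ℂ → ℝ} {c : P.Dom → ℕ → ℝ} {g : ℕ → ℝ≥0 → ℝ≥0}
    (happ : ∀ A, IsApprox (S A) (γ A) (φ A) (c A)) (hsol : ∀ A, (P.sol A).1 = S A)
    (hg : IsResolventControl g)
    (hγ : ∀ A (m : ℕ) (z : ℂ), ‖z‖ ≤ m → (g m (Metric.infNndist z (S A)) : ℝ) ≤ γ A z) :
    HasErrorBounds P (fun n A => minimiserSet n (φ A n) g)
      (fun n A z => compInvg n (φ A n z + c A n) (g ⌈‖z‖⌉₊))
      (fun n A => sSup ((fun z => compInvg n (φ A n z + c A n) (g ⌈‖z‖⌉₊)) ''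
        minimiserSet n (φ A n) g)) := by
  refine fun A => ⟨fun n hn z hz => ⟨?_, ?_⟩, fun r δ hδ =>
    (happ A).eventually_compInvg_le hg (hγ A) r hδ⟩
  · rw [hsol A]
    exact (happ A).infDist_le hg (hγ A) hn z
  · exact le_csSup ((minimiserSet_finite hn _ _).image _).bddAbove (Set.mem_image_of_mem _ hz)

theorem Problem.oracle_encode (P : Problem.{u}) (A : P.Dom) (k : P.Idx) :
    P.oracle A (P.enc.encode k) = P.eval k A := by
  unfold Problem.oracle
  rw [P.enc.encodek]

theorem evalPair_re_im (O : ℕ → ℂ) (k : ℕ) : evalPair O (codeRe k, codeIm k) = O k := by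
  apply Complex.ext <;> simp [evalPair]

/-- A natural number whose value is available is computable. -/
theorem oracleComputable_of_eval {X : Type*} {𝒪 : X → ℕ → ℂ} {F : X → ℕ → ℕ} {idx : ℕ → ℕ}
    (hidx : Primrec idx) (h : ∀ A n, 𝒪 A (idx n) = F A n) : OracleComputable 𝒪 F := by
  have h1 : OracleDecidable 𝒪 fun A (y : ℕ × ℕ) =>
      ¬ 0 < evalCode (𝒪 A) (codeSub (codeRe (idx y.1)) (codeConst y.2)) :=
    .not (.pos (by fun_prop))
  have h2 : ∀ A n k, ¬ 0 < evalCode (𝒪 A) (codeSub (codeRe (idx n)) (codeConst k)) ↔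
      F A n ≤ k := fun A n k => by
    rw [evalCode_sub, evalCode_re, evalCode_const, h, Complex.natCast_re, sub_pos, not_lt,
      Nat.cast_le]
  exact h1.find (fun A n => (h2 A n _).2 le_rfl) fun A n k hk hcon =>
    absurd ((h2 A n k).1 hcon) (by omega)

/-! ## Operators with known dispersion -/

section Dispersion

variable {f : ℕ → ℕ} {Class : DispOp f → Prop} {Ξ : DispOp f → Cl} {K : Type} [Encodable K]
  {κ : K → ℂ}

/-- The number is the standard encoding of the index: left summands are encoded by `2 k`, right
summands by `2 k + 1`, and pairs by `Nat.pair`. The same pattern gives the other evaluations. -/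
theorem dispProblem_oracle_entry (A : (dispProblem f Class Ξ K κ).Dom) (i j : ℕ) :
    (dispProblem f Class Ξ K κ).oracle A (2 * (2 * Nat.pair i j)) = A.1.mat i j :=
  Problem.oracle_encode _ A (.inl (.inl (i, j)))

theorem dispProblem_oracle_f (A : (dispProblem f Class Ξ K κ).Dom) (n : ℕ) :
    (dispProblem f Class Ξ K κ).oracle A (2 * (2 * (2 * n) + 1)) = f n :=
  Problem.oracle_encode _ A (.inl (.inr (.inl n)))

theorem dispProblem_oracle_c (A : (dispProblem f Class Ξ K κ).Dom) (n : ℕ) :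
    (dispProblem f Class Ξ K κ).oracle A (2 * (2 * (2 * n + 1) + 1)) = (A.1.c n : ℂ) :=
  Problem.oracle_encode _ A (.inl (.inr (.inr n)))

theorem dispProblem_oracle_const (A : (dispProblem f Class Ξ K κ).Dom) (k : K) :
    (dispProblem f Class Ξ K κ).oracle A (2 * Encodable.encode k + 1) = κ k :=
  Problem.oracle_encode _ A (.inr k)

theorem dispProblem_level :
    OracleComputable (dispProblem f Class Ξ K κ).oracle
      fun A (y : ℕ × ℕ) => level A.1.mat (f y.1) y.1 y.2 :=
  oracleComputable_level
    (code := fun i j => (codeRe (2 * (2 * Nat.pair i j)), codeIm (2 * (2 * Nat.pair i j))))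
    (rows := fun _ => f)
    (show Primrec fun y : ℕ × ℕ =>
      (codeRe (2 * (2 * Nat.pair y.1 y.2)), codeIm (2 * (2 * Nat.pair y.1 y.2))) by fun_prop)
    (fun A i j => by rw [evalPair_re_im, dispProblem_oracle_entry])
    (oracleComputable_of_eval (idx := fun n => 2 * (2 * (2 * n) + 1)) (by fun_prop)
      dispProblem_oracle_f)
    (fun A n z hn => stopSet_nonempty (Equiv.refl ℕ) A.1.admissible hn z)

theorem dispProblem_code_c (A : (dispProblem f Class Ξ K κ).Dom) (n : ℕ) :
    evalCode ((dispProblem f Class Ξ K κ).oracle A) (codeRe (2 * (2 * (2 * n + 1) + 1))) =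
      (A.1.c n : ℝ) := by
  rw [evalCode_re, dispProblem_oracle_c, Complex.ratCast_re]

theorem realises_compSpecUB_dispProblem (hf : ∀ n, n ≤ f n) {g : ℕ → ℝ≥0 → ℝ≥0}
    (hg : IsResolventControl g) (hγ : ∀ A : DispOp f, Class A → HasResolventBound g A.op)
    {gcode : ℕ × ℕ × ℕ → ℕ} (hgc : Primrec gcode)
    (hgv : ∀ A m k N, 1 ≤ N → evalCode ((dispProblem f Class
      (fun A => specCl A.op A.spec_nonempty) K κ).oracle A) (gcode (m, k, N)) =
        g m ((k : ℝ≥0) / (N : ℝ≥0))) :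
    Realises (dispProblem f Class (fun A => specCl A.op A.spec_nonempty) K κ)
      (fun n A => compSpecUB A.1.mat n (f n) g) ∧
    HasErrorBounds (dispProblem f Class (fun A => specCl A.op A.spec_nonempty) K κ)
      (fun n A => compSpecUB A.1.mat n (f n) g)
      (fun n A => specErrAt A.1.mat n (f n) g (A.1.c n))
      (fun n A => specErr A.1.mat n (f n) g (A.1.c n)) :=
  ⟨realises_minimiserSet (.inl (.inr (.inl 0))) dispProblem_level
      (fun A N x => level_div A.1.mat (f N) N x) (fun A => A.1.isApprox hf) (fun _ => rfl) hg
      (fun A => hγ A.1 A.2) (ccode := fun n => codeRe (2 * (2 * (2 * n + 1) + 1))) (by fun_prop)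
      dispProblem_code_c hgc hgv,
    IsApprox.hasErrorBounds (fun A => A.1.isApprox hf) (fun _ => rfl) hg fun A => hγ A.1 A.2⟩

theorem realises_pseudoSpecUB_dispProblem (hf : ∀ n, n ≤ f n) {ε : ℝ} (hε : 0 < ε) :
    Realises (dispProblem f Class (fun A => pseudoSpecCl ε A.op A.spec_nonempty) Unit
      fun _ => (ε : ℂ)) (fun n A => pseudoSpecUB A.1.mat n (f n) (A.1.c n) ε) :=
  realises_sublevelGrid (P := dispProblem f Class (fun A => pseudoSpecCl ε A.op A.spec_nonempty)
    Unit fun _ => (ε : ℂ)) (.inl (.inr (.inl 0))) dispProblem_level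
    (fun A N x => level_div A.1.mat (f N) N x) (fun A => A.1.isApprox hf) hε
    (fun _ => pseudoSpec_eq hε) (ccode := fun n => codeRe (2 * (2 * (2 * n + 1) + 1)))
    (by fun_prop) dispProblem_code_c (εcode := codeRe (2 * Encodable.encode () + 1))
    fun A => by rw [evalCode_re, dispProblem_oracle_const, Complex.ofReal_re]

theorem DispOp.pseudoSpecUB_subset (hf : ∀ n, n ≤ f n) {ε : ℝ} (hε : 0 < ε) (A : DispOp f) {n : ℕ}
    (hn : 1 ≤ n) : pseudoSpecUB A.mat n (f n) (A.c n) ε ⊆ pseudoSpec A.op ε := by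
  rw [pseudoSpec_eq hε]
  exact ((A.isApprox hf).sublevelGrid_subset hn ε).trans subset_closure

end Dispersion

/-! ## Operators on graphs -/

section Graph

variable {V : Type u} {G : SimpleGraph V} {v : ℕ ≃ V} {Class : GraphOp G v → Prop}
  {Ξ : GraphOp G v → Cl} {K : Type} [Encodable K] {κ : K → ℂ}

theorem graphProblem_oracle_entry (A : (graphProblem G v Class Ξ K κ).Dom) (i j : ℕ) :
    (graphProblem G v Class Ξ K κ).oracle A (2 * (2 * Nat.pair i j)) = A.1.mat i j :=
  Problem.oracle_encode _ A (.inl (.inl (i, j)))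

theorem graphProblem_oracle_S (A : (graphProblem G v Class Ξ K κ).Dom) (n : ℕ) :
    (graphProblem G v Class Ξ K κ).oracle A (2 * (2 * n + 1)) = A.1.S n :=
  Problem.oracle_encode _ A (.inl (.inr n))

theorem graphProblem_oracle_const (A : (graphProblem G v Class Ξ K κ).Dom) (k : K) :
    (graphProblem G v Class Ξ K κ).oracle A (2 * Encodable.encode k + 1) = κ k :=
  Problem.oracle_encode _ A (.inr k)

/-- The maximum is accumulated by recursion over the first `n` indices, reading one value of `S` at
each step. -/
theorem graphProblem_rows :
    OracleComputable (graphProblem G v Class Ξ K κ).oracle fun A n => A.1.rows n := by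
  have h1 : OracleComputable (graphProblem G v Class Ξ K κ).oracle fun A n => A.1.S n :=
    oracleComputable_of_eval (idx := fun n => 2 * (2 * n + 1)) (by fun_prop) graphProblem_oracle_S
  have h2 : OracleComputable (graphProblem G v Class Ξ K κ).oracle
      fun A (y : ℕ × ℕ × ℕ) => max y.2.2 (A.1.S y.2.1 + 1) := by
    have h3 : OracleComputable (graphProblem G v Class Ξ K κ).oracle
        fun A (y : ℕ × ℕ × ℕ) => (y.2.2, A.1.S y.2.1) :=
      .pair (.of_primrec (by fun_prop)) (h1.comp_primrec (by fun_prop))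
    exact OracleComputable.map (f := fun z : ℕ × ℕ => max z.1 (z.2 + 1))
      (Primrec.nat_max.comp (by fun_prop) (by fun_prop)) h3
  have h4 := (OracleComputable.natRec (F := fun _ (n : ℕ) => n) (.of_primrec Primrec.id)
    h2).comp_primrec (f := fun n : ℕ => (n, n)) (by fun_prop)
  have h5 : ∀ (A : GraphOp G v) (n k : ℕ), Nat.rec (motive := fun _ => ℕ) n
      (fun j b => max b (A.S j + 1)) k = max n ((Finset.range k).sup fun j => A.S j + 1) := by
    intro A n k
    induction k with
    | zero => simp
    | succ k ih =>
      simp only [ih, Finset.range_add_one, Finset.sup_insert]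
      rw [max_assoc]
      congr 1
      exact max_comm _ _
  convert h4 using 3 with A n
  exact (h5 A.1 n n).symm

theorem graphProblem_level :
    OracleComputable (graphProblem G v Class Ξ K κ).oracle
      fun A (y : ℕ × ℕ) => level A.1.mat (A.1.rows y.1) y.1 y.2 :=
  oracleComputable_level (𝒪 := (graphProblem G v Class Ξ K κ).oracle) (a := fun A => A.1.mat)
    (code := fun i j => (codeRe (2 * (2 * Nat.pair i j)), codeIm (2 * (2 * Nat.pair i j))))
    (rows := fun A n => A.1.rows n)
    (show Primrec fun y : ℕ × ℕ =>
      (codeRe (2 * (2 * Nat.pair y.1 y.2)), codeIm (2 * (2 * Nat.pair y.1 y.2))) by fun_prop)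
    (fun A i j => by rw [evalPair_re_im, graphProblem_oracle_entry]) graphProblem_rows
    (fun A n z hn => stopSet_nonempty v A.1.admissible hn z)

theorem realises_compSpecUB_graphProblem {g : ℕ → ℝ≥0 → ℝ≥0}
    (hg : IsResolventControl g) (hγ : ∀ A : GraphOp G v, Class A → HasResolventBound g A.op)
    {gcode : ℕ × ℕ × ℕ → ℕ} (hgc : Primrec gcode)
    (hgv : ∀ A m k N, 1 ≤ N → evalCode ((graphProblem G v Class
      (fun A => specCl A.op A.spec_nonempty) K κ).oracle A) (gcode (m, k, N)) =
        g m ((k : ℝ≥0) / (N : ℝ≥0))) :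
    Realises (graphProblem G v Class (fun A => specCl A.op A.spec_nonempty) K κ)
      (fun n A => compSpecUB A.1.mat n (A.1.rows n) g) ∧
    HasErrorBounds (graphProblem G v Class (fun A => specCl A.op A.spec_nonempty) K κ)
      (fun n A => compSpecUB A.1.mat n (A.1.rows n) g)
      (fun n A => specErrAt A.1.mat n (A.1.rows n) g 0)
      (fun n A => specErr A.1.mat n (A.1.rows n) g 0) :=
  ⟨realises_minimiserSet (.inl (.inr 0)) graphProblem_level
      (fun A N x => level_div A.1.mat (A.1.rows N) N x) (fun A => A.1.isApprox) (fun _ => rfl) hg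
      (fun A => hγ A.1 A.2) (ccode := fun _ => codeConst 0) (by fun_prop)
      (fun A N => by rw [evalCode_const, Nat.cast_zero]) hgc hgv,
    IsApprox.hasErrorBounds (fun A => A.1.isApprox) (fun _ => rfl) hg fun A => hγ A.1 A.2⟩

theorem realises_pseudoSpecUB_graphProblem {ε : ℝ} (hε : 0 < ε) :
    Realises (graphProblem G v Class (fun A => pseudoSpecCl ε A.op A.spec_nonempty) Unit
      fun _ => (ε : ℂ)) (fun n A => pseudoSpecUB A.1.mat n (A.1.rows n) 0 ε) :=
  have : Nonempty V := ⟨v 0⟩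
  realises_sublevelGrid (P := graphProblem G v Class
    (fun A => pseudoSpecCl ε A.op A.spec_nonempty) Unit fun _ => (ε : ℂ)) (.inl (.inr 0)) graphProblem_level
    (fun A N x => level_div A.1.mat (A.1.rows N) N x) (fun A => A.1.isApprox) hε
    (fun _ => pseudoSpec_eq hε) (ccode := fun _ => codeConst 0)
    (by fun_prop) (fun A N => by rw [evalCode_const, Nat.cast_zero])
    (εcode := codeRe (2 * Encodable.encode () + 1))
    fun A => by rw [evalCode_re, graphProblem_oracle_const, Complex.ofReal_re]

theorem GraphOp.pseudoSpecUB_subset {ε : ℝ} (hε : 0 < ε) (A : GraphOp G v) {n : ℕ}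
    (hn : 1 ≤ n) : pseudoSpecUB A.mat n (A.rows n) 0 ε ⊆ pseudoSpec A.op ε := by
  have : Nonempty V := ⟨v 0⟩
  rw [pseudoSpec_eq hε]
  exact (A.isApprox.sublevelGrid_subset hn ε).trans subset_closure

end Graph

theorem primrec_code_gEval :
    Primrec fun y : ℕ × ℕ × ℕ => codeRe (2 * Encodable.encode y + 1) := by fun_prop

end SCI

/-! ### The classification theorem. -/

theorem theorem3p6
    -- the graph, with an enumeration of its countably many vertices
    {V : Type*} (G : SimpleGraph V) (hG : G.Connected) (v : ℕ ≃ V)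
    -- the dispersion function, the functions controlling the resolvent, and `ε`
    (f : ℕ → ℕ) (hf : ∀ n, n ≤ f n)
    (g : ℕ → ℝ≥0 → ℝ≥0) (hg : IsResolventControl g)
    (ε : ℝ) (hε : 0 < ε) :
    -- classification of the spectrum
    (¬ DeltaOne .general (diagSpec f) ∧ SigmaOne .arithmetic (diagSpec f)) ∧
    (((∀ m x, g m x ≤ x) → ¬ DeltaOne .general (resolventSpec f g)) ∧
      SigmaOne .arithmetic (resolventSpec f g)) ∧
    (((∀ m x, g m x ≤ x) → ¬ DeltaOne .general (graphSpec G v g)) ∧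
      SigmaOne .arithmetic (graphSpec G v g)) ∧
    -- classification of the pseudospectrum
    (¬ DeltaOne .general (diagPseudo f ε) ∧ SigmaOne .arithmetic (diagPseudo f ε)) ∧
    (¬ DeltaOne .general (dispPseudo f ε) ∧ SigmaOne .arithmetic (dispPseudo f ε)) ∧
    (¬ DeltaOne .general (graphPseudo G v ε) ∧ SigmaOne .arithmetic (graphPseudo G v ε)) ∧
    -- the routine `CompSpecUB` realises the classifications of the spectrum
    -- (with `g_m(x) = x` for diagonal operators), with guaranteed error bounds
    (Realises (diagSpec f) (fun n A => compSpecUB A.1.mat n (f n) (fun _ => id)) ∧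
      HasErrorBounds (diagSpec f) (fun n A => compSpecUB A.1.mat n (f n) (fun _ => id))
        (fun n A => specErrAt A.1.mat n (f n) (fun _ => id) (A.1.c n))
        (fun n A => specErr A.1.mat n (f n) (fun _ => id) (A.1.c n))) ∧
    (Realises (resolventSpec f g) (fun n A => compSpecUB A.1.mat n (f n) g) ∧
      HasErrorBounds (resolventSpec f g) (fun n A => compSpecUB A.1.mat n (f n) g)
        (fun n A => specErrAt A.1.mat n (f n) g (A.1.c n))
        (fun n A => specErr A.1.mat n (f n) g (A.1.c n))) ∧
    (Realises (graphSpec G v g) (fun n A => compSpecUB A.1.mat n (A.1.rows n) g) ∧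
      HasErrorBounds (graphSpec G v g) (fun n A => compSpecUB A.1.mat n (A.1.rows n) g)
        (fun n A => specErrAt A.1.mat n (A.1.rows n) g 0)
        (fun n A => specErr A.1.mat n (A.1.rows n) g 0)) ∧
    -- the routine `PseudoSpecUB` realises the classifications of the pseudospectrum, and its
    -- output is contained in the pseudospectrum
    (Realises (diagPseudo f ε) (fun n A => pseudoSpecUB A.1.mat n (f n) (A.1.c n) ε) ∧
      ∀ (A : (diagPseudo f ε).Dom) (n : ℕ), 1 ≤ n →
        pseudoSpecUB A.1.mat n (f n) (A.1.c n) ε ⊆ pseudoSpec A.1.op ε) ∧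
    (Realises (dispPseudo f ε) (fun n A => pseudoSpecUB A.1.mat n (f n) (A.1.c n) ε) ∧
      ∀ (A : (dispPseudo f ε).Dom) (n : ℕ), 1 ≤ n →
        pseudoSpecUB A.1.mat n (f n) (A.1.c n) ε ⊆ pseudoSpec A.1.op ε) ∧
    (Realises (graphPseudo G v ε) (fun n A => pseudoSpecUB A.1.mat n (A.1.rows n) 0 ε) ∧
      ∀ (A : (graphPseudo G v ε).Dom) (n : ℕ), 1 ≤ n →
        pseudoSpecUB A.1.mat n (A.1.rows n) 0 ε ⊆ pseudoSpec A.1.op ε) := by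
  have hdiag : ∀ A : DispOp f, A.IsDiagonal → HasResolventBound (fun _ => id) A.op := fun A hA =>
    hasResolventBound_of_diagonal (Equiv.refl ℕ) A.admissible hA fun _ _ => le_rfl
  -- For `g_m(x) = x` the value needed is `k / N`, a quotient of constants, so no evaluations of `g`
  -- are required.
  have hD := realises_compSpecUB_dispProblem (K := Empty) (κ := nofun) hf isResolventControl_id
    hdiag (gcode := fun y => codeDiv (codeConst y.2.1) (codeConst y.2.2)) (by fun_prop)
    (fun A m k N _ => by simp)
  have hR := realises_compSpecUB_dispProblem (Class := fun A => HasResolventBound g A.op)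
    (κ := gEval g) hf hg (fun _ h => h) primrec_code_gEval
    (fun A m k N _ => by rw [evalCode_re, dispProblem_oracle_const]; rfl)
  have hGr := realises_compSpecUB_graphProblem (G := G) (v := v)
    (Class := fun A => HasResolventBound g A.op) (κ := gEval g) hg (fun _ h => h)
    primrec_code_gEval (fun A m k N _ => by rw [evalCode_re, graphProblem_oracle_const]; rfl)
  have hD' := realises_pseudoSpecUB_dispProblem (Class := fun A : DispOp f => A.IsDiagonal) hf hε
  have hR' := realises_pseudoSpecUB_dispProblem (Class := fun _ : DispOp f => True) hf hε
  have hGr' := realises_pseudoSpecUB_graphProblem (G := G) (v := v) (Class := fun _ => True) hε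
  refine ⟨⟨?_, hD.1.sigmaOne⟩, ⟨fun hgx => ?_, hR.1.sigmaOne⟩, ⟨fun hgx => ?_, hGr.1.sigmaOne⟩,
    ⟨?_, hD'.sigmaOne⟩, ⟨?_, hR'.sigmaOne⟩, ⟨?_, hGr'.sigmaOne⟩, hD, hR, hGr,
    ⟨hD', fun A n hn => A.1.pseudoSpecUB_subset hf hε hn⟩,
    ⟨hR', fun A n hn => A.1.pseudoSpecUB_subset hf hε hn⟩,
    ⟨hGr', fun A n hn => A.1.pseudoSpecUB_subset hε hn⟩⟩
  · exact not_deltaOne_dispProblem hf _ _ _ _ 1 (fun _ h => h) fun k =>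
      one_le_infDist_sub_spec (Equiv.refl ℕ) k 0 le_rfl
  · exact not_deltaOne_dispProblem hf _ _ _ _ 1
      (fun A hA => hasResolventBound_of_diagonal (Equiv.refl ℕ) A.admissible hA hgx) fun k =>
      one_le_infDist_sub_spec (Equiv.refl ℕ) k 0 le_rfl
  · exact not_deltaOne_graphProblem G v _ _ _ _ 1
      (fun k t => hasResolventBound_of_diagonal v (isAdmissible_rankOne (v k) t)
        (entry_rankOne_diagonal (v k) t) hgx) fun k =>
      one_le_infDist_sub_spec v (v k) (v 0) le_rfl
  -- The eigenvalue `ε + 1` stays at distance at least `1` from the pseudospectrum of the zero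
  -- operator; for spectra the eigenvalue `1` is enough.
  · exact not_deltaOne_dispProblem hf _ _ _ _ (ε + 1) (fun _ h => h) fun k =>
      one_le_infDist_sub_pseudoSpec (Equiv.refl ℕ) k 0 hε le_rfl
  · exact not_deltaOne_dispProblem hf _ _ _ _ (ε + 1) (fun _ _ => trivial) fun k =>
      one_le_infDist_sub_pseudoSpec (Equiv.refl ℕ) k 0 hε le_rfl
  · exact not_deltaOne_graphProblem G v _ _ _ _ (ε + 1) (fun _ _ => trivial) fun k =>
      one_le_infDist_sub_pseudoSpec v (v k) (v 0) hε le_rfl
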